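/- Let $\mathcal D\subset\mathbf C$ be the open unit disc and let $X$ be a complex manifold of dimension $n$. A complex semi-stable degeneration is a proper holomorphic map $\pi\colon X\to\mathcal D$ which is regular at all points outside the special fibre $X_0=\pi^{-1}(0)$ and such that every $p\in X_0$ has a centred holomorphic chart with $\pi(z)=z_1\cdots z_k$ for some $1\le k\le n$. A real structure is an antiholomorphic involution $\iota\colon X\to X$ with $\pi\circ\iota=\overline{\pi}$; write $\mathbf R$ for fixed points of $\iota$ (and of the involutions it induces). The degeneration is totally real if for every $p\in\mathbf R X_0$ the differential $d\iota\colon T_pX\to T_pX$ maps each hyperplane of the tangent cone $T_pX_0$ to itself. Let $\widetilde\pi\colon\widetilde X\to\widetilde{\mathcal D}=S^1\times[0,1)$ be the real-oriented blow-up of $\pi$: $\widetilde X\to X$ is the real-oriented blow-up of $X$ along $X_0$, which in a chart as above is $(S^1\times\mathbf R_{\ge0})^k\times\mathbf C^{n-k}\to\mathbf C^k\times\mathbf C^{n-k}$, $(\theta_j,r_j)_{j\le k}\mapsto(\theta_jr_j)_{j\le k}$, and there $\widetilde\pi=(\theta_1\cdots\theta_k,\,r_1\cdots r_k)$; the induced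 real structure on $\widetilde X$ is locally $(\theta,r)\mapsto(\theta^{-1},r)$ in coordinates adapted to $\iota$. Put $\widetilde X^+=\widetilde\pi^{-1}(\{1\}\times[0,1))$ and $\widetilde X^+_0=\widetilde\pi^{-1}(1,0)$. Let $X_1,\dots,X_m\subset X$ be closed complex submanifolds with $\iota(X_i)=X_i$ that form a transversal collection: for every $p\in X$, with $H_{p,1},\dots,H_{p,k}\subset T_pX$ the hyperplanes whose union is the tangent cone at $p$ of the fibre of $\pi$ through $p$, the codimension in $T_pX$ of the intersection of all $H_{p,j}$ and all $T_pX_i$ with $p\in X_i$ is the sum of the codimensions of these subspaces. Let $\widetilde X_i$ be the real-oriented blow-up of $X_i$ along $X_i\cap X_0$, regarded as a subset of $\widetilde X$ through the natural map, and let $\widetilde X_i^+=\widetilde X_i\cap\widetilde X^+$, $\widetilde X_{i,0}^+=\widetilde X_i\cap\widetilde X_0^+$. Theorem. If $(\pi,\iota)$ is a totally real semi-stable degeneration and $X_1,\dots,X_m$ is a transversal collection of real submanifolds as above, then there is a homeomorphism $$H\colon\mathbf R\widetilde X^+_0\times[0,1)\to\mathbf R\widetilde X^+$$ with $\widetilde\pi(H(x,t))=(1,t)$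 for all $(x,t)$ and $$H\bigl(\mathbf R\widetilde X^+_{i,0}\times[0,1)\bigr)=\mathbf R\widetilde X^+_i\qquad\text{for all } i=1,\dots,m.$$ In particular, for every $t\in(0,1)$ there is a homeomorphism $\mathbf R\widetilde X^+_0\to\mathbf R X_t$, where $X_t=\pi^{-1}(t)$, that maps $\mathbf R\widetilde X^+_{i,0}$ onto $\mathbf R(X_i\cap X_t)$ for all $i=1,\dots,m$. -/

import Mathlib

open Set Filter Topology Manifold
open scoped ContDiff

noncomputable section

namespace SemiStable

/-- The model space of an `n`-dimensional complex manifold. -/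
abbrev Model (n : ℕ) : Type := Fin n → ℂ

/-- The open unit disc in `ℂ`. -/
abbrev Disc : Type := Metric.ball (0 : ℂ) 1

section Manifold

variable {n : ℕ} {X : Type*} [TopologicalSpace X] [ChartedSpace (Model n) X]

/-- A complex-valued function that is holomorphic (complex differentiable) at the point `p`. -/
abbrev HolAt (f : X → ℂ) (p : X) : Prop := MDifferentiableAt 𝓘(ℂ, Model n) 𝓘(ℂ, ℂ) f p

/-- The tangent cone of a subset `A` at `p`, as a subset of `T_p X`: the limits of complex secants
of `A` at `p`, computed in the chart at `p`, in which `T_p X` is the model space. -/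
def tangentCone (A : Set X) (p : X) : Set (TangentSpace 𝓘(ℂ, Model n) p) :=
  tangentConeAt ℂ (chartAt (Model n) p '' (A ∩ (chartAt (Model n) p).source))
    (chartAt (Model n) p p)

/-- The complex hyperplanes of `T_p X` contained in the tangent cone of `A` at `p`. If `A` is a
normal crossing divisor, they are the finitely many hyperplanes whose union is the tangent cone. -/
def tangentHyperplanes (A : Set X) (p : X) :
    Set (Submodule ℂ (TangentSpace 𝓘(ℂ, Model n) p)) :=
  {L | Module.finrank ℂ (TangentSpace 𝓘(ℂ, Model n) p ⧸ L) = 1 ∧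
    (L : Set (TangentSpace 𝓘(ℂ, Model n) p)) ⊆ tangentCone A p}

/-- The tangent space at `p` of a complex submanifold `S` through `p`, as a subspace of `T_p X`. -/
def tangentSubspace (S : Set X) (p : X) : Submodule ℂ (TangentSpace 𝓘(ℂ, Model n) p) :=
  Submodule.span ℂ (tangentCone S p)

/-- A closed complex submanifold: a closed subset which, in a suitable holomorphic chart centred
at any of its points, is a coordinate subspace. -/
def IsClosedComplexSubmanifold (S : Set X) : Prop :=
  IsClosed S ∧ ∀ p ∈ S, ∃ φ ∈ IsManifold.maximalAtlas 𝓘(ℂ, Model n) ω X,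
    p ∈ φ.source ∧ φ p = 0 ∧
      ∃ d : ℕ, ∀ q ∈ φ.source, q ∈ S ↔ ∀ j : Fin n, d ≤ (j : ℕ) → φ q j = 0

/-- A self-map of a complex manifold is antiholomorphic if it is continuous and the complex
conjugate of its expression in charts is complex differentiable. -/
def IsAntiholomorphic (ι : X → X) : Prop :=
  Continuous ι ∧ ∀ p : X, DifferentiableAt ℂ
    (fun z : Model n => star (chartAt (Model n) (ι p) (ι ((chartAt (Model n) p).symm z))))
    (chartAt (Model n) p p)

/-- The (real) differential at a fixed point `p` of a self-map `ι`, as a map `T_p X → T_p X`. -/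
def differentialAtFixedPoint (ι : X → X) (p : X) :
    TangentSpace 𝓘(ℂ, Model n) p → TangentSpace 𝓘(ℂ, Model n) p :=
  fderiv ℝ (fun z : Model n => chartAt (Model n) p (ι ((chartAt (Model n) p).symm z)))
    (chartAt (Model n) p p)

end Manifold

/-! ### Semi-stable degenerations and real structures -/

/-- A complex semi-stable degeneration: a proper holomorphic map to the unit disc which is regular
over the punctured disc, and which is of the form `z_1 ⋯ z_k`, `1 ≤ k ≤ n`, in a suitable
holomorphic chart centred at any point of the special fibre. -/
structure ComplexDegeneration (n : ℕ) (X : Type*) [TopologicalSpace X]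
    [ChartedSpace (Model n) X] where
  toDisc : X → Disc
  holomorphic : ∀ p, HolAt (n := n) (fun x => (toDisc x : ℂ)) p
  proper : IsProperMap toDisc
  regular : ∀ p, (toDisc p : ℂ) ≠ 0 → Function.Surjective
    (mfderiv 𝓘(ℂ, Model n) 𝓘(ℂ, ℂ) (fun x => (toDisc x : ℂ)) p)
  normalCrossing : ∀ p, (toDisc p : ℂ) = 0 →
    ∃ φ ∈ IsManifold.maximalAtlas 𝓘(ℂ, Model n) ω X, p ∈ φ.source ∧ φ p = 0 ∧
      ∃ k : ℕ, 1 ≤ k ∧ k ≤ n ∧ ∀ q ∈ φ.source,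
        (toDisc q : ℂ) = ∏ j : Fin n, if (j : ℕ) < k then φ q j else 1

section Degeneration

variable {n : ℕ} {X : Type*} [TopologicalSpace X] [ChartedSpace (Model n) X]

/-- The function `π`, with values in `ℂ`. -/
def ComplexDegeneration.fn (π : ComplexDegeneration n X) (x : X) : ℂ := π.toDisc x

/-- The fibre `X_t`. -/
def ComplexDegeneration.fibre (π : ComplexDegeneration n X) (t : ℂ) : Set X := {x | π.fn x = t}

/-- A real structure: an antiholomorphic involution compatible with complex conjugation on the
disc. -/
structure RealStructure (π : ComplexDegeneration n X) where
  inv : X → X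
  antiholomorphic : IsAntiholomorphic (n := n) inv
  involutive : Function.Involutive inv
  conj_compat : ∀ x, π.fn (inv x) = star (π.fn x)

/-- A real structure is totally real if, at each real point of the special fibre, its
differential maps each hyperplane of the tangent cone of the special fibre to itself. -/
def RealStructure.IsTotallyReal {π : ComplexDegeneration n X} (ι : RealStructure π) : Prop :=
  ∀ p : X, ι.inv p = p → π.fn p = 0 → ∀ L ∈ tangentHyperplanes (n := n) (π.fibre 0) p,
    differentialAtFixedPoint (n := n) ι.inv p '' (L : Set (TangentSpace 𝓘(ℂ, Model n) p)) = L

/-- A real submanifold: a closed complex submanifold preserved by the real structure. -/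
def RealStructure.IsRealSubmanifold {π : ComplexDegeneration n X} (ι : RealStructure π)
    (S : Set X) : Prop :=
  IsClosedComplexSubmanifold (n := n) S ∧ MapsTo ι.inv S S

/-- A collection `S_1, …, S_m` of submanifolds is transversal (with respect to `π`) if at each
point `p` the codimension of the intersection of all the hyperplanes of the tangent cone at `p`
of the fibre through `p` and of the tangent spaces of the `S_i` through `p` is the sum of the
codimensions. -/
def ComplexDegeneration.IsTransversal (π : ComplexDegeneration n X) {m : ℕ}
    (S : Fin m → Set X) : Prop :=
  ∀ p : X, Module.finrank ℂ (TangentSpace 𝓘(ℂ, Model n) p ⧸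
      ((⨅ L ∈ tangentHyperplanes (n := n) (π.fibre (π.fn p)) p, L) ⊓
        ⨅ i : {i : Fin m // p ∈ S i}, tangentSubspace (n := n) (S i) p)) =
    (tangentHyperplanes (n := n) (π.fibre (π.fn p)) p).ncard +
      ∑ᶠ i : {i : Fin m // p ∈ S i},
        Module.finrank ℂ (TangentSpace 𝓘(ℂ, Model n) p ⧸ tangentSubspace (n := n) (S i) p)

end Degeneration

/-! ### The real-oriented blow-up

The real-oriented blow-up of a complex manifold along a normal crossing divisor `D` is constructed
as follows. Its points over `p` are the systems of phases in `S¹` of all holomorphic germs at `p`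
that are invertible outside `D`, where phases are multiplicative and the phase of a germ `f` with
`f p ≠ 0` is `f p / |f p|`. If `D = {z_1 ⋯ z_k = 0}` in coordinates centred at `p`, these germs
are uniquely of the form `u z_1 ^ a_1 ⋯ z_k ^ a_k` with a unit `u`; hence a point over `p` is given
by the phases `θ_j` of the `z_j`, `j ≤ k`, and near `p` the blow-up is
`(S¹ × ℝ≥0)^k × ℂ^(n-k)` with the map `(θ, r) ↦ θ r` on the first `k` factors.
The construction is carried out for a closed submanifold `S` of `X` and the divisor `S ∩ D` of `S`;
germs of holomorphic functions on `S` are restrictions of germs of holomorphic functions on `X`. -/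

section Blowup

variable {n : ℕ} {X : Type*} [TopologicalSpace X] [ChartedSpace (Model n) X]

/-- The functions on `X` that are holomorphic near `p` and whose restriction to `S` has no zeros
outside `D` near `p`. -/
def logMonoid (n : ℕ) {X : Type*} [TopologicalSpace X] [ChartedSpace (Model n) X]
    (S D : Set X) (p : X) : Submonoid (X → ℂ) where
  carrier := {f | (∀ᶠ q in 𝓝 p, HolAt (n := n) f q) ∧ ∀ᶠ q in 𝓝[S] p, q ∉ D → f q ≠ 0}
  one_mem' := ⟨Eventually.of_forall fun _ => mdifferentiableAt_const,
    Eventually.of_forall fun _ _ => one_ne_zero⟩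
  mul_mem' := by
    rintro f g ⟨hf, hf'⟩ ⟨hg, hg'⟩
    refine ⟨?_, ?_⟩
    · filter_upwards [hf, hg] with q h1 h2
      exact h1.mul h2
    · filter_upwards [hf', hg'] with q h1 h2 hq
      exact mul_ne_zero (h1 hq) (h2 hq)

/-- The real-oriented blow-up of the submanifold `S` of `X` along `S ∩ D`. -/
@[ext]
structure Blowup (n : ℕ) {X : Type*} [TopologicalSpace X] [ChartedSpace (Model n) X]
    (S D : Set X) where
  /-- the image under the blow-down map -/
  pt : X
  mem : pt ∈ S
  /-- the phase of a function -/
  phase : logMonoid n S D pt →* Circle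
  phase_congr : ∀ f g : logMonoid n S D pt,
    (f : X → ℂ) =ᶠ[𝓝[S] pt] (g : X → ℂ) → phase f = phase g
  phase_unit : ∀ f : logMonoid n S D pt, (f : X → ℂ) pt ≠ 0 →
    (phase f : ℂ) = (f : X → ℂ) pt / (‖(f : X → ℂ) pt‖ : ℝ)

/-- The coarsest topology for which the blow-down map is continuous and the phase of each
function `f` as above, defined over an open set `U`, is continuous over `U`. -/
instance (S D : Set X) : TopologicalSpace (Blowup n S D) :=
  TopologicalSpace.generateFrom
    ({A | ∃ U : Set X, IsOpen U ∧ A = {y | y.pt ∈ U}} ∪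
      {A | ∃ (U : Set X) (f : X → ℂ) (hf : ∀ q ∈ U, f ∈ logMonoid n S D q) (V : Set Circle),
        IsOpen U ∧ IsOpen V ∧ A = {y | ∃ h : y.pt ∈ U, y.phase ⟨f, hf _ h⟩ ∈ V}})

theorem logMonoid_univ_le (S D : Set X) (p : X) : logMonoid n univ D p ≤ logMonoid n S D p :=
  fun _ hf => ⟨hf.1, nhdsWithin_mono p (subset_univ S) hf.2⟩

/-- The natural map from the blow-up of the submanifold `S` to the blow-up of `X`. -/
def Blowup.incl {S D : Set X} (y : Blowup n S D) : Blowup n (univ : Set X) D where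
  pt := y.pt
  mem := mem_univ _
  phase := y.phase.comp (Submonoid.inclusion (logMonoid_univ_le S D y.pt))
  phase_congr f g h :=
    y.phase_congr (Submonoid.inclusion (logMonoid_univ_le S D y.pt) f)
      (Submonoid.inclusion (logMonoid_univ_le S D y.pt) g)
      (h.filter_mono (nhdsWithin_mono _ (subset_univ S)))
  phase_unit f hf := y.phase_unit (Submonoid.inclusion (logMonoid_univ_le S D y.pt) f) hf

/-! #### The blown-up family -/

theorem ComplexDegeneration.fn_mem_logMonoid (π : ComplexDegeneration n X) (S : Set X) (p : X) :
    π.fn ∈ logMonoid n S (π.fibre 0) p :=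
  ⟨Eventually.of_forall π.holomorphic, Eventually.of_forall fun _ h => h⟩

theorem ComplexDegeneration.norm_fn_mem (π : ComplexDegeneration n X) (p : X) :
    ‖π.fn p‖ ∈ Ico (0 : ℝ) 1 :=
  ⟨norm_nonneg _, mem_ball_zero_iff.1 (π.toDisc p).2⟩

/-- The blown-up family with values in the blow-up `S¹ × [0,1)` of the disc. -/
def ComplexDegeneration.blowupMap (π : ComplexDegeneration n X) {S : Set X}
    (y : Blowup n S (π.fibre 0)) : Circle × Ico (0 : ℝ) 1 :=
  (y.phase ⟨π.fn, π.fn_mem_logMonoid S y.pt⟩, ⟨‖π.fn y.pt‖, π.norm_fn_mem y.pt⟩)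

/-! #### The induced real structure -/

variable {π : ComplexDegeneration n X}

theorem holAt_star_comp {ι : X → X} (hι : IsAntiholomorphic (n := n) ι) {f : X → ℂ} {p : X}
    (hf : HolAt (n := n) f (ι p)) : HolAt (n := n) (fun x => star (f (ι x))) p := by
  rw [HolAt, mdifferentiableAt_iff] at hf ⊢
  obtain ⟨hc, hd⟩ := hf
  have hc' : ContinuousAt (fun x => f (ι x)) p := ContinuousAt.comp hc hι.1.continuousAt
  refine ⟨hc'.star, ?_⟩
  simp only [mfld_simps, differentiableWithinAt_univ] at hd ⊢
  set e := chartAt (Model n) p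
  set e' := chartAt (Model n) (ι p)
  have h2 := hι.2 p
  have hd' : DifferentiableAt ℂ (f ∘ e'.symm)
      (e' (ι (e.symm (e p)))) := by
    rw [e.left_inv (mem_chart_source _ p)]; exact hd
  have h3 := hd'.star_star.comp (e p) h2
  refine h3.congr_of_eventuallyEq ?_
  have hs : ∀ᶠ x in 𝓝 p, ι x ∈ e'.source :=
    hι.1.continuousAt.eventually (chart_source_mem_nhds _ (ι p))
  have ht : Tendsto e.symm (𝓝 (e p)) (𝓝 p) := e.tendsto_symm (mem_chart_source _ p)
  filter_upwards [ht.eventually hs] with z hz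
  have hz' : e'.symm (chartAt (Model n) (ι p) (ι (e.symm z))) = ι (e.symm z) := e'.left_inv hz
  change star (f (ι (e.symm z))) = star (f (e'.symm (star (star
    (chartAt (Model n) (ι p) (ι (e.symm z)))))))
  rw [star_star, hz']

theorem star_comp_mem_logMonoid (ι : RealStructure π) {S : Set X} (hS : MapsTo ι.inv S S)
    {p : X} {f : X → ℂ} (hf : f ∈ logMonoid n S (π.fibre 0) (ι.inv p)) :
    (fun x => star (f (ι.inv x))) ∈ logMonoid n S (π.fibre 0) p := by
  have hc : Continuous ι.inv := ι.antiholomorphic.1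
  refine ⟨?_, ?_⟩
  · filter_upwards [hc.continuousAt.eventually hf.1] with q hq
    exact holAt_star_comp ι.antiholomorphic hq
  · have ht : Tendsto ι.inv (𝓝[S] p) (𝓝[S] (ι.inv p)) :=
      hc.continuousAt.continuousWithinAt.tendsto_nhdsWithin hS
    filter_upwards [ht.eventually hf.2] with q hq hqD
    refine star_ne_zero.2 (hq fun h => hqD ?_)
    have h0 : π.fn (ι.inv q) = 0 := h
    rw [ι.conj_compat] at h0
    exact star_eq_zero.1 h0

/-- The induced real structure on the blow-up: the new phase of `f` is the conjugate of the phase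
of the function `x ↦ conj (f (ι x))`. In the local model it is `(θ, r) ↦ (θ⁻¹, r)`. -/
def Blowup.conj (ι : RealStructure π) {S : Set X} (hS : MapsTo ι.inv S S)
    (y : Blowup n S (π.fibre 0)) : Blowup n S (π.fibre 0) where
  pt := ι.inv y.pt
  mem := hS y.mem
  phase :=
    { toFun := fun f => (y.phase ⟨fun x => star ((f : X → ℂ) (ι.inv x)),
        star_comp_mem_logMonoid ι hS f.2⟩)⁻¹
      map_one' := by
        rw [inv_eq_one, ← map_one y.phase]
        congr 1
        ext x
        simp
      map_mul' := fun f g => by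
        rw [← mul_inv, ← map_mul]
        congr 2
        ext x
        simp }
  phase_congr f g h := by
    have ht : Tendsto ι.inv (𝓝[S] y.pt) (𝓝[S] (ι.inv y.pt)) :=
      ι.antiholomorphic.1.continuousAt.continuousWithinAt.tendsto_nhdsWithin hS
    refine congrArg (·⁻¹) (y.phase_congr _ _ ?_)
    filter_upwards [ht.eventually h] with q hq
    exact congrArg star hq
  phase_unit f hf := by
    have h := y.phase_unit ⟨fun x => star ((f : X → ℂ) (ι.inv x)),
      star_comp_mem_logMonoid ι hS f.2⟩ (star_ne_zero.2 hf)
    refine (Circle.coe_inv_eq_conj _).trans ((congrArg (starRingEnd ℂ) h).trans ?_)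
    simp

/-- `ℝ X̃⁺` (for a real submanifold `S` instead of `X`): the real points of the blow-up that are
mapped to `{1} × [0,1)` by the blown-up family. -/
def realPositive (ι : RealStructure π) {S : Set X} (hS : MapsTo ι.inv S S) :
    Set (Blowup n S (π.fibre 0)) :=
  {y | y.conj ι hS = y ∧ (π.blowupMap y).1 = 1}

/-- `ℝ X̃₀⁺` (for a real submanifold `S` instead of `X`): the real points of the blow-up that are
mapped to `(1, 0)` by the blown-up family. -/
def realPositiveSpecial (ι : RealStructure π) {S : Set X} (hS : MapsTo ι.inv S S) :
    Set (Blowup n S (π.fibre 0)) :=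
  {y | y.conj ι hS = y ∧ (π.blowupMap y).1 = 1 ∧ ((π.blowupMap y).2 : ℝ) = 0}

/-- The space `ℝ X̃⁺`. -/
abbrev RealPositive (ι : RealStructure π) : Type _ := realPositive ι (mapsTo_univ ι.inv univ)

/-- The space `ℝ X̃₀⁺`, the real positive special fibre. -/
abbrev RealPositiveSpecial (ι : RealStructure π) : Type _ :=
  realPositiveSpecial ι (mapsTo_univ ι.inv univ)

/-- The subset `ℝ X̃ᵢ⁺` of `ℝ X̃⁺`. -/
def realPositiveSub (ι : RealStructure π) {S : Set X} (hS : MapsTo ι.inv S S) :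
    Set (RealPositive ι) :=
  {y | (y : Blowup n univ (π.fibre 0)) ∈ Blowup.incl '' realPositive ι hS}

/-- The subset `ℝ X̃ᵢ₀⁺` of `ℝ X̃₀⁺`. -/
def realPositiveSpecialSub (ι : RealStructure π) {S : Set X} (hS : MapsTo ι.inv S S) :
    Set (RealPositiveSpecial ι) :=
  {y | (y : Blowup n univ (π.fibre 0)) ∈ Blowup.incl '' realPositiveSpecial ι hS}

/-- The real locus `ℝ X_t` of the fibre over `t`. -/
abbrev RealFibre (ι : RealStructure π) (t : ℝ) : Type _ :=
  {x : X // ι.inv x = x ∧ π.fn x = (t : ℂ)}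

end Blowup

end SemiStable

end

/-! Write `M` for the real positive blow-up and `f` for the function `|π|` on it. The proof shows
that `M` is a manifold with corners on which `f` is locally a product of boundary coordinates, and
that such an `f`, being proper over `[0, 1)`, is a trivial family even across the value `0`.

Local structure. Near a real point one wants holomorphic coordinates compatible with the real
structure in which `π` is a product of coordinates with index in `K` and each `S i` is given by the
other coordinates (`exists_isRealChart`). Total reality says that conjugation preserves each local
branch of the special fibre, so the factors of `π` become real after multiplication by units
(`exists_real_factors`). Transversality says that the differentials of these factors and of real
equations of the `S i` are independent, so they extend to a real chart. Over such a chart a point of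
`M` is a real point together with signs of the coordinates in `K`, with product `1`. For fixed signs
the absolute values of these coordinates make `M` an open subset of an orthant
(`IsRealChart.exists_orthantChart`). That the phases of coordinates determine all phases rests on
writing germs without zeros off the divisor as units times monomials (`exists_unit_mul_monomial`).

Trivialization. In an orthant one flows in the direction in which all coordinates in `K` grow at
unit speed. This preserves the `S i`, and `F = f ^ (1 / n)` increases at rate at least `1 / n`, even
at corners (`root_prod_expanding`). No global flow is constructed. The fibre `F = τ` is moved to `F
= a` through the sets `F = a + (τ - a) * min 1 (∑ λ_l)`, dropping one bump function `λ_l` at a time;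
each step is a push along the flow lines of one box (`FlowBox.exists_push`). The bump functions are
Lipschitz, so for small `τ - a` all functions involved stay strictly increasing along the lines.
Compactness gives retractions over short intervals, and these are glued to a retraction of `M` onto
`f = 0` that is bijective on every fibre (`exists_retraction_of_orthantCharts`). Retraction and `f`
together form a proper continuous bijection, whose inverse is the trivialization. -/

namespace SemiStable

/-! ### Flow boxes and pushes along flow lines -/

/-- A flow box: an open set identified with a product `B × J` of a set and an interval of times
without a last element. -/
structure FlowBox (M E : Type*) [TopologicalSpace M] [TopologicalSpace E] where
  e : PartialEquiv M (E × ℝ)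
  base : Set E
  times : Set ℝ
  open_source : IsOpen e.source
  continuousOn : ContinuousOn e e.source
  continuousOn_symm : ContinuousOn e.symm e.target
  target_eq : e.target = base ×ˢ times
  ordConnected : times.OrdConnected
  exists_gt : ∀ s ∈ times, ∃ s' ∈ times, s < s'

namespace FlowBox

variable {M E T : Type*} [TopologicalSpace M] [TopologicalSpace E] [TopologicalSpace T]
  (X : FlowBox M E)

/-- The function `g` is strictly increasing along the flow lines of the box. -/
def StrictMonoAlong (g : M → ℝ) : Prop :=
  ∀ β ∈ X.base, StrictMonoOn (fun s => g (X.e.symm (β, s))) X.times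

theorem symm_mem {β : E} {s : ℝ} (hβ : β ∈ X.base) (hs : s ∈ X.times) :
    X.e.symm (β, s) ∈ X.e.source :=
  X.e.map_target (by rw [X.target_eq]; exact ⟨hβ, hs⟩)

theorem apply_symm {β : E} {s : ℝ} (hβ : β ∈ X.base) (hs : s ∈ X.times) :
    X.e (X.e.symm (β, s)) = (β, s) :=
  X.e.right_inv (by rw [X.target_eq]; exact ⟨hβ, hs⟩)

theorem base_mem {y : M} (hy : y ∈ X.e.source) : (X.e y).1 ∈ X.base := by
  have h := X.e.map_source hy
  rw [X.target_eq] at h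
  exact h.1

theorem time_mem {y : M} (hy : y ∈ X.e.source) : (X.e y).2 ∈ X.times := by
  have h := X.e.map_source hy
  rw [X.target_eq] at h
  exact h.2

theorem symm_base_time {y : M} (hy : y ∈ X.e.source) :
    X.e.symm ((X.e y).1, (X.e y).2) = y := X.e.left_inv hy

theorem continuousOn_line {β : E} (hβ : β ∈ X.base) :
    ContinuousOn (fun s => X.e.symm (β, s)) X.times := by
  refine X.continuousOn_symm.comp (by fun_prop) ?_
  intro s hs
  rw [X.target_eq]
  exact ⟨hβ, hs⟩

theorem exists_zero_on_line {g : M → ℝ} (hg : Continuous g) {β : E} (hβ : β ∈ X.base) {s s' : ℝ}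
    (hs : s ∈ X.times) (hs' : s' ∈ X.times) (hle : s ≤ s') (h1 : g (X.e.symm (β, s)) ≤ 0)
    (h2 : 0 ≤ g (X.e.symm (β, s'))) :
    ∃ u ∈ X.times, g (X.e.symm (β, u)) = 0 := by
  have hsub : Icc s s' ⊆ X.times := X.ordConnected.out hs hs'
  have hc : ContinuousOn (fun u => g (X.e.symm (β, u))) (Icc s s') :=
    hg.comp_continuousOn ((X.continuousOn_line hβ).mono hsub)
  obtain ⟨u, hu, hu0⟩ := intermediate_value_Icc hle hc ⟨h1, h2⟩
  exact ⟨u, hsub hu, hu0⟩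

/-- Compactness bounds the times in `K`, and the absence of a last time leaves room beyond. Every
flow line thus has a point above `K`, where functions that agree off `K` can be compared. -/
theorem exists_time_gt {K : Set M} (hK : IsCompact K) (hKs : K ⊆ X.e.source) (hne : K.Nonempty) :
    ∃ s ∈ X.times, ∀ y ∈ K, (X.e y).2 < s := by
  obtain ⟨y, hy, hmax⟩ := hK.exists_isMaxOn hne
    (continuous_snd.comp_continuousOn (X.continuousOn.mono hKs))
  obtain ⟨s, hs, hlt⟩ := X.exists_gt _ (X.time_mem (hKs hy))
  exact ⟨s, hs, fun z hz => lt_of_le_of_lt (hmax hz) hlt⟩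

/-- Downwards there may be no room, because a box can end at a face of the orthant. In that case the
least time is returned, and the values there have to be controlled separately. -/
theorem exists_time_lt {K : Set M} (hK : IsCompact K) (hKs : K ⊆ X.e.source) (hne : K.Nonempty) :
    ∃ s ∈ X.times, IsLeast X.times s ∨ ∀ y ∈ K, s < (X.e y).2 := by
  obtain ⟨y, hy, hmin⟩ := hK.exists_isMinOn hne
    (continuous_snd.comp_continuousOn (X.continuousOn.mono hKs))
  by_cases h : IsLeast X.times (X.e y).2
  · exact ⟨_, X.time_mem (hKs hy), Or.inl h⟩
  · have : ∃ s ∈ X.times, s < (X.e y).2 := by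
      by_contra! hcon
      exact h ⟨X.time_mem (hKs hy), hcon⟩
    obtain ⟨s, hs, hlt⟩ := this
    exact ⟨s, hs, Or.inr fun z hz => lt_of_lt_of_le hlt (hmin hz)⟩

/-- Pushing the zero set of `b` to the zero set of `a` along the flow lines of a box outside of
which `a` and `b` agree. -/
theorem exists_push [T2Space M] {K : Set M} (hK : IsCompact K) (hKs : K ⊆ X.e.source)
    {a b : M → T → ℝ} (ha : Continuous (Function.uncurry a)) (hb : Continuous (Function.uncurry b))
    (hab : ∀ y ∉ K, ∀ τ, a y τ = b y τ) (hle : ∀ y τ, b y τ ≤ a y τ)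
    (hma : ∀ τ, X.StrictMonoAlong fun y => a y τ) (hmb : ∀ τ, X.StrictMonoAlong fun y => b y τ)
    (hbot : ∀ s, IsLeast X.times s → ∀ β ∈ X.base, ∀ τ, a (X.e.symm (β, s)) τ ≤ 0) :
    ∃ P : M → T → M,
      ContinuousOn (Function.uncurry P) {z | b z.1 z.2 = 0} ∧
      (∀ τ, BijOn (fun y => P y τ) {y | b y τ = 0} {y | a y τ = 0}) ∧
      (∀ y τ, b y τ = 0 → a y τ = 0 → P y τ = y) ∧
      ∀ y τ, P y τ = y ∨
        (y ∈ X.e.source ∧ P y τ ∈ X.e.source ∧ (X.e (P y τ)).1 = (X.e y).1) := by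
  classical
  have hca : ∀ τ, Continuous fun y => a y τ := fun τ => by
    exact ha.comp (Continuous.prodMk continuous_id continuous_const)
  have hcb : ∀ τ, Continuous fun y => b y τ := fun τ => by
    exact hb.comp (Continuous.prodMk continuous_id continuous_const)
  -- `cond` says that the line through `y` meets the zeros of `a`; by strict monotonicity it does so
  -- once, and `P` moves `y` there. The default value `y` is right for zeros of `b` off the box,
  -- where `a` and `b` agree.
  let cond : M → T → Prop := fun y τ =>
    y ∈ X.e.source ∧ ∃ s ∈ X.times, a (X.e.symm ((X.e y).1, s)) τ = 0
  let P : M → T → M := fun y τ =>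
    if h : cond y τ then X.e.symm ((X.e y).1, h.2.choose) else y
  have hPspec : ∀ y τ, cond y τ → ∃ s ∈ X.times, a (X.e.symm ((X.e y).1, s)) τ = 0 ∧
      P y τ = X.e.symm ((X.e y).1, s) := fun y τ h =>
    ⟨h.2.choose, h.2.choose_spec.1, h.2.choose_spec.2, by simp only [P]; rw [dif_pos h]⟩
  have hPid : ∀ y τ, ¬ cond y τ → P y τ = y := fun y τ h => by simp only [P]; rw [dif_neg h]
  have hPeq : ∀ y τ, y ∈ X.e.source → ∀ s ∈ X.times, a (X.e.symm ((X.e y).1, s)) τ = 0 →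
      P y τ = X.e.symm ((X.e y).1, s) := by
    intro y τ hy s hs h0
    obtain ⟨s', hs', h0', hP⟩ := hPspec y τ ⟨hy, s, hs, h0⟩
    rw [hP, (hma τ _ (X.base_mem hy)).injOn hs' hs (h0'.trans h0.symm)]
  -- zeros of `a` on the line through a zero of `b`
  have hza : ∀ y τ, y ∈ X.e.source → b y τ = 0 → cond y τ := by
    intro y τ hy h0
    refine ⟨hy, ?_⟩
    by_cases hyK : y ∈ K
    -- At `y` itself `a ≥ b = 0`. Below `K` on the same line `a = b < 0` since `b` is strictly
    -- increasing, or else the line reaches the bottom of the box, where `a ≤ 0`. So `a` has a zero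
    -- in between.
    · obtain ⟨lo, hlo, hlo'⟩ := X.exists_time_lt hK hKs ⟨y, hyK⟩
      have hβ := X.base_mem hy
      have ht := X.time_mem hy
      have hab0 : 0 ≤ a (X.e.symm ((X.e y).1, (X.e y).2)) τ := by
        rw [X.symm_base_time hy, ← h0]; exact hle y τ
      rcases hlo' with hl | hl
      · exact X.exists_zero_on_line (hca τ) hβ hlo ht (hl.2 ht) (hbot lo hl _ hβ τ) hab0
      · refine X.exists_zero_on_line (hca τ) hβ hlo ht (hl y hyK).le ?_ hab0
        have hnot : X.e.symm ((X.e y).1, lo) ∉ K := fun hmem => by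
          have := hl _ hmem
          rw [X.apply_symm hβ hlo] at this
          exact lt_irrefl _ this
        rw [hab _ hnot]
        have := hmb τ _ hβ hlo ht (hl y hyK)
        simp only [X.symm_base_time hy, h0] at this
        exact this.le
    · exact ⟨(X.e y).2, X.time_mem hy, by rw [X.symm_base_time hy, hab y hyK, h0]⟩
  have hPa : ∀ y τ, b y τ = 0 → a (P y τ) τ = 0 := by
    intro y τ h0
    by_cases hy : y ∈ X.e.source
    · obtain ⟨s, hs, hs0, hP⟩ := hPspec y τ (hza y τ hy h0)
      rw [hP, hs0]
    · rw [hPid y τ fun h => hy h.1, hab y fun h => hy (hKs h), h0]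
  have hPfix : ∀ y τ, b y τ = 0 → a y τ = 0 → P y τ = y := by
    intro y τ _ h0
    by_cases hy : y ∈ X.e.source
    · rw [hPeq y τ hy _ (X.time_mem hy) (by rw [X.symm_base_time hy, h0]), X.symm_base_time hy]
    · exact hPid y τ fun h => hy h.1
  have hPline : ∀ y τ, P y τ = y ∨
      (y ∈ X.e.source ∧ P y τ ∈ X.e.source ∧ (X.e (P y τ)).1 = (X.e y).1) := by
    intro y τ
    by_cases h : cond y τ
    · obtain ⟨s, hs, -, hP⟩ := hPspec y τ h
      refine Or.inr ⟨h.1, ?_, ?_⟩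
      · rw [hP]; exact X.symm_mem (X.base_mem h.1) hs
      · rw [hP, X.apply_symm (X.base_mem h.1) hs]
    · exact Or.inl (hPid y τ h)
  refine ⟨P, ?_, ?_, hPfix, hPline⟩
  · rintro ⟨y, τ⟩ hyτ
    have h0 : b y τ = 0 := hyτ
    by_cases hy : y ∈ X.e.source
    swap
    -- Neighbours of `y` may lie in the box, but not in the closed set `K`; there `a = b`, and `P`
    -- fixes the zeros.
    · have hyK : y ∉ K := fun h => hy (hKs h)
      have hev : ∀ᶠ z in 𝓝[{z : M × T | b z.1 z.2 = 0}] (y, τ),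
          Function.uncurry P z = z.1 := by
        have : ∀ᶠ z : M × T in 𝓝 (y, τ), z.1 ∉ K :=
          (continuous_fst.tendsto (y, τ)).eventually (hK.isClosed.isOpen_compl.mem_nhds hyK)
        filter_upwards [mem_nhdsWithin_of_mem_nhds this, self_mem_nhdsWithin] with z hz hz0
        exact hPfix z.1 z.2 hz0 (by rw [hab _ hz]; exact hz0)
      exact (continuousWithinAt_fst).congr_of_eventuallyEq hev
        (hPfix y τ h0 (by rw [hab y hyK, h0]))
    · obtain ⟨s, hs, hs0, hP⟩ := hPspec y τ (hza y τ hy h0)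
      have hβ := X.base_mem hy
      have hce : ContinuousAt X.e y := X.continuousOn.continuousAt (X.open_source.mem_nhds hy)
      have hsrc : ∀ᶠ z : M × T in 𝓝 (y, τ), z.1 ∈ X.e.source :=
        continuous_fst.continuousAt.eventually (X.open_source.mem_nhds hy)
      let D : Set (M × T) := {z | b z.1 z.2 = 0}
      -- continuity of the function `a` on lines
      have hline : ∀ u ∈ X.times, Tendsto (fun z : M × T => a (X.e.symm ((X.e z.1).1, u)) z.2)
          (𝓝 (y, τ)) (𝓝 (a (X.e.symm ((X.e y).1, u)) τ)) := by
        intro u hu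
        have h1 : Tendsto (fun z : M × T => ((X.e z.1).1, u)) (𝓝 (y, τ))
            (𝓝[X.e.target] ((X.e y).1, u)) := by
          refine tendsto_nhdsWithin_iff.2 ⟨?_, ?_⟩
          · refine Tendsto.prodMk_nhds ?_ tendsto_const_nhds
            exact (continuous_fst.continuousAt.comp hce).tendsto.comp
              (continuous_fst.continuousAt (x := (y, τ)))
          · filter_upwards [hsrc] with z hz
            rw [X.target_eq]; exact ⟨X.base_mem hz, hu⟩
        have h2 : Tendsto X.e.symm (𝓝[X.e.target] ((X.e y).1, u))
            (𝓝 (X.e.symm ((X.e y).1, u))) :=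
          X.continuousOn_symm _ (by rw [X.target_eq]; exact ⟨hβ, hu⟩)
        exact (ha.tendsto (X.e.symm ((X.e y).1, u), τ)).comp
          ((h2.comp h1).prodMk_nhds (continuous_snd.continuousAt (x := (y, τ))))
      -- the time of the zero
      have htime : Tendsto (fun z : M × T => ((X.e z.1).1, (X.e (P z.1 z.2)).2)) (𝓝[D] (y, τ))
          (𝓝[X.e.target] ((X.e y).1, s)) := by
        have hinD : ∀ᶠ z in 𝓝[D] (y, τ), z.1 ∈ X.e.source ∧ ∃ v ∈ X.times,
            a (X.e.symm ((X.e z.1).1, v)) z.2 = 0 ∧ (X.e (P z.1 z.2)).2 = v := by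
          filter_upwards [mem_nhdsWithin_of_mem_nhds hsrc, self_mem_nhdsWithin] with z hz hz0
          obtain ⟨v, hv, hv0, hPv⟩ := hPspec z.1 z.2 (hza z.1 z.2 hz hz0)
          exact ⟨hz, v, hv, hv0, by rw [hPv, X.apply_symm (X.base_mem hz) hv]⟩
        refine tendsto_nhdsWithin_iff.2 ⟨Tendsto.prodMk_nhds ?_ ?_, ?_⟩
        · exact ((continuous_fst.continuousAt.comp hce).tendsto.comp
            (continuous_fst.continuousAt (x := (y, τ)))).mono_left nhdsWithin_le_nhds
        · refine tendsto_order.2 ⟨fun l hl => ?_, fun u hu => ?_⟩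
          -- The negative sign of `a` at a fixed time `w < s` persists nearby and keeps the zero
          -- above `w`. If the box has no time in `[l, s)`, order connectedness puts all its times
          -- above `l`.
          · by_cases hlow : ∃ w ∈ X.times, w < s ∧ l ≤ w
            · obtain ⟨w, hw, hws, hlw⟩ := hlow
              have hneg : a (X.e.symm ((X.e y).1, w)) τ < 0 := by
                have := hma τ _ hβ hw hs hws
                simpa [hs0] using this
              filter_upwards [hinD, mem_nhdsWithin_of_mem_nhds
                ((hline w hw).eventually_lt_const hneg)] with z hz hzneg
              obtain ⟨hzs, v, hv, hv0, hPv⟩ := hz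
              rw [hPv]
              refine lt_of_le_of_lt hlw ?_
              by_contra! hcon
              have := (hma z.2 _ (X.base_mem hzs)).monotoneOn hv hw hcon
              simp only [hv0] at this
              linarith
            · filter_upwards [hinD] with z hz
              obtain ⟨hzs, v, hv, hv0, hPv⟩ := hz
              rw [hPv]
              by_contra! hcon
              exact hlow ⟨l, X.ordConnected.out hv hs ⟨hcon, hl.le⟩, hl, le_rfl⟩
          · obtain ⟨w', hw', hsw'⟩ := X.exists_gt s hs
            obtain ⟨w, hsw, hwu⟩ := exists_between (lt_min hu hsw')
            have hw : w ∈ X.times :=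
              X.ordConnected.out hs hw' ⟨hsw.le, (hwu.trans_le (min_le_right _ _)).le⟩
            have hpos : 0 < a (X.e.symm ((X.e y).1, w)) τ := by
              have := hma τ _ hβ hs hw hsw
              simpa [hs0] using this
            filter_upwards [hinD, mem_nhdsWithin_of_mem_nhds
              ((hline w hw).eventually_const_lt hpos)] with z hz hzpos
            obtain ⟨hzs, v, hv, hv0, hPv⟩ := hz
            rw [hPv]
            refine lt_of_lt_of_le ?_ (hwu.trans_le (min_le_left _ _)).le
            by_contra! hcon
            have := (hma z.2 _ (X.base_mem hzs)).monotoneOn hw hv hcon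
            simp only [hv0] at this
            linarith
        · filter_upwards [hinD] with z hz
          obtain ⟨hzs, v, hv, hv0, hPv⟩ := hz
          rw [X.target_eq, hPv]
          exact ⟨X.base_mem hzs, hv⟩
      have h2 : Tendsto X.e.symm (𝓝[X.e.target] ((X.e y).1, s)) (𝓝 (X.e.symm ((X.e y).1, s))) :=
        X.continuousOn_symm _ (by rw [X.target_eq]; exact ⟨hβ, hs⟩)
      have h3 := h2.comp htime
      change Tendsto (Function.uncurry P) (𝓝[D] (y, τ)) (𝓝 (P y τ))
      rw [hP]
      refine h3.congr' ?_
      filter_upwards [mem_nhdsWithin_of_mem_nhds hsrc, self_mem_nhdsWithin] with z hz hz0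
      obtain ⟨v, hv, hv0, hPv⟩ := hPspec z.1 z.2 (hza z.1 z.2 hz hz0)
      change X.e.symm ((X.e z.1).1, (X.e (P z.1 z.2)).2) = P z.1 z.2
      rw [hPv, X.apply_symm (X.base_mem hz) hv]
  · intro τ
    refine ⟨fun y hy => hPa y τ hy, ?_, ?_⟩
    -- `P` preserves the box and its lines, and a line carries at most one zero of `b`.
    · intro y hy y' hy' heq
      have heq : P y τ = P y' τ := heq
      have hy : b y τ = 0 := hy
      have hy' : b y' τ = 0 := hy'
      have hmemiff : ∀ z, P z τ ∈ X.e.source → z ∈ X.e.source := by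
        intro z hz
        rcases hPline z τ with h | h
        · rwa [h] at hz
        · exact h.1
      have hbase : ∀ z, z ∈ X.e.source → P z τ ∈ X.e.source ∧ (X.e (P z τ)).1 = (X.e z).1 := by
        intro z hz
        rcases hPline z τ with h | h
        · rw [h]; exact ⟨hz, rfl⟩
        · exact h.2
      by_cases hys : y ∈ X.e.source
      · have hy's : y' ∈ X.e.source := hmemiff y' (heq ▸ (hbase y hys).1)
        have hbb : (X.e y).1 = (X.e y').1 := by
          rw [← (hbase y hys).2, heq, (hbase y' hy's).2]
        have ht : (X.e y).2 = (X.e y').2 := by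
          refine (hmb τ _ (X.base_mem hys)).injOn (X.time_mem hys) (X.time_mem hy's) ?_
          change b (X.e.symm ((X.e y).1, (X.e y).2)) τ = b (X.e.symm ((X.e y).1, (X.e y').2)) τ
          rw [X.symm_base_time hys, hbb, X.symm_base_time hy's, hy, hy']
        rw [← X.symm_base_time hys, hbb, ht, X.symm_base_time hy's]
      · have hy's : y' ∉ X.e.source := fun h => hys (hmemiff y (heq ▸ (hbase y' h).1))
        rwa [hPid y τ fun h => hys h.1, hPid y' τ fun h => hy's h.1] at heq
    -- At a zero `z` of `a` in `K` one has `b ≤ a = 0`, while `b = a > 0` above `K` on its line; the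
    -- zero of `b` in between is pushed to `z`.
    · intro z hz
      have hz : a z τ = 0 := hz
      by_cases hzK : z ∈ K
      · have hzs := hKs hzK
        have hβ := X.base_mem hzs
        have ht := X.time_mem hzs
        obtain ⟨hi, hhi, hlt⟩ := X.exists_time_gt hK hKs ⟨z, hzK⟩
        have hnot : X.e.symm ((X.e z).1, hi) ∉ K := fun hmem => by
          have := hlt _ hmem
          rw [X.apply_symm hβ hhi] at this
          exact lt_irrefl _ this
        have hpos : 0 < b (X.e.symm ((X.e z).1, hi)) τ := by
          rw [← hab _ hnot]
          have := hma τ _ hβ ht hhi (hlt z hzK)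
          simpa only [X.symm_base_time hzs, hz] using this
        have hneg : b (X.e.symm ((X.e z).1, (X.e z).2)) τ ≤ 0 := by
          rw [X.symm_base_time hzs, ← hz]; exact hle z τ
        obtain ⟨u, hu, hu0⟩ := X.exists_zero_on_line (hcb τ) hβ ht hhi (hlt z hzK).le hneg hpos.le
        refine ⟨X.e.symm ((X.e z).1, u), hu0, ?_⟩
        have hus := X.symm_mem hβ hu
        have hb1 : (X.e (X.e.symm ((X.e z).1, u))).1 = (X.e z).1 := by rw [X.apply_symm hβ hu]
        change P _ τ = z
        rw [hPeq _ τ hus (X.e z).2 ht (by rw [hb1, X.symm_base_time hzs, hz]), hb1,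
          X.symm_base_time hzs]
      · have hbz : b z τ = 0 := by rw [← hab z hzK, hz]
        exact ⟨z, hbz, hPfix z τ hbz hz⟩

end FlowBox

end SemiStable

namespace SemiStable

/-! ### Trivializations over intervals -/

variable {M E A I : Type*} [TopologicalSpace M] [TopologicalSpace E]

/-- A retraction of the part of `M` over `[a, b]` to the fibre over `a` which is bijective on
fibres and compatible with the sets `Z i`. -/
structure IsRetractionOver (F : M → ℝ) (Z : I → Set M) (a b : ℝ) (ρ : M → M) : Prop where
  continuousOn : ContinuousOn ρ (F ⁻¹' Icc a b)
  bijOn : ∀ τ ∈ Icc a b, BijOn ρ {y | F y = τ} {y | F y = a}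
  eq_self : ∀ y, F y = a → ρ y = y
  mem_iff : ∀ y, F y ∈ Icc a b → ∀ i, ρ y ∈ Z i ↔ y ∈ Z i

/-- The truncated sum of the functions `lam l`, `l ∈ s`. -/
noncomputable def truncSum (lam : A → M → ℝ) (s : Finset A) (y : M) : ℝ :=
  min 1 (∑ l ∈ s, lam l y)

/-- Fibres are moved through the zero sets of `F - a - (τ - a) * truncSum lam s'`. For `s' = ∅` this
is the fibre over `a`; for `s' = s` the covering hypothesis makes it the fibre over `τ`. Adding one
index changes the function only in the support of one bump function, so a push in one box suffices.
The bound `δ` on `τ - a` keeps all these functions increasing along the lines. -/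
theorem exists_retraction_of_boxes [T2Space M] {F : M → ℝ} (hF : Continuous F) {Z : I → Set M}
    (s : Finset A) (X : A → FlowBox M E) (K : A → Set M) (lam : A → M → ℝ)
    (hK : ∀ l, IsCompact (K l)) (hKs : ∀ l, K l ⊆ (X l).e.source)
    (hlc : ∀ l, Continuous (lam l)) (hl0 : ∀ l y, 0 ≤ lam l y) (hlK : ∀ l, ∀ y ∉ K l, lam l y = 0)
    {a b δ : ℝ} (ha : 0 ≤ a) (hb : b - a ≤ δ)
    (hmono : ∀ l ∈ s, ∀ s' ⊆ s, ∀ c, 0 ≤ c → c ≤ δ →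
      (X l).StrictMonoAlong fun y => F y - c * truncSum lam s' y)
    (hsat : ∀ l, ∀ i, ∀ y ∈ (X l).e.source, ∀ y' ∈ (X l).e.source,
      ((X l).e y').1 = ((X l).e y).1 → (y' ∈ Z i ↔ y ∈ Z i))
    (hbot : ∀ l, ∀ u, IsLeast (X l).times u → ∀ β ∈ (X l).base, F ((X l).e.symm (β, u)) ≤ 0)
    (hcov : ∀ y, F y ∈ Icc a b → 1 ≤ ∑ l ∈ s, lam l y) :
    ∃ ρ, IsRetractionOver F Z a b ρ := by
  classical
  have hT0 : ∀ s' y, 0 ≤ truncSum lam s' y := fun s' y =>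
    le_min zero_le_one (Finset.sum_nonneg fun l _ => hl0 l y)
  have hTc : ∀ s', Continuous (truncSum lam s') := fun s' =>
    continuous_const.min (continuous_finsetSum _ fun l _ => hlc l)
  let g : Finset A → M → Icc a b → ℝ := fun s' y τ => F y - a - (τ - a) * truncSum lam s' y
  have hgc : ∀ s', Continuous (Function.uncurry (g s')) := fun s' => by
    have h1 : Continuous fun z : M × Icc a b => truncSum lam s' z.1 := (hTc s').comp continuous_fst
    have h2 : Continuous fun z : M × Icc a b => F z.1 := hF.comp continuous_fst
    exact (h2.sub continuous_const).sub
      (((continuous_subtype_val.comp continuous_snd).sub continuous_const).mul h1)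
  have key : ∀ s' ⊆ s, ∃ Q : M → Icc a b → M,
      ContinuousOn (Function.uncurry Q) {z | g s' z.1 z.2 = 0} ∧
      (∀ τ, BijOn (fun y => Q y τ) {y | g s' y τ = 0} {y | F y = a}) ∧
      (∀ y τ, g s' y τ = 0 → F y = a → Q y τ = y) ∧
      ∀ y τ i, Q y τ ∈ Z i ↔ y ∈ Z i := by
    intro s'
    induction s' using Finset.induction_on with
    | empty =>
      intro _
      refine ⟨fun y _ => y, continuousOn_fst, fun τ => ?_, fun _ _ _ _ => rfl,
        fun _ _ _ => Iff.rfl⟩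
      have : {y | g ∅ y τ = 0} = {y | F y = a} := by
        ext y
        simp [g, truncSum, sub_eq_zero]
      rw [this]
      exact bijOn_id _
    | insert l s' hl ih =>
      intro hsub
      obtain ⟨Q, hQc, hQb, hQi, hQZ⟩ := ih fun x hx => hsub (Finset.mem_insert_of_mem hx)
      have hls : l ∈ s := hsub (Finset.mem_insert_self _ _)
      have hle : ∀ y, truncSum lam s' y ≤ truncSum lam (insert l s') y := fun y => by
        refine min_le_min le_rfl ?_
        rw [Finset.sum_insert hl]
        linarith [hl0 l y]
      have hmono' : ∀ s'' ⊆ s, ∀ τ : Icc a b, (X l).StrictMonoAlong fun y => g s'' y τ := by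
        intro s'' hs'' τ β hβ u hu v hv huv
        have := hmono l hls s'' hs'' (τ - a) (sub_nonneg.2 τ.2.1)
          ((sub_le_sub_right τ.2.2 a).trans hb) β hβ hu hv huv
        simp only [g] at this ⊢
        linarith
      obtain ⟨P, hPc, hPb, hPi, hPl⟩ := (X l).exists_push (hK l) (hKs l) (hgc s')
        (hgc (insert l s'))
        (fun y hy τ => by
          simp only [g, truncSum, Finset.sum_insert hl, hlK l y hy, zero_add])
        (fun y τ => by
          have := mul_le_mul_of_nonneg_left (hle y) (sub_nonneg.2 τ.2.1)
          simp only [g]; linarith)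
        (hmono' s' fun x hx => hsub (Finset.mem_insert_of_mem hx)) (hmono' _ hsub)
        (fun u hu β hβ τ => by
          have h1 := hbot l u hu β hβ
          have h2 := mul_nonneg (sub_nonneg.2 τ.2.1) (hT0 s' ((X l).e.symm (β, u)))
          simp only [g]; linarith)
      refine ⟨fun y τ => Q (P y τ) τ, ?_, fun τ => (hQb τ).comp (hPb τ), ?_, ?_⟩
      · have h1 : ContinuousOn (fun z : M × Icc a b => (P z.1 z.2, z.2))
            {z | g (insert l s') z.1 z.2 = 0} := hPc.prodMk continuousOn_snd
        exact hQc.comp h1 fun z hz => (hPb z.2).mapsTo hz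
      -- On the fibre over `a` the equation says that `τ - a` times the larger sum is zero. The same
      -- then holds for the smaller sum, so neither the new push nor the earlier ones move the
      -- point.
      · intro y τ h0 hFa
        have h1 := mul_le_mul_of_nonneg_left (hle y) (sub_nonneg.2 τ.2.1)
        have h2 := mul_nonneg (sub_nonneg.2 τ.2.1) (hT0 s' y)
        have h3 : g s' y τ = 0 := by
          simp only [g] at h0 ⊢
          linarith
        have h4 := hPi y τ h0 h3
        simp only [h4]
        exact hQi y τ h3 hFa
      · intro y τ i
        rw [hQZ]
        rcases hPl y τ with h | ⟨h1, h2, h3⟩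
        · rw [h]
        · exact hsat l i y h1 _ h2 h3
  obtain ⟨Q, hQc, hQb, hQi, hQZ⟩ := key s Finset.Subset.rfl
  have hone : ∀ y, F y ∈ Icc a b → truncSum lam s y = 1 := fun y hy => min_eq_left (hcov y hy)
  have hset : ∀ τ : Icc a b, {y | g s y τ = 0} = {y | F y = τ} := by
    intro τ
    ext y
    simp only [mem_ofPred_eq, g]
    constructor
    -- A zero satisfies `a ≤ F y ≤ τ` because the truncated sum lies in `[0, 1]`; only then does the
    -- covering hypothesis apply and force `F y = τ`.
    · intro h
      have h1 := hT0 s y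
      have h2 : truncSum lam s y ≤ 1 := min_le_left _ _
      have h3 := sub_nonneg.2 τ.2.1
      have h4 := mul_nonneg h3 h1
      have h5 := mul_le_mul_of_nonneg_left h2 h3
      have h6 := τ.2.2
      rw [hone y ⟨by linarith, by linarith⟩] at h
      linarith
    · intro h
      rw [hone y (h ▸ τ.2), h]
      ring
  -- The parameter `τ` is taken to be the level of the point itself, which turns the family of maps
  -- into a single one.
  let ρ : M → M := fun y => if h : F y ∈ Icc a b then Q y ⟨F y, h⟩ else y
  have hρ : ∀ y (h : F y ∈ Icc a b), ρ y = Q y ⟨F y, h⟩ := fun y h => dif_pos h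
  refine ⟨ρ, ?_, ?_, ?_, ?_⟩
  · rw [continuousOn_iff_continuous_domRestrict]
    have : (F ⁻¹' Icc a b).domRestrict ρ = fun y => Function.uncurry Q (y.1, ⟨F y.1, y.2⟩) := by
      ext y
      exact hρ y.1 y.2
    rw [this]
    refine hQc.comp_continuous ?_ ?_
    · exact continuous_subtype_val.prodMk
        (Continuous.subtype_mk (hF.comp continuous_subtype_val) _)
    · intro y
      have : y.1 ∈ {y' | F y' = ((⟨F y.1, y.2⟩ : Icc a b) : ℝ)} := rfl
      rw [← hset] at this
      exact this
  · intro τ hτ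
    have := hQb ⟨τ, hτ⟩
    rw [hset] at this
    refine this.congr ?_
    intro y hy
    have hy : F y = τ := hy
    subst hy
    exact (hρ y hτ).symm
  · intro y hy
    by_cases h : F y ∈ Icc a b
    · rw [hρ y h]
      refine hQi y _ ?_ hy
      have : y ∈ {y' | F y' = ((⟨F y, h⟩ : Icc a b) : ℝ)} := rfl
      rwa [← hset] at this
    · exact dif_neg h
  · intro y hy i
    rw [hρ y hy]
    exact hQZ _ _ _

namespace IsRetractionOver

variable {F : M → ℝ} {Z : I → Set M} {a b c : ℝ}

theorem refl (F : M → ℝ) (Z : I → Set M) (a : ℝ) : IsRetractionOver F Z a a id where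
  continuousOn := continuousOn_id
  bijOn τ hτ := by
    rw [Icc_self] at hτ
    rw [hτ]
    exact bijOn_id _
  eq_self _ _ := rfl
  mem_iff _ _ _ := Iff.rfl

/-- Retractions over adjacent intervals can be glued. -/
theorem glue (hF : Continuous F) {ρ₁ ρ₂ : M → M} (hab : a ≤ b) (hbc : b ≤ c)
    (h₁ : IsRetractionOver F Z a b ρ₁) (h₂ : IsRetractionOver F Z b c ρ₂) :
    ∃ ρ, IsRetractionOver F Z a c ρ ∧ ∀ y, F y ≤ b → ρ y = ρ₁ y := by
  classical
  let ρ : M → M := fun y => if F y ≤ b then ρ₁ y else ρ₁ (ρ₂ y)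
  have hle : ∀ y, F y ≤ b → ρ y = ρ₁ y := fun y h => if_pos h
  -- Both formulas hold over `b`, since `ρ₂` fixes the fibre there; so the two pieces agree where
  -- their closed domains meet.
  have hge : ∀ y, b ≤ F y → ρ y = ρ₁ (ρ₂ y) := fun y h => by
    rcases h.lt_or_eq with h | h
    · exact if_neg h.not_ge
    · rw [hle y h.symm.le, h₂.eq_self y h.symm]
  have hmaps : ∀ y, F y ∈ Icc b c → F (ρ₂ y) = b := fun y hy => (h₂.bijOn _ hy).mapsTo rfl
  refine ⟨ρ, ⟨?_, ?_, ?_, ?_⟩, hle⟩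
  · have hU : F ⁻¹' Icc a c = F ⁻¹' Icc a b ∪ F ⁻¹' Icc b c := by
      rw [← preimage_union, Icc_union_Icc_eq_Icc hab hbc]
    rw [hU]
    refine ContinuousOn.union_of_isClosed ?_ ?_ (isClosed_Icc.preimage hF)
      (isClosed_Icc.preimage hF)
    · exact h₁.continuousOn.congr fun y hy => hle y hy.2
    · refine ContinuousOn.congr (f := fun y => ρ₁ (ρ₂ y)) ?_ fun y hy => hge y hy.1
      refine h₁.continuousOn.comp h₂.continuousOn fun y hy => ?_
      change F (ρ₂ y) ∈ Icc a b
      rw [hmaps y hy]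
      exact ⟨hab, le_rfl⟩
  · intro τ hτ
    rcases le_total τ b with h | h
    · refine (h₁.bijOn τ ⟨hτ.1, h⟩).congr fun y hy => (hle y ?_).symm
      exact (show F y = τ from hy).trans_le h
    · refine ((h₁.bijOn b ⟨hab, le_rfl⟩).comp (h₂.bijOn τ ⟨h, hτ.2⟩)).congr fun y hy =>
        (hge y ?_).symm
      exact h.trans_eq (show F y = τ from hy).symm
  · intro y hy
    rw [hle y (hy.trans_le hab), h₁.eq_self y hy]
  · intro y hy i
    rcases le_total (F y) b with h | h
    · rw [hle y h, h₁.mem_iff y ⟨hy.1, h⟩]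
    · rw [hge y h, h₁.mem_iff _ (by rw [hmaps y ⟨h, hy.2⟩]; exact ⟨hab, le_rfl⟩),
        h₂.mem_iff y ⟨h, hy.2⟩]

/-- Retractions exist over all intervals if they exist over short intervals. -/
theorem exists_of_local (hF : Continuous F)
    (hloc : ∀ t ∈ Ico (0 : ℝ) 1, ∃ ε > 0, ∀ a b, 0 ≤ a → a ≤ b → b < 1 → t - ε < a → b < t + ε →
      ∃ ρ, IsRetractionOver F Z a b ρ)
    (ha : 0 ≤ a) (hab : a ≤ b) (hb : b < 1) : ∃ ρ, IsRetractionOver F Z a b ρ := by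
  -- Gluing on a short interval around the supremum of `S` would pass beyond it, unless it is
  -- already `b`.
  let S : Set ℝ := {x ∈ Icc a b | ∃ ρ, IsRetractionOver F Z a x ρ}
  have haS : a ∈ S := ⟨⟨le_rfl, hab⟩, id, refl F Z a⟩
  have hbdd : BddAbove S := ⟨b, fun x hx => hx.1.2⟩
  have hs1 : a ≤ sSup S := le_csSup hbdd haS
  have hs2 : sSup S ≤ b := csSup_le ⟨a, haS⟩ fun x hx => hx.1.2
  obtain ⟨ε, hε, h⟩ := hloc (sSup S) ⟨ha.trans hs1, hs2.trans_lt hb⟩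
  obtain ⟨x, hxS, hx⟩ := exists_lt_of_lt_csSup ⟨a, haS⟩ (sub_lt_self (sSup S) hε)
  have hxle : x ≤ sSup S := le_csSup hbdd hxS
  have hreach : ∀ y, x ≤ y → y ≤ b → y < sSup S + ε → y ∈ S := by
    intro y hxy hyb hy
    obtain ⟨ρ₂, h₂⟩ := h x y (ha.trans hxS.1.1) hxy (hyb.trans_lt hb) hx hy
    obtain ⟨ρ₁, h₁⟩ := hxS.2
    obtain ⟨ρ, hρ, -⟩ := glue hF hxS.1.1 hxy h₁ h₂
    exact ⟨⟨hxS.1.1.trans hxy, hyb⟩, ρ, hρ⟩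
  have hend : b ≤ sSup S := by
    by_contra! hlt
    have hm : min b (sSup S + ε / 2) ∈ S :=
      hreach _ (le_min (hxle.trans hs2) (by linarith)) (min_le_left _ _)
        (lt_of_le_of_lt (min_le_right _ _) (by linarith))
    have := le_csSup hbdd hm
    have h3 : sSup S < min b (sSup S + ε / 2) := lt_min hlt (by linarith)
    linarith
  exact (hreach b (hxle.trans hs2) le_rfl (by linarith)).2

/-- Retractions over compact intervals can be chosen compatibly. -/
theorem exists_global (hF : Continuous F) (hF0 : ∀ y, 0 ≤ F y) (hF1 : ∀ y, F y < 1)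
    (hex : ∀ a b, 0 ≤ a → a ≤ b → b < 1 → ∃ ρ, IsRetractionOver F Z a b ρ) :
    ∃ r : M → M, Continuous r ∧ (∀ τ ∈ Ico (0 : ℝ) 1, BijOn r {y | F y = τ} {y | F y = 0}) ∧
      (∀ y, F y = 0 → r y = y) ∧ ∀ y i, r y ∈ Z i ↔ y ∈ Z i := by
  -- `B` increases from `0` to the limit `1`. Each retraction over `[0, B k]` is extended to `[0, B
  -- (k + 1)]` without change, so the sequence is eventually constant near every point.
  let B : ℕ → ℝ := fun k => 1 - 1 / ((k : ℝ) + 1)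
  have hB0 : ∀ k, 0 ≤ B k := fun k => by
    have : 1 / ((k : ℝ) + 1) ≤ 1 := by
      rw [div_le_one (by positivity)]
      linarith [(Nat.cast_nonneg k : (0 : ℝ) ≤ k)]
    simp only [B]; linarith
  have hB1 : ∀ k, B k < 1 := fun k => by
    have : 0 < 1 / ((k : ℝ) + 1) := by positivity
    simp only [B]; linarith
  have hBmono : Monotone B := fun i j hij => by
    have : 1 / ((j : ℝ) + 1) ≤ 1 / ((i : ℝ) + 1) :=
      one_div_le_one_div_of_le (by positivity) (by
        have : (i : ℝ) ≤ j := by exact_mod_cast hij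
        linarith)
    simp only [B]; linarith
  have hBlim : ∀ x < (1 : ℝ), ∃ k, x < B k := fun x hx => by
    obtain ⟨k, hk⟩ := exists_nat_one_div_lt (sub_pos.2 hx)
    exact ⟨k, by simp only [B]; linarith⟩
  have hext : ∀ k (ρ : {ρ : M → M // IsRetractionOver F Z 0 (B k) ρ}),
      ∃ ρ' : {ρ : M → M // IsRetractionOver F Z 0 (B (k + 1)) ρ},
        ∀ y, F y ≤ B k → ρ'.1 y = ρ.1 y := by
    rintro k ⟨ρ, hρ⟩
    obtain ⟨ρ₂, h₂⟩ := hex (B k) (B (k + 1)) (hB0 k) (hBmono k.le_succ) (hB1 _)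
    obtain ⟨ρ', h', heq⟩ := glue hF (hB0 k) (hBmono k.le_succ) hρ h₂
    exact ⟨⟨ρ', h'⟩, heq⟩
  choose next hnext using hext
  obtain ⟨ρ₀, h₀⟩ := hex 0 (B 0) le_rfl (hB0 0) (hB1 0)
  let R : ∀ k, {ρ : M → M // IsRetractionOver F Z 0 (B k) ρ} := fun k =>
    Nat.rec ⟨ρ₀, h₀⟩ (fun k ρ => next k ρ) k
  have hRs : ∀ k y, F y ≤ B k → (R (k + 1)).1 y = (R k).1 y := fun k y hy => hnext k (R k) y hy
  have hR : ∀ j k, j ≤ k → ∀ y, F y ≤ B j → (R k).1 y = (R j).1 y := by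
    intro j k hjk
    induction hjk with
    | refl => intro y _; rfl
    | step hjk ih =>
      intro y hy
      rw [hRs _ y (hy.trans (hBmono hjk)), ih y hy]
  choose N hN using fun y => hBlim (F y) (hF1 y)
  let r : M → M := fun y => (R (N y)).1 y
  have hr : ∀ k y, F y ≤ B k → r y = (R k).1 y := by
    intro k y hy
    rcases le_total (N y) k with h | h
    · exact (hR _ _ h y (hN y).le).symm
    · exact hR _ _ h y hy
  refine ⟨r, ?_, ?_, ?_, ?_⟩
  · rw [continuous_iff_continuousAt]
    intro y
    have hnear : ∀ᶠ z in 𝓝 y, F z < B (N y) := hF.continuousAt.eventually_lt_const (hN y)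
    have hcont : ContinuousAt (R (N y)).1 y := by
      refine (R (N y)).2.continuousOn.continuousAt ?_
      filter_upwards [hnear] with z hz
      exact ⟨hF0 z, hz.le⟩
    refine hcont.congr ?_
    filter_upwards [hnear] with z hz
    exact (hr _ z hz.le).symm
  · intro τ hτ
    obtain ⟨k, hk⟩ := hBlim τ hτ.2
    refine ((R k).2.bijOn τ ⟨hτ.1, hk.le⟩).congr fun y hy => (hr k y ?_).symm
    exact (show F y = τ from hy).trans_le hk.le
  · intro y hy
    rw [hr 0 y (hy.trans_le (hB0 0)), (R 0).2.eq_self y hy]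
  · intro y i
    exact (R (N y)).2.mem_iff y ⟨hF0 y, (hN y).le⟩ i

end IsRetractionOver

end SemiStable

namespace SemiStable

/-! ### Orthant charts -/

/-- The orthant on which the coordinates with index in `K` are nonnegative. -/
def orthant {n : ℕ} (K : Finset (Fin n)) : Set (Fin n → ℝ) := {x | ∀ j ∈ K, 0 ≤ x j}

theorem isClosed_orthant {n : ℕ} (K : Finset (Fin n)) : IsClosed (orthant K) := by
  have : orthant K = ⋂ j ∈ K, {x | 0 ≤ x j} := by ext; simp [orthant]
  rw [this]
  exact isClosed_biInter fun j _ => isClosed_le continuous_const (continuous_apply j)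

/-- The direction of the flow in an orthant. -/
def flowDir {n : ℕ} (K : Finset (Fin n)) : Fin n → ℝ := fun j => if j ∈ K then 1 else 0

theorem norm_flowDir_le {n : ℕ} (K : Finset (Fin n)) : ‖flowDir K‖ ≤ 1 := by
  refine (pi_norm_le_iff_of_nonneg zero_le_one).2 fun j => ?_
  by_cases h : j ∈ K <;> simp [flowDir, h]

/-- The minimum of the coordinates with index in `K`. -/
noncomputable def minCoord {n : ℕ} (K : Finset (Fin n)) (hK : K.Nonempty) (x : Fin n → ℝ) : ℝ :=
  K.inf' hK x

section minCoord

variable {n : ℕ} {K : Finset (Fin n)} (hK : K.Nonempty)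

theorem minCoord_le (x : Fin n → ℝ) {j : Fin n} (hj : j ∈ K) : minCoord K hK x ≤ x j :=
  Finset.inf'_le x hj

theorem exists_minCoord_eq (x : Fin n → ℝ) : ∃ j ∈ K, minCoord K hK x = x j :=
  Finset.exists_mem_eq_inf' hK x

theorem continuous_minCoord : Continuous (minCoord K hK) :=
  Continuous.finset_inf'_apply hK fun j _ => continuous_apply j

/-- The flow shifts all coordinates in `K` by the same amount, so their minimum measures time;
flowing back by it projects the orthant to its boundary. -/
theorem minCoord_add_smul (x : Fin n → ℝ) (s : ℝ) :
    minCoord K hK (x + s • flowDir K) = minCoord K hK x + s := by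
  apply le_antisymm
  · obtain ⟨j, hj, h⟩ := exists_minCoord_eq hK x
    rw [h]
    refine (minCoord_le hK _ hj).trans_eq ?_
    simp [flowDir, hj]
  · obtain ⟨j, hj, h⟩ := exists_minCoord_eq hK (x + s • flowDir K)
    rw [h]
    have := minCoord_le hK x hj
    simpa [flowDir, hj] using this

theorem abs_minCoord_sub_le (x y : Fin n → ℝ) :
    |minCoord K hK x - minCoord K hK y| ≤ ‖x - y‖ := by
  have key : ∀ x y : Fin n → ℝ, minCoord K hK x - minCoord K hK y ≤ ‖x - y‖ := by
    intro x y
    obtain ⟨j, hj, h⟩ := exists_minCoord_eq hK y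
    have h1 := minCoord_le hK x hj
    have h2 := norm_le_pi_norm (x - y) j
    rw [Pi.sub_apply, Real.norm_eq_abs] at h2
    linarith [le_abs_self (x j - y j)]
  rw [abs_le]
  have := key y x
  rw [norm_sub_rev] at this
  exact ⟨by linarith, key x y⟩

end minCoord

theorem pow_sub_pow_le_mul {a b : ℝ} (hb : 0 ≤ b) (hab : b ≤ a) (n : ℕ) :
    a ^ n - b ^ n ≤ n * a ^ (n - 1) * (a - b) := by
  have h := abs_pow_sub_pow_le a b n
  rw [abs_of_nonneg (sub_nonneg.2 hab), abs_of_nonneg (hb.trans hab), abs_of_nonneg hb,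
    max_eq_left hab] at h
  calc a ^ n - b ^ n ≤ _ := le_abs_self _
    _ ≤ _ := h
    _ = _ := by ring

/-- The `n`-th root of a product of at most `n` coordinates grows at least linearly along the
flow. -/
theorem root_prod_expanding {n : ℕ} {K : Finset (Fin n)} (hK : K.Nonempty) {x : Fin n → ℝ}
    (hx : x ∈ orthant K) {s : ℝ} (hs : 0 < s) (h1 : ∏ j ∈ K, (x + s • flowDir K) j < 1) :
    s / n ≤ (∏ j ∈ K, (x + s • flowDir K) j) ^ (1 / (n : ℝ)) -
      (∏ j ∈ K, x j) ^ (1 / (n : ℝ)) := by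
  have hn : n ≠ 0 := by
    rintro rfl
    exact hK.choose.elim0
  have hnR : (0 : ℝ) < n := by exact_mod_cast Nat.pos_of_ne_zero hn
  have hco : ∀ j ∈ K, (x + s • flowDir K) j = x j + s := fun j hj => by simp [flowDir, hj]
  have hf' : ∏ j ∈ K, (x + s • flowDir K) j = ∏ j ∈ K, (x j + s) := Finset.prod_congr rfl hco
  rw [hf'] at h1 ⊢
  obtain ⟨i, hi, hmin⟩ := exists_minCoord_eq hK x
  have hmin' : ∀ j ∈ K, x i ≤ x j := fun j hj => hmin ▸ minCoord_le hK x hj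
  set f := ∏ j ∈ K, x j with hf
  set f' := ∏ j ∈ K, (x j + s) with hf'
  have hxi : 0 ≤ x i := hx i hi
  have hA : 0 < x i + s := by linarith
  have hf0 : 0 ≤ f := Finset.prod_nonneg fun j hj => hx j hj
  have hf'0 : 0 < f' := Finset.prod_pos fun j hj => by linarith [hx j hj]
  -- The ratio `f / f'` is at most that of the smallest factor, `x i / (x i + s)`; equivalently, `f'
  -- * s ≤ (f' - f) * (x i + s)`.
  have hmul : f * (x i + s) ≤ f' * x i := by
    rw [hf, hf', ← Finset.mul_prod_erase K _ hi, ← Finset.mul_prod_erase K _ hi]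
    have : ∏ j ∈ K.erase i, x j ≤ ∏ j ∈ K.erase i, (x j + s) :=
      Finset.prod_le_prod (fun j hj => hx j (Finset.mem_of_mem_erase hj))
        fun j _ => by linarith
    have h2 := mul_le_mul_of_nonneg_left this (mul_nonneg hxi hA.le)
    linarith
  have hff' : f ≤ f' := Finset.prod_le_prod (fun j hj => hx j hj) fun j _ => by linarith
  have hcard : (x i + s) ^ K.card ≤ f' := by
    rw [← Finset.prod_const]
    exact Finset.prod_le_prod (fun _ _ => hA.le) fun j hj => by linarith [hmin' j hj]
  have hA1 : x i + s ≤ 1 := by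
    by_contra! hcon
    have := one_le_pow₀ (n := K.card) hcon.le
    linarith
  -- Since `x i + s ≤ 1`, the exponent may be raised from the number of factors to `n`. This is
  -- where `f' < 1` enters, and it allows the same root in all charts, whatever their number of
  -- boundary coordinates.
  have hAn : (x i + s) ^ n ≤ f' :=
    (pow_le_pow_of_le_one hA.le hA1 (by simpa using K.card_le_univ)).trans hcard
  set G := f ^ (1 / (n : ℝ)) with hG
  set G' := f' ^ (1 / (n : ℝ)) with hG'
  have hGn : G ^ n = f := by
    rw [hG, one_div, Real.rpow_inv_natCast_pow hf0 hn]
  have hG'n : G' ^ n = f' := by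
    rw [hG', one_div, Real.rpow_inv_natCast_pow hf'0.le hn]
  have hG0 : 0 ≤ G := Real.rpow_nonneg hf0 _
  have hG'0 : 0 < G' := Real.rpow_pos_of_pos hf'0 _
  have hGG' : G ≤ G' := Real.rpow_le_rpow hf0 hff' (by positivity)
  have hAG : x i + s ≤ G' := by
    rw [← pow_le_pow_iff_left₀ hA.le hG'0.le hn, hG'n]
    exact hAn
  -- Since `f' - f ≤ n * G' ^ (n - 1) * (G' - G)`, the bound on `f' * s` becomes `G' * s ≤ n * (G' -
  -- G) * (x i + s)`, and the last factor is cancelled by means of `x i + s ≤ G'`.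
  have h3 := pow_sub_pow_le_mul hG0 hGG' n
  rw [hGn, hG'n] at h3
  have h4 : f' * s ≤ (f' - f) * (x i + s) := by nlinarith
  have h5 : G' ^ (n - 1) * G' = f' := by rw [pow_sub_one_mul hn, hG'n]
  have h6 : f' * s ≤ n * G' ^ (n - 1) * (G' - G) * (x i + s) :=
    h4.trans (mul_le_mul_of_nonneg_right h3 hA.le)
  have h7 : 0 < G' ^ (n - 1) := by positivity
  have h8 : G' * s ≤ n * (G' - G) * (x i + s) := by
    rw [← h5] at h6
    refine le_of_mul_le_mul_left ?_ h7
    linarith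
  have h9 : (x i + s) * s ≤ n * (G' - G) * (x i + s) :=
    (mul_le_mul_of_nonneg_right hAG hs.le).trans h8
  have h10 : s ≤ n * (G' - G) := by
    refine le_of_mul_le_mul_right ?_ hA
    linarith
  rw [div_le_iff₀ hnR]
  linarith

/-- Points of the flow box lie in a closed ball. -/
theorem add_smul_flowDir_mem {n : ℕ} {K : Finset (Fin n)} (hK : K.Nonempty) {x₀ β : Fin n → ℝ}
    {ρ s : ℝ} (h1 : minCoord K hK β = 0) (h2 : ‖β - (x₀ - minCoord K hK x₀ • flowDir K)‖ < ρ)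
    (h3 : 0 ≤ s) (h4 : |s - minCoord K hK x₀| < ρ) :
    β + s • flowDir K ∈ Metric.closedBall x₀ (2 * ρ) ∩ orthant K := by
  refine ⟨?_, fun j hj => ?_⟩
  · rw [mem_closedBall_iff_norm]
    have : β + s • flowDir K - x₀ =
        (β - (x₀ - minCoord K hK x₀ • flowDir K)) + (s - minCoord K hK x₀) • flowDir K := by
      rw [sub_smul]; abel
    rw [this]
    refine (norm_add_le _ _).trans ?_
    rw [norm_smul, Real.norm_eq_abs]
    have h6 := mul_le_mul h4.le (norm_flowDir_le K) (norm_nonneg _) ((abs_nonneg _).trans h4.le)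
    linarith
  · have h5 := minCoord_le hK β hj
    simp only [flowDir, Pi.add_apply, Pi.smul_apply, hj, if_true, smul_eq_mul, mul_one]
    linarith

/-- A chart identifying an open set with an open subset of an orthant, in which `f` is the product
of the coordinates with index in `K` and the sets `Z i` are invariant under changes of these
coordinates. -/
structure OrthantChart (M : Type*) [TopologicalSpace M] {I : Type*} (n : ℕ) (f : M → ℝ)
    (Z : I → Set M) where
  e : PartialEquiv M (Fin n → ℝ)
  K : Finset (Fin n)
  W : Set (Fin n → ℝ)
  nonempty : K.Nonempty
  isOpen_W : IsOpen W
  target_eq : e.target = W ∩ orthant K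
  open_source : IsOpen e.source
  continuousOn : ContinuousOn e e.source
  continuousOn_symm : ContinuousOn e.symm e.target
  f_eq : ∀ y ∈ e.source, f y = ∏ j ∈ K, e y j
  sat : ∀ i, ∀ y ∈ e.source, ∀ y' ∈ e.source, (∀ j ∉ K, e y j = e y' j) → y ∈ Z i → y' ∈ Z i

namespace OrthantChart

variable {M I : Type*} [TopologicalSpace M] {n : ℕ} {f : M → ℝ} {Z : I → Set M}
  (c : OrthantChart M n f Z)

/-- The flow box around a point of the orthant of radius `ρ`. -/
noncomputable def box (x₀ : Fin n → ℝ) (ρ : ℝ) (hρ : Metric.closedBall x₀ (2 * ρ) ⊆ c.W) :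
    FlowBox M (Fin n → ℝ) where
  e :=
    { toFun := fun y => (c.e y - minCoord c.K c.nonempty (c.e y) • flowDir c.K,
        minCoord c.K c.nonempty (c.e y))
      invFun := fun p => c.e.symm (p.1 + p.2 • flowDir c.K)
      -- Base point and time are each kept within `ρ` of those of `x₀`; the two errors add up to at
      -- most `2 * ρ`, so the whole product stays in `c.W`.
      source := {y ∈ c.e.source |
        ‖c.e y - minCoord c.K c.nonempty (c.e y) • flowDir c.K -
          (x₀ - minCoord c.K c.nonempty x₀ • flowDir c.K)‖ < ρ ∧
        |minCoord c.K c.nonempty (c.e y) - minCoord c.K c.nonempty x₀| < ρ}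
      target := {β | minCoord c.K c.nonempty β = 0 ∧
          ‖β - (x₀ - minCoord c.K c.nonempty x₀ • flowDir c.K)‖ < ρ} ×ˢ
        {s | 0 ≤ s ∧ |s - minCoord c.K c.nonempty x₀| < ρ}
      map_source' := by
        rintro y ⟨hy, h1, h2⟩
        have hy' := c.e.map_source hy
        rw [c.target_eq] at hy'
        refine ⟨⟨?_, h1⟩, ?_, h2⟩
        · rw [sub_eq_add_neg, ← neg_smul, minCoord_add_smul, add_neg_cancel]
        · obtain ⟨j, hj, h⟩ := exists_minCoord_eq c.nonempty (c.e y)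
          simp only [h]
          exact hy'.2 j hj
      map_target' := by
        rintro ⟨β, s⟩ ⟨⟨h1, h2⟩, h3, h4⟩
        have hmem : β + s • flowDir c.K ∈ c.e.target := by
          have h := add_smul_flowDir_mem c.nonempty h1 h2 h3 h4
          rw [c.target_eq]
          exact ⟨hρ h.1, h.2⟩
        have hr : c.e (c.e.symm (β + s • flowDir c.K)) = β + s • flowDir c.K := c.e.right_inv hmem
        refine ⟨c.e.map_target hmem, ?_, ?_⟩
        · simp only at h1 h2
          simp only [hr, minCoord_add_smul, h1, zero_add, add_sub_cancel_right]
          exact h2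
        · simp only at h1 h4
          simp only [hr, minCoord_add_smul, h1, zero_add]
          exact h4
      left_inv' := by
        rintro y ⟨hy, -, -⟩
        simp only [sub_add_cancel]
        exact c.e.left_inv hy
      right_inv' := by
        rintro ⟨β, s⟩ ⟨⟨h1, h2⟩, h3, h4⟩
        have hmem : β + s • flowDir c.K ∈ c.e.target := by
          have h := add_smul_flowDir_mem c.nonempty h1 h2 h3 h4
          rw [c.target_eq]
          exact ⟨hρ h.1, h.2⟩
        have hr : c.e (c.e.symm (β + s • flowDir c.K)) = β + s • flowDir c.K := c.e.right_inv hmem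
        simp only at h1
        simp only [hr, minCoord_add_smul, h1, zero_add, add_sub_cancel_right] }
  base := {β | minCoord c.K c.nonempty β = 0 ∧
    ‖β - (x₀ - minCoord c.K c.nonempty x₀ • flowDir c.K)‖ < ρ}
  times := {s | 0 ≤ s ∧ |s - minCoord c.K c.nonempty x₀| < ρ}
  open_source := by
    have hm : ContinuousOn (fun y => minCoord c.K c.nonempty (c.e y)) c.e.source :=
      (continuous_minCoord c.nonempty).comp_continuousOn c.continuousOn
    have h1 : ContinuousOn (fun y => ‖c.e y - minCoord c.K c.nonempty (c.e y) • flowDir c.K -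
          (x₀ - minCoord c.K c.nonempty x₀ • flowDir c.K)‖) c.e.source :=
      ((c.continuousOn.sub (hm.smul continuousOn_const)).sub continuousOn_const).norm
    have h2 : ContinuousOn (fun y =>
        |minCoord c.K c.nonempty (c.e y) - minCoord c.K c.nonempty x₀|) c.e.source :=
      (hm.sub continuousOn_const).abs
    have h3 := (h1.prodMk h2).isOpen_inter_preimage c.open_source
      ((isOpen_Iio (a := ρ)).prod (isOpen_Iio (a := ρ)))
    exact h3
  continuousOn := by
    have hm : ContinuousOn (fun y => minCoord c.K c.nonempty (c.e y)) c.e.source :=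
      (continuous_minCoord c.nonempty).comp_continuousOn c.continuousOn
    exact ((c.continuousOn.sub (hm.smul continuousOn_const)).prodMk hm).mono fun y hy => hy.1
  continuousOn_symm := by
    refine c.continuousOn_symm.comp (Continuous.continuousOn (by fun_prop)) ?_
    rintro ⟨β, s⟩ ⟨⟨h1, h2⟩, h3, h4⟩
    have h := add_smul_flowDir_mem c.nonempty h1 h2 h3 h4
    rw [c.target_eq]
    exact ⟨hρ h.1, h.2⟩
  target_eq := rfl
  ordConnected := by
    refine ⟨fun s hs s' hs' u hu => ⟨hs.1.trans hu.1, ?_⟩⟩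
    have h1 := abs_lt.1 hs.2
    have h2 := abs_lt.1 hs'.2
    exact abs_lt.2 ⟨by linarith [hu.1], by linarith [hu.2]⟩
  exists_gt := by
    intro s hs
    have h1 := abs_lt.1 hs.2
    obtain ⟨s', h2, h3⟩ := exists_between (show s < minCoord c.K c.nonempty x₀ + ρ by linarith)
    exact ⟨s', ⟨hs.1.trans h2.le, abs_lt.2 ⟨by linarith, by linarith⟩⟩, h2⟩

section box

variable {x₀ : Fin n → ℝ} {ρ : ℝ} (hρ : Metric.closedBall x₀ (2 * ρ) ⊆ c.W)

theorem box_symm_apply (β : Fin n → ℝ) (s : ℝ) :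
    (c.box x₀ ρ hρ).e.symm (β, s) = c.e.symm (β + s • flowDir c.K) := rfl

theorem box_line_mem {β : Fin n → ℝ} {s : ℝ} (hβ : β ∈ (c.box x₀ ρ hρ).base)
    (hs : s ∈ (c.box x₀ ρ hρ).times) :
    β + s • flowDir c.K ∈ Metric.closedBall x₀ (2 * ρ) ∩ orthant c.K :=
  add_smul_flowDir_mem c.nonempty hβ.1 hβ.2 hs.1 hs.2

include hρ in
theorem closedBall_inter_subset_target :
    Metric.closedBall x₀ (2 * ρ) ∩ orthant c.K ⊆ c.e.target := by
  rw [c.target_eq]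
  exact inter_subset_inter_left _ hρ

/-- Flow lines change only the coordinates with index in `K`, to which the sets `Z i` are
insensitive. -/
theorem box_sat (i : I) {y y' : M} (hy : y ∈ (c.box x₀ ρ hρ).e.source)
    (hy' : y' ∈ (c.box x₀ ρ hρ).e.source)
    (h : ((c.box x₀ ρ hρ).e y').1 = ((c.box x₀ ρ hρ).e y).1) : y' ∈ Z i ↔ y ∈ Z i := by
  have key : ∀ j ∉ c.K, c.e y' j = c.e y j := by
    intro j hj
    have := congrFun h j
    simpa [box, flowDir, hj] using this
  exact ⟨c.sat i _ hy'.1 _ hy.1 key, c.sat i _ hy.1 _ hy'.1 fun j hj => (key j hj).symm⟩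

theorem box_root_expanding (hf : ∀ y, f y < 1) {β : Fin n → ℝ} (hβ : β ∈ (c.box x₀ ρ hρ).base)
    {s s' : ℝ} (hs : s ∈ (c.box x₀ ρ hρ).times) (hs' : s' ∈ (c.box x₀ ρ hρ).times)
    (h : s < s') :
    (s' - s) / n ≤ f ((c.box x₀ ρ hρ).e.symm (β, s')) ^ (1 / (n : ℝ)) -
      f ((c.box x₀ ρ hρ).e.symm (β, s)) ^ (1 / (n : ℝ)) := by
  have h1 := c.box_line_mem hρ hβ hs
  have h2 := c.closedBall_inter_subset_target hρ (c.box_line_mem hρ hβ hs')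
  have h3 := c.closedBall_inter_subset_target hρ h1
  have e1 : β + s' • flowDir c.K = (β + s • flowDir c.K) + (s' - s) • flowDir c.K := by
    rw [sub_smul]; abel
  have f2 : f ((c.box x₀ ρ hρ).e.symm (β, s')) =
      ∏ j ∈ c.K, ((β + s • flowDir c.K) + (s' - s) • flowDir c.K) j := by
    rw [box_symm_apply, c.f_eq _ (c.e.map_target h2), c.e.right_inv h2, e1]
  have f1 : f ((c.box x₀ ρ hρ).e.symm (β, s)) = ∏ j ∈ c.K, (β + s • flowDir c.K) j := by
    rw [box_symm_apply, c.f_eq _ (c.e.map_target h3), c.e.right_inv h3]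
  have h4 := hf ((c.box x₀ ρ hρ).e.symm (β, s'))
  rw [f1]
  rw [f2] at h4 ⊢
  exact root_prod_expanding c.nonempty h1.2 (sub_pos.2 h) h4

/-- The times are cut out of `[0, ∞)` by an open condition, so a least time can only be `0`; there
some coordinate in `K` vanishes. -/
theorem box_bottom {u : ℝ} (hu : IsLeast (c.box x₀ ρ hρ).times u) {β : Fin n → ℝ}
    (hβ : β ∈ (c.box x₀ ρ hρ).base) : f ((c.box x₀ ρ hρ).e.symm (β, u)) = 0 := by
  have h0 : u = 0 := by
    by_contra hne
    have hpos : 0 < u := lt_of_le_of_ne hu.1.1 (Ne.symm hne)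
    have h1 := abs_lt.1 hu.1.2
    obtain ⟨w, hw1, hw2⟩ :=
      exists_between (max_lt hpos (show minCoord c.K c.nonempty x₀ - ρ < u by linarith))
    have h2 := (le_max_left _ _).trans_lt hw1
    have h3 := (le_max_right _ _).trans_lt hw1
    have h4 := hu.2 (show w ∈ (c.box x₀ ρ hρ).times from
      ⟨h2.le, abs_lt.2 ⟨by linarith, by linarith⟩⟩)
    linarith
  have h2 := c.closedBall_inter_subset_target hρ (c.box_line_mem hρ hβ hu.1)
  rw [box_symm_apply, c.f_eq _ (c.e.map_target h2), c.e.right_inv h2, h0, zero_smul, add_zero]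
  obtain ⟨j, hj, h⟩ := exists_minCoord_eq c.nonempty β
  exact Finset.prod_eq_zero hj (by rw [← h]; exact hβ.1)

/-- A function which is locally Lipschitz in the coordinates of the chart is uniformly Lipschitz
along the flow lines of a box. -/
theorem box_lipschitz {g : M → ℝ}
    (hg : ∀ y ∈ c.e.source, ∃ L : NNReal, ∃ U ∈ 𝓝 y, ∀ a ∈ U, ∀ b ∈ U,
      dist (g a) (g b) ≤ L * dist (c.e a) (c.e b)) :
    ∃ L : NNReal, ∀ β ∈ (c.box x₀ ρ hρ).base, ∀ s ∈ (c.box x₀ ρ hρ).times,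
      ∀ s' ∈ (c.box x₀ ρ hρ).times,
      |g ((c.box x₀ ρ hρ).e.symm (β, s)) - g ((c.box x₀ ρ hρ).e.symm (β, s'))| ≤
        L * |s - s'| := by
  set D := Metric.closedBall x₀ (2 * ρ) ∩ orthant c.K
  have hD : IsCompact D := (isCompact_closedBall _ _).inter_right (isClosed_orthant _)
  have hDt : D ⊆ c.e.target := c.closedBall_inter_subset_target hρ
  -- A locally Lipschitz function on a compact set is Lipschitz, and `D` contains all flow lines of
  -- the box.
  have hloc : LocallyLipschitzOn D fun x => g (c.e.symm x) := by
    intro x hx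
    obtain ⟨L, U, hU, h⟩ := hg _ (c.e.map_target (hDt hx))
    have hc := (c.continuousOn_symm.mono hDt) x hx
    refine ⟨L, D ∩ c.e.symm ⁻¹' U, inter_mem self_mem_nhdsWithin (hc hU), ?_⟩
    refine LipschitzOnWith.of_dist_le_mul fun a ha b hb => ?_
    have := h _ ha.2 _ hb.2
    rwa [c.e.right_inv (hDt ha.1), c.e.right_inv (hDt hb.1)] at this
  obtain ⟨L, hL⟩ := hloc.exists_lipschitzOnWith_of_compact hD
  refine ⟨L, fun β hβ s hs s' hs' => ?_⟩
  have h1 := hL.dist_le_mul _ (c.box_line_mem hρ hβ hs) _ (c.box_line_mem hρ hβ hs')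
  rw [Real.dist_eq] at h1
  refine h1.trans (mul_le_mul_of_nonneg_left ?_ L.2)
  rw [dist_eq_norm, add_sub_add_left_eq_sub, ← sub_smul, norm_smul, Real.norm_eq_abs]
  exact mul_le_of_le_one_right (abs_nonneg _) (norm_flowDir_le _)

end box

open Classical in
/-- A bump function around the point with coordinates `x₀`. -/
noncomputable def bump (x₀ : Fin n → ℝ) (r : ℝ) (y : M) : ℝ :=
  if y ∈ c.e.source then max 0 (2 - 2 / r * dist (c.e y) x₀) else 0

/-- The support of the bump function. -/
def bumpSupport (x₀ : Fin n → ℝ) (r : ℝ) : Set M :=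
  c.e.symm '' (Metric.closedBall x₀ r ∩ orthant c.K)

section bump

variable {x₀ : Fin n → ℝ} {r : ℝ}

theorem bump_nonneg (y : M) : 0 ≤ c.bump x₀ r y := by
  unfold bump
  split_ifs
  · exact le_max_left _ _
  · exact le_rfl

theorem bump_self {y : M} (hy : y ∈ c.e.source) : c.bump (c.e y) r y = 2 := by
  rw [bump, if_pos hy, dist_self]
  norm_num

variable (hr : Metric.closedBall x₀ r ⊆ c.W)

include hr in
theorem isCompact_bumpSupport : IsCompact (c.bumpSupport x₀ r) := by
  refine ((isCompact_closedBall _ _).inter_right (isClosed_orthant _)).image_of_continuousOn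
    (c.continuousOn_symm.mono ?_)
  rw [c.target_eq]
  exact inter_subset_inter_left _ hr

include hr in
theorem bumpSupport_subset : c.bumpSupport x₀ r ⊆ c.e.source := by
  rintro _ ⟨x, hx, rfl⟩
  refine c.e.map_target ?_
  rw [c.target_eq]
  exact ⟨hr hx.1, hx.2⟩

theorem bump_eq_zero (hr0 : 0 < r) {y : M} (hy : y ∉ c.bumpSupport x₀ r) : c.bump x₀ r y = 0 := by
  unfold bump
  split_ifs with h
  · refine max_eq_left ?_
    have hd : r ≤ dist (c.e y) x₀ := by
      by_contra! hcon
      refine hy ⟨c.e y, ⟨hcon.le, ?_⟩, c.e.left_inv h⟩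
      have := c.e.map_source h
      rw [c.target_eq] at this
      exact this.2
    have h1 := mul_le_mul_of_nonneg_left hd (show 0 ≤ 2 / r by positivity)
    rw [div_mul_cancel₀ _ hr0.ne'] at h1
    linarith
  · rfl

include hr in
theorem bump_eventually_eq_zero [T2Space M] (hr0 : 0 < r) {y : M} (hy : y ∉ c.bumpSupport x₀ r) :
    ∀ᶠ z in 𝓝 y, c.bump x₀ r z = 0 := by
  filter_upwards [(c.isCompact_bumpSupport hr).isClosed.isOpen_compl.mem_nhds hy] with z hz
  exact c.bump_eq_zero hr0 hz

include hr in
theorem continuous_bump [T2Space M] (hr0 : 0 < r) : Continuous (c.bump x₀ r) := by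
  rw [continuous_iff_continuousAt]
  intro y
  by_cases hy : y ∈ c.bumpSupport x₀ r
  · have hs := c.bumpSupport_subset hr hy
    have h1 : ContinuousAt (fun z => max 0 (2 - 2 / r * dist (c.e z) x₀)) y := by
      have := c.continuousOn.continuousAt (c.open_source.mem_nhds hs)
      exact continuousAt_const.max
        (continuousAt_const.sub (continuousAt_const.mul (this.dist continuousAt_const)))
    refine h1.congr ?_
    filter_upwards [c.open_source.mem_nhds hs] with z hz
    exact (if_pos hz).symm
  · exact (continuousAt_const (y := (0 : ℝ))).congr
      ((c.bump_eventually_eq_zero hr hr0 hy).mono fun z hz => hz.symm)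

theorem dist_bump_le (hr0 : 0 < r) {a b : M} (ha : a ∈ c.e.source) (hb : b ∈ c.e.source) :
    dist (c.bump x₀ r a) (c.bump x₀ r b) ≤ 2 / r * dist (c.e a) (c.e b) := by
  rw [bump, bump, if_pos ha, if_pos hb, Real.dist_eq]
  refine (abs_max_sub_max_le_max _ _ _ _).trans ?_
  rw [sub_self, abs_zero]
  refine max_le (by positivity) ?_
  have h1 : (2 - 2 / r * dist (c.e a) x₀) - (2 - 2 / r * dist (c.e b) x₀) =
      2 / r * (dist (c.e b) x₀ - dist (c.e a) x₀) := by ring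
  rw [h1, abs_mul, abs_of_pos (show 0 < 2 / r by positivity)]
  refine mul_le_mul_of_nonneg_left ?_ (by positivity)
  rw [dist_comm (c.e a) (c.e b)]
  exact abs_dist_sub_le _ _ _

include hr in
/-- Bump functions are locally Lipschitz in the coordinates of other charts. -/
theorem bump_locally_lipschitz [T2Space M] (hr0 : 0 < r) (c' : OrthantChart M n f Z)
    (htr : ∀ y ∈ c.e.source ∩ c'.e.source, ∃ L : NNReal, ∃ U ∈ 𝓝 y, ∀ a ∈ U, ∀ b ∈ U,
      dist (c.e a) (c.e b) ≤ L * dist (c'.e a) (c'.e b)) :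
    ∀ y ∈ c'.e.source, ∃ L : NNReal, ∃ U ∈ 𝓝 y, ∀ a ∈ U, ∀ b ∈ U,
      dist (c.bump x₀ r a) (c.bump x₀ r b) ≤ L * dist (c'.e a) (c'.e b) := by
  intro y hy
  by_cases hK : y ∈ c.bumpSupport x₀ r
  · have hs := c.bumpSupport_subset hr hK
    obtain ⟨L, U, hU, h⟩ := htr y ⟨hs, hy⟩
    refine ⟨(2 / r).toNNReal * L, U ∩ c.e.source, inter_mem hU (c.open_source.mem_nhds hs), ?_⟩
    intro a ha b hb
    refine (c.dist_bump_le hr0 ha.2 hb.2).trans ?_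
    rw [NNReal.coe_mul, Real.coe_toNNReal _ (by positivity), mul_assoc]
    exact mul_le_mul_of_nonneg_left (h a ha.1 b hb.1) (by positivity)
  · refine ⟨0, _, c.bump_eventually_eq_zero hr hr0 hK, fun a ha b hb => ?_⟩
    have ha : c.bump x₀ r a = 0 := ha
    have hb : c.bump x₀ r b = 0 := hb
    simp [ha, hb]

/-- Replacing points by their projections along the flow at most doubles the distance to the centre,
so radius `ρ / 3` stays strictly inside the bounds `ρ` of the box. -/
theorem bumpSupport_subset_box {ρ : ℝ} (hρ0 : 0 < ρ)
    (hρ : Metric.closedBall x₀ (2 * ρ) ⊆ c.W) :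
    c.bumpSupport x₀ (ρ / 3) ⊆ (c.box x₀ ρ hρ).e.source := by
  rintro _ ⟨x, ⟨hx, hxo⟩, rfl⟩
  have hxt : x ∈ c.e.target := by
    rw [c.target_eq]
    refine ⟨hρ (Metric.closedBall_subset_closedBall (by linarith) hx), hxo⟩
  refine ⟨c.e.map_target hxt, ?_⟩
  rw [c.e.right_inv hxt]
  rw [mem_closedBall_iff_norm] at hx
  have h1 := abs_minCoord_sub_le c.nonempty x x₀
  refine ⟨?_, by linarith⟩
  have : x - minCoord c.K c.nonempty x • flowDir c.K -
      (x₀ - minCoord c.K c.nonempty x₀ • flowDir c.K) =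
      (x - x₀) - (minCoord c.K c.nonempty x - minCoord c.K c.nonempty x₀) • flowDir c.K := by
    rw [sub_smul]; abel
  rw [this]
  refine (norm_sub_le _ _).trans_lt ?_
  rw [norm_smul, Real.norm_eq_abs]
  have h2 := mul_le_of_le_one_right
    (abs_nonneg (minCoord c.K c.nonempty x - minCoord c.K c.nonempty x₀)) (norm_flowDir_le c.K)
  linarith

end bump

end OrthantChart

end SemiStable

/-! ### Retractions of spaces with orthant charts -/

namespace SemiStable

theorem abs_truncSum_sub_le {M A : Type*} (lam : A → M → ℝ) (s : Finset A) (y z : M) :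
    |truncSum lam s y - truncSum lam s z| ≤ ∑ l ∈ s, |lam l y - lam l z| := by
  unfold truncSum
  refine (abs_min_sub_min_le_max _ _ _ _).trans ?_
  rw [sub_self, abs_zero, ← Finset.sum_sub_distrib]
  exact max_le (Finset.sum_nonneg fun _ _ => abs_nonneg _) (Finset.abs_sum_le_sum_abs _ _)

section

variable {M I : Type*} [TopologicalSpace M] [T2Space M] {n : ℕ} {f : M → ℝ} {Z : I → Set M}

/-- Finitely many boxes cover the compact fibre. Along their flow lines `F` grows at rate at least
`1 / n`, while the truncated sums of bump functions have a common Lipschitz constant `Lt`. So `F`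
minus a small multiple of such a sum still increases, as `exists_retraction_of_boxes` requires. -/
theorem exists_local_retraction (hn : n ≠ 0) (hf : Continuous f) (hf0 : ∀ y, 0 ≤ f y)
    (hf1 : ∀ y, f y < 1)
    (hcomp : ∀ b < 1, IsCompact (f ⁻¹' Iic b)) (c : M → OrthantChart M n f Z)
    (hc : ∀ y, y ∈ (c y).e.source)
    (htr : ∀ x z, ∀ y ∈ (c x).e.source ∩ (c z).e.source, ∃ L : NNReal, ∃ U ∈ 𝓝 y,
      ∀ a ∈ U, ∀ b ∈ U, dist ((c x).e a) ((c x).e b) ≤ L * dist ((c z).e a) ((c z).e b))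
    {t : ℝ} (ht : t ∈ Ico (0 : ℝ) 1) :
    ∃ ε > 0, ∀ a b, 0 ≤ a → a ≤ b → b < 1 → t - ε < a → b < t + ε →
      ∃ ρ, IsRetractionOver (fun y => f y ^ (1 / (n : ℝ))) Z a b ρ := by
  classical
  set F : M → ℝ := fun y => f y ^ (1 / (n : ℝ)) with hFdef
  have hnR : (0 : ℝ) < n := by exact_mod_cast Nat.pos_of_ne_zero hn
  have hF : Continuous F := hf.rpow_const fun _ => Or.inr (by positivity)
  have hFn : ∀ y, F y ^ n = f y := fun y => by
    rw [hFdef, one_div]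
    exact Real.rpow_inv_natCast_pow (hf0 y) hn
  have hF0 : ∀ y, 0 ≤ F y := fun y => Real.rpow_nonneg (hf0 y) _
  have hFcomp : ∀ b < 1, IsCompact (F ⁻¹' Iic b) := by
    intro b hb
    rcases lt_or_ge b 0 with h0 | h0
    · convert isCompact_empty
      ext y
      simpa using h0.trans_le (hF0 y)
    · refine (hcomp (b ^ n) (pow_lt_one₀ h0 hb hn)).of_isClosed_subset (isClosed_Iic.preimage hF) ?_
      intro y hy
      change f y ≤ b ^ n
      rw [← hFn]
      exact pow_le_pow_left₀ (hF0 y) hy n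
  -- boxes and bump functions
  have hball : ∀ y, ∃ ρ > 0, Metric.closedBall ((c y).e y) (2 * ρ) ⊆ (c y).W := by
    intro y
    have hW : (c y).e y ∈ (c y).W := by
      have := (c y).e.map_source (hc y)
      rw [(c y).target_eq] at this
      exact this.1
    obtain ⟨ρ, hρ, h⟩ := Metric.nhds_basis_closedBall.mem_iff.1 ((c y).isOpen_W.mem_nhds hW)
    exact ⟨ρ / 2, by positivity, by rwa [mul_div_cancel₀ _ (two_ne_zero)]⟩
  choose ρ hρ0 hρ using hball
  have hr : ∀ y, Metric.closedBall ((c y).e y) (ρ y / 3) ⊆ (c y).W := fun y =>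
    (Metric.closedBall_subset_closedBall (by linarith [hρ0 y])).trans (hρ y)
  have hr0 : ∀ y, 0 < ρ y / 3 := fun y => by linarith [hρ0 y]
  let X : M → FlowBox M (Fin n → ℝ) := fun y => (c y).box _ _ (hρ y)
  let lam : M → M → ℝ := fun y => (c y).bump ((c y).e y) (ρ y / 3)
  have hlc : ∀ l, Continuous (lam l) := fun l => (c l).continuous_bump (hr l) (hr0 l)
  have hl0 : ∀ l y, 0 ≤ lam l y := fun l y => (c l).bump_nonneg y
  have hself : ∀ y, lam y y = 2 := fun y => (c y).bump_self (hc y)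
  have hLip : ∀ l k, ∃ L : NNReal, ∀ β ∈ (X k).base, ∀ s ∈ (X k).times, ∀ s' ∈ (X k).times,
      |lam l ((X k).e.symm (β, s)) - lam l ((X k).e.symm (β, s'))| ≤ L * |s - s'| := fun l k =>
    (c k).box_lipschitz (hρ k) ((c l).bump_locally_lipschitz (hr l) (hr0 l) (c k) (htr l k))
  choose L hL using hLip
  -- the finite cover
  have hC : IsCompact (F ⁻¹' {t}) :=
    (hFcomp t ht.2).of_isClosed_subset (isClosed_singleton.preimage hF) fun y hy => hy.le
  -- A bump function has the value `2` at its centre, so it exceeds `1` on a neighbourhood; wherever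
  -- one of them does, the sum is at least `1`.
  obtain ⟨S, hS⟩ := hC.elim_finite_subcover (fun y => {z | 1 < lam y z})
    (fun y => isOpen_lt continuous_const (hlc y)) fun y _ =>
      mem_iUnion.2 ⟨y, by simp [hself y]⟩
  let V : Set M := ⋃ y ∈ S, {z | 1 < lam y z}
  have hV : IsOpen V := isOpen_biUnion fun y _ => isOpen_lt continuous_const (hlc y)
  obtain ⟨b₁, hb₁, hb₁'⟩ := exists_between ht.2
  -- The levels of uncovered points up to `b₁` form a compact set missing `t`, so all fibres near
  -- `t` are covered.
  have hQ : IsCompact (F '' (F ⁻¹' Iic b₁ \ V)) := ((hFcomp b₁ hb₁').diff hV).image hF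
  have htQ : t ∉ F '' (F ⁻¹' Iic b₁ \ V) := by
    rintro ⟨y, hy, rfl⟩
    exact hy.2 (hS rfl)
  obtain ⟨ε₁, hε₁, hε₁'⟩ := Metric.mem_nhds_iff.1 (hQ.isClosed.isOpen_compl.mem_nhds htQ)
  let Lt : ℝ := ∑ k ∈ S, ∑ l ∈ S, (L l k : ℝ)
  have hLt : 0 ≤ Lt := Finset.sum_nonneg fun _ _ => Finset.sum_nonneg fun _ _ => NNReal.coe_nonneg _
  -- Chosen so that `δ * Lt < 1 / n`; the summand `1` guards against `Lt = 0`.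
  let δ : ℝ := 1 / (2 * n * (Lt + 1))
  have hδ : 0 < δ := by positivity
  have hδL : δ * Lt < 1 / n := by
    have h1 : δ * (Lt + 1) = 1 / (2 * n) := by
      simp only [δ]
      field_simp
    have h2 : 1 / (2 * (n : ℝ)) < 1 / n := one_div_lt_one_div_of_lt hnR (by linarith)
    nlinarith
  -- `ε₁` keeps the fibres covered, `δ / 2` bounds `b - a` by `δ`, and `b₁ - t` keeps the interval
  -- below `b₁`.
  refine ⟨min (min ε₁ (δ / 2)) (b₁ - t), by
    refine lt_min (lt_min hε₁ (by linarith)) (by linarith), ?_⟩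
  intro a b ha hab hb hta htb
  have e1 : min (min ε₁ (δ / 2)) (b₁ - t) ≤ ε₁ := (min_le_left _ _).trans (min_le_left _ _)
  have e2 : min (min ε₁ (δ / 2)) (b₁ - t) ≤ δ / 2 := (min_le_left _ _).trans (min_le_right _ _)
  have e3 : min (min ε₁ (δ / 2)) (b₁ - t) ≤ b₁ - t := min_le_right _ _
  refine exists_retraction_of_boxes hF S X
    (fun l => (c l).bumpSupport ((c l).e l) (ρ l / 3)) lam
    (fun l => (c l).isCompact_bumpSupport (hr l))
    (fun l => (c l).bumpSupport_subset_box (hρ0 l) (hρ l)) hlc hl0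
    (fun l y hy => (c l).bump_eq_zero (hr0 l) hy) (δ := δ) ha (by linarith) ?_ ?_ ?_ ?_
  · intro k hk s' hs' w hw0 hw β hβ u hu v hv huv
    have h1 : (v - u) / n ≤ F ((X k).e.symm (β, v)) - F ((X k).e.symm (β, u)) :=
      (c k).box_root_expanding (hρ k) hf1 hβ hu hv huv
    have h2 : |truncSum lam s' ((X k).e.symm (β, v)) - truncSum lam s' ((X k).e.symm (β, u))| ≤
        Lt * (v - u) := by
      refine (abs_truncSum_sub_le lam s' _ _).trans ?_
      have h3 : ∑ l ∈ s', |lam l ((X k).e.symm (β, v)) - lam l ((X k).e.symm (β, u))| ≤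
          ∑ l ∈ s', (L l k : ℝ) * (v - u) := Finset.sum_le_sum fun l _ => by
        have := hL l k β hβ v hv u hu
        rwa [abs_of_pos (sub_pos.2 huv)] at this
      refine h3.trans ?_
      rw [← Finset.sum_mul]
      refine mul_le_mul_of_nonneg_right ?_ (sub_pos.2 huv).le
      refine (Finset.sum_le_sum_of_subset_of_nonneg hs' fun _ _ _ => NNReal.coe_nonneg _).trans ?_
      exact Finset.single_le_sum (f := fun k => ∑ l ∈ S, (L l k : ℝ))
        (fun _ _ => Finset.sum_nonneg fun _ _ => NNReal.coe_nonneg _) hk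
    have h5 : w * (truncSum lam s' ((X k).e.symm (β, v)) -
        truncSum lam s' ((X k).e.symm (β, u))) ≤ δ * (Lt * (v - u)) :=
      (mul_le_mul_of_nonneg_left ((le_abs_self _).trans h2) hw0).trans
        (mul_le_mul_of_nonneg_right hw (mul_nonneg hLt (sub_pos.2 huv).le))
    have h6 : δ * Lt * (v - u) < 1 / n * (v - u) := mul_lt_mul_of_pos_right hδL (sub_pos.2 huv)
    have h7 : 1 / (n : ℝ) * (v - u) = (v - u) / n := by ring
    simp only
    linarith
  · intro l i y hy y' hy' h
    exact (c l).box_sat (hρ l) i hy hy' h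
  · intro l u hu β hβ
    have := (c l).box_bottom (hρ l) hu hβ
    change f _ ^ (1 / (n : ℝ)) ≤ 0
    rw [this, Real.zero_rpow (by positivity)]
  · intro y hy
    have hyV : y ∈ V := by
      by_contra hcon
      have h1 : F y ∈ F '' (F ⁻¹' Iic b₁ \ V) :=
        ⟨y, ⟨show F y ≤ b₁ by linarith [hy.2], hcon⟩, rfl⟩
      refine hε₁' ?_ h1
      rw [Metric.mem_ball, Real.dist_eq, abs_lt]
      constructor <;> linarith [hy.1, hy.2]
    obtain ⟨l, hl, hyl⟩ := mem_iUnion₂.1 hyV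
    exact (show 1 < lam l y from hyl).le.trans
      (Finset.single_le_sum (f := fun l => lam l y) (fun l _ => hl0 l y) hl)

/-- A space with an atlas of orthant charts retracts onto the special fibre of `f` so that every
fibre is mapped bijectively. -/
theorem exists_retraction_of_orthantCharts (hf : Continuous f) (hf0 : ∀ y, 0 ≤ f y)
    (hf1 : ∀ y, f y < 1)
    (hcomp : ∀ b < 1, IsCompact (f ⁻¹' Iic b)) (c : M → OrthantChart M n f Z)
    (hc : ∀ y, y ∈ (c y).e.source)
    (htr : ∀ x z, ∀ y ∈ (c x).e.source ∩ (c z).e.source, ∃ L : NNReal, ∃ U ∈ 𝓝 y,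
      ∀ a ∈ U, ∀ b ∈ U, dist ((c x).e a) ((c x).e b) ≤ L * dist ((c z).e a) ((c z).e b)) :
    ∃ r : M → M, Continuous r ∧
      (∀ τ ∈ Ico (0 : ℝ) 1, BijOn r {y | f y = τ} {y | f y = 0}) ∧
      ∀ y i, r y ∈ Z i ↔ y ∈ Z i := by
  rcases isEmpty_or_nonempty M with hM | ⟨⟨y₀⟩⟩
  · refine ⟨id, continuous_id, fun τ _ => ?_, fun y => hM.elim y⟩
    have : ∀ s : Set M, s = ∅ := fun s => s.eq_empty_of_isEmpty
    rw [this {y | f y = τ}, this {y | f y = 0}]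
    exact bijOn_empty _
  have hn : n ≠ 0 := by
    rintro rfl
    exact (c y₀).nonempty.choose.elim0
  have hnR : (0 : ℝ) < n := by exact_mod_cast Nat.pos_of_ne_zero hn
  have hF : Continuous fun y => f y ^ (1 / (n : ℝ)) :=
    hf.rpow_const fun _ => Or.inr (by positivity)
  obtain ⟨r, hrc, hrb, -, hrZ⟩ := IsRetractionOver.exists_global (Z := Z) hF
    (fun y => Real.rpow_nonneg (hf0 y) _)
    (fun y => Real.rpow_lt_one (hf0 y) (hf1 y) (by positivity))
    (fun a b ha hab hb => IsRetractionOver.exists_of_local hF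
      (fun t ht => exists_local_retraction hn hf hf0 hf1 hcomp c hc htr ht) ha hab hb)
  refine ⟨r, hrc, fun τ hτ => ?_, hrZ⟩
  -- The retraction was built for `f ^ (1 / n)`; taking roots only relabels the fibres.
  have hset : ∀ τ : ℝ, 0 ≤ τ →
      {y | f y ^ (1 / (n : ℝ)) = τ ^ (1 / (n : ℝ))} = {y | f y = τ} := by
    intro τ hτ
    ext y
    exact ⟨fun h => (Real.rpow_left_inj (hf0 y) hτ (by positivity)).1 h, fun h => by
      change f y ^ _ = _
      rw [show f y = τ from h]⟩
  have h := hrb (τ ^ (1 / (n : ℝ))) ⟨Real.rpow_nonneg hτ.1 _,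
    Real.rpow_lt_one hτ.1 hτ.2 (by positivity)⟩
  have h0 := hset 0 le_rfl
  rw [Real.zero_rpow (by positivity)] at h0
  rwa [hset τ hτ.1, h0] at h

end

end SemiStable

namespace SemiStable

/-! ### Holomorphic functions of several variables -/

section General

variable {E : Type*} [NormedAddCommGroup E] [NormedSpace ℂ E]

/-- A Cauchy estimate. -/
theorem norm_fderiv_le_of_bound {f : E → ℂ} {z : E} {R C : ℝ} (hR : 0 < R)
    (hd : DifferentiableOn ℂ f (Metric.ball z R)) (hC : ∀ w ∈ Metric.ball z R, ‖f w‖ ≤ C) :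
    ‖fderiv ℂ f z‖ ≤ 2 * C / R := by
  refine Complex.norm_fderiv_le_div_of_mapsTo_ball hd (fun w hw => ?_) hR
  rw [mem_closedBall_iff_norm]
  have h1 := hC w hw
  have h2 := hC z (Metric.mem_ball_self hR)
  linarith [norm_sub_le (f w) (f z)]

/-- Functions which are complex differentiable near a point are continuously differentiable. -/
theorem contDiffAt_one_of_eventually_differentiableAt {f : E → ℂ} {z₀ : E}
    (hf : ∀ᶠ z in 𝓝 z₀, DifferentiableAt ℂ f z) : ContDiffAt ℂ 1 f z₀ := by
  have hcont : ContinuousAt f z₀ := hf.self_of_nhds.continuousAt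
  have hbd : ∀ᶠ z in 𝓝 z₀, ‖f z‖ < ‖f z₀‖ + 1 :=
    hcont.norm.eventually_lt_const (by linarith)
  obtain ⟨R, hR, h⟩ := Metric.eventually_nhds_iff_ball.1 (hf.and hbd)
  set C := ‖f z₀‖ + 1
  have hC0 : 0 < C := by positivity
  -- Balls of radius `r` around points of the ball of radius `3 * r` stay within radius `R`, which
  -- leaves room for two Cauchy estimates.
  set r := R / 4 with hr
  have hr0 : 0 < r := by positivity
  have hb1 : ∀ z ∈ Metric.ball z₀ (3 * r), ‖fderiv ℂ f z‖ ≤ 2 * C / r := by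
    intro z hz
    have hsub : Metric.ball z r ⊆ Metric.ball z₀ R :=
      Metric.ball_subset_ball' (by rw [Metric.mem_ball] at hz; linarith)
    exact norm_fderiv_le_of_bound hr0 (fun w hw => (h w (hsub hw)).1.differentiableWithinAt)
      fun w hw => (h w (hsub hw)).2.le
  have hlip : ∀ z ∈ Metric.ball z₀ (3 * r), ∀ w ∈ Metric.ball z₀ (3 * r),
      ‖f w - f z‖ ≤ 2 * C / r * ‖w - z‖ := by
    intro z hz w hw
    refine (convex_ball z₀ (3 * r)).norm_image_sub_le_of_norm_fderiv_le (𝕜 := ℂ)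
      (fun x hx => (h x ?_).1) hb1 hz hw
    exact Metric.ball_subset_ball (by linarith) hx
  rw [contDiffAt_one_iff]
  refine ⟨fderiv ℂ f, Metric.ball z₀ r, Metric.ball_mem_nhds _ hr0, ?_, fun z hz =>
    (h z (Metric.ball_subset_ball (by linarith) hz)).1.hasFDerivAt⟩
  intro z hz
  refine ContinuousAt.continuousWithinAt ?_
  rw [Metric.mem_ball] at hz
  -- The second Cauchy estimate concerns the difference of `f` and its translate by `w - z`, which
  -- is of order `‖w - z‖` by the Lipschitz bound from the first. It shows that the derivative is
  -- Lipschitz at `z`.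
  have hkey : ∀ w ∈ Metric.ball z r, ‖fderiv ℂ f w - fderiv ℂ f z‖ ≤
      2 * (2 * C / r) / r * ‖w - z‖ := by
    intro w hw
    rw [mem_ball_iff_norm] at hw
    have hin : ∀ x ∈ Metric.ball z r, x ∈ Metric.ball z₀ (3 * r) ∧
        x + (w - z) ∈ Metric.ball z₀ (3 * r) := by
      intro x hx
      rw [mem_ball_iff_norm] at hx
      rw [dist_eq_norm] at hz
      have e1 : x - z₀ = (x - z) + (z - z₀) := by abel
      have e2 : x + (w - z) - z₀ = (x - z) + (z - z₀) + (w - z) := by abel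
      rw [mem_ball_iff_norm, mem_ball_iff_norm]
      constructor
      · rw [e1]; linarith [norm_add_le (x - z) (z - z₀)]
      · rw [e2]
        linarith [norm_add_le ((x - z) + (z - z₀)) (w - z), norm_add_le (x - z) (z - z₀)]
    have hR3 : Metric.ball z₀ (3 * r) ⊆ Metric.ball z₀ R := Metric.ball_subset_ball (by linarith)
    have hd1 : ∀ x ∈ Metric.ball z r, DifferentiableAt ℂ (fun x => f (x + (w - z))) x :=
      fun x hx => DifferentiableAt.comp x (h _ (hR3 (hin x hx).2)).1 (by fun_prop)
    have hd2 : ∀ x ∈ Metric.ball z r, DifferentiableAt ℂ f x := fun x hx => (h x (hR3 (hin x hx).1)).1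
    have h1 := norm_fderiv_le_of_bound (f := fun x => f (x + (w - z)) - f x) (z := z)
      (C := 2 * C / r * ‖w - z‖) hr0
      (fun x hx => ((hd1 x hx).sub (hd2 x hx)).differentiableWithinAt) (fun x hx => by
        have := hlip x (hin x hx).1 _ (hin x hx).2
        rwa [add_sub_cancel_left] at this)
    have hz' := Metric.mem_ball_self (x := z) hr0
    have h2 : fderiv ℂ (fun x => f (x + (w - z)) - f x) z = fderiv ℂ f w - fderiv ℂ f z := by
      have := fderiv_fun_sub (hd1 z hz') (hd2 z hz')
      rw [this, fderiv_comp_add_right, add_sub_cancel]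
    rw [h2] at h1
    calc _ ≤ _ := h1
      _ = _ := by ring
  rw [ContinuousAt, tendsto_iff_norm_sub_tendsto_zero]
  have hlim : Tendsto (fun w => 2 * (2 * C / r) / r * ‖w - z‖) (𝓝 z) (𝓝 0) := by
    have : Continuous fun w : E => 2 * (2 * C / r) / r * ‖w - z‖ := by fun_prop
    simpa using this.tendsto z
  refine squeeze_zero' (Eventually.of_forall fun w => norm_nonneg _) ?_ hlim
  filter_upwards [Metric.ball_mem_nhds z hr0] with w hw
  exact hkey w hw

/-- Differentiability of integrals depending holomorphically on a parameter. -/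
theorem differentiableAt_intervalIntegral [ProperSpace E] {F : E → ℝ → ℂ} {z₀ : E} {R : ℝ}
    (hR : 0 < R)
    (hc : ContinuousOn (Function.uncurry F) (Metric.ball z₀ R ×ˢ univ))
    (hd : ∀ θ, DifferentiableOn ℂ (fun z => F z θ) (Metric.ball z₀ R)) (a b : ℝ) :
    DifferentiableAt ℂ (fun z => ∫ θ in a..b, F z θ) z₀ := by
  set r := R / 3 with hr
  have hr0 : 0 < r := by positivity
  have hsub : Metric.closedBall z₀ (2 * r) ⊆ Metric.ball z₀ R :=
    Metric.closedBall_subset_ball (by linarith)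
  have hFc : ∀ z ∈ Metric.ball z₀ R, Continuous (F z) := fun z hz =>
    continuousOn_univ.1 (hc.comp (f := fun θ => (z, θ)) (by fun_prop) fun θ _ => ⟨hz, mem_univ _⟩)
  have hcomp : IsCompact (Metric.closedBall z₀ (2 * r) ×ˢ uIcc a b) :=
    (isCompact_closedBall _ _).prod isCompact_uIcc
  obtain ⟨C, hC⟩ := (hcomp.image_of_continuousOn
    (hc.mono (prod_mono hsub (subset_univ _)))).isBounded.exists_norm_le
  have hC' : ∀ z ∈ Metric.closedBall z₀ (2 * r), ∀ θ ∈ uIcc a b, ‖F z θ‖ ≤ C := fun z hz θ hθ =>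
    hC _ ⟨(z, θ), ⟨hz, hθ⟩, rfl⟩
  have hderiv : ∀ θ ∈ uIcc a b, ∀ z ∈ Metric.ball z₀ r,
      ‖fderiv ℂ (fun z => F z θ) z‖ ≤ 2 * C / r := by
    intro θ hθ z hz
    have hz2 : Metric.ball z r ⊆ Metric.closedBall z₀ (2 * r) := by
      refine (Metric.ball_subset_ball' ?_).trans Metric.ball_subset_closedBall
      rw [Metric.mem_ball] at hz; linarith
    exact norm_fderiv_le_of_bound hr0 ((hd θ).mono (hz2.trans hsub))
      fun w hw => hC' w (hz2 hw) θ hθ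
  -- Only measurability in `θ` is needed below. Continuity follows from Cauchy's estimate for `F z θ
  -- - F z θ₀`, which is uniformly small on a compact ball.
  have hF'c : Continuous fun θ => fderiv ℂ (fun z => F z θ) z₀ := by
    rw [continuous_iff_continuousAt]
    intro θ₀
    rw [ContinuousAt, Metric.tendsto_nhds]
    intro ε hε
    have hunif : ∀ᶠ θ in 𝓝 θ₀, ∀ z ∈ Metric.closedBall z₀ r, ‖F z θ - F z θ₀‖ < ε * r / 4 := by
      refine (isCompact_closedBall z₀ r).eventually_forall_of_forall_eventually fun z hz => ?_
      have hzR : z ∈ Metric.ball z₀ R :=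
        hsub (Metric.closedBall_subset_closedBall (by linarith) hz)
      have hopen : Metric.ball z₀ R ×ˢ (univ : Set ℝ) ∈ 𝓝 (z, θ₀) :=
        (Metric.isOpen_ball.prod isOpen_univ).mem_nhds ⟨hzR, mem_univ _⟩
      have h1 : ContinuousAt (Function.uncurry F) (z, θ₀) := hc.continuousAt hopen
      have h2 : Tendsto (fun p : ℝ × E => F p.2 p.1) (𝓝 (θ₀, z)) (𝓝 (F z θ₀)) :=
        h1.tendsto.comp (continuous_swap.tendsto (θ₀, z))
      have h3 : Tendsto (fun p : ℝ × E => F p.2 θ₀) (𝓝 (θ₀, z)) (𝓝 (F z θ₀)) :=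
        h1.tendsto.comp (g := Function.uncurry F) (f := fun p : ℝ × E => (p.2, θ₀))
          ((continuous_snd.prodMk continuous_const).tendsto (θ₀, z))
      have h4 := (h2.sub h3).norm
      rw [sub_self, norm_zero] at h4
      exact h4.eventually_lt_const (by positivity)
    filter_upwards [hunif] with θ hθ
    have hb0 : Metric.ball z₀ r ⊆ Metric.ball z₀ R := Metric.ball_subset_ball (by linarith)
    have hzz : Metric.ball z₀ R ∈ 𝓝 z₀ := Metric.ball_mem_nhds _ hR
    have h1 := norm_fderiv_le_of_bound (f := fun z => F z θ - F z θ₀) (z := z₀)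
      (C := ε * r / 4) hr0 (((hd θ).mono hb0).sub ((hd θ₀).mono hb0))
      fun w hw => (hθ w (Metric.ball_subset_closedBall hw)).le
    rw [fderiv_fun_sub ((hd θ).differentiableAt hzz) ((hd θ₀).differentiableAt hzz)] at h1
    rw [dist_eq_norm]
    refine h1.trans_lt ?_
    have : 2 * (ε * r / 4) / r = ε / 2 := by field_simp; norm_num
    rw [this]; linarith
  have hsubI : ∀ t, t ∈ uIoc a b → t ∈ uIcc a b := fun t ht => uIoc_subset_uIcc ht
  have := intervalIntegral.hasFDerivAt_integral_of_dominated_loc_of_lip (𝕜 := ℂ)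
    (μ := MeasureTheory.volume) (F := F) (a := a) (b := b)
    (F' := fun θ => fderiv ℂ (fun z => F z θ) z₀) (x₀ := z₀) (s := Metric.ball z₀ r)
    (bound := fun _ => 2 * C / r) (Metric.ball_mem_nhds _ hr0)
    (by
      filter_upwards [Metric.ball_mem_nhds z₀ hR] with z hz
      exact (hFc z hz).aestronglyMeasurable)
    ((hFc z₀ (Metric.mem_ball_self hR)).intervalIntegrable _ _)
    hF'c.aestronglyMeasurable
    (Eventually.of_forall fun t ht => by
      refine LipschitzOnWith.of_dist_le_mul fun z hz w hw => ?_
      rw [dist_eq_norm, dist_eq_norm, Real.coe_nnabs]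
      refine ((convex_ball z₀ r).norm_image_sub_le_of_norm_fderiv_le (𝕜 := ℂ)
        (f := fun z => F z t) (fun x hx => (hd t).differentiableAt ?_)
        (hderiv t (hsubI t ht)) hw hz).trans
        (mul_le_mul_of_nonneg_right (le_abs_self _) (norm_nonneg _))
      exact Metric.isOpen_ball.mem_nhds (Metric.ball_subset_ball (by linarith) hx))
    (continuous_const.intervalIntegrable _ _)
    (Eventually.of_forall fun t _ =>
      ((hd t).differentiableAt (Metric.ball_mem_nhds _ hR)).hasFDerivAt)
  exact this.2.differentiableAt

end General

/-! ### Division by a coordinate -/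

section Coordinates

variable {n : ℕ}

theorem mem_ball_update {z₀ z : Fin n → ℂ} {r : ℝ} {i : Fin n} {ζ : ℂ}
    (hz : z ∈ Metric.ball z₀ r) (hζ : ζ ∈ Metric.ball (z₀ i) r) :
    Function.update z i ζ ∈ Metric.ball z₀ r := by
  have hr : 0 < r := Metric.pos_of_mem_ball hz
  rw [Metric.mem_ball, dist_pi_lt_iff hr] at hz ⊢
  intro j
  by_cases h : j = i
  · subst h; simpa using hζ
  · simpa [h] using hz j

theorem differentiable_update (i : Fin n) :
    Differentiable ℂ fun p : (Fin n → ℂ) × ℂ => Function.update p.1 i p.2 := by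
  rw [differentiable_pi]
  intro j
  by_cases h : j = i
  · subst h
    simp
  · simp only [Function.update_of_ne h]
    fun_prop

/-- A holomorphic function vanishing on a coordinate hyperplane is divisible by the coordinate. -/
theorem exists_eq_coord_mul {g : (Fin n → ℂ) → ℂ} {z₀ : Fin n → ℂ} {i : Fin n} (hi : z₀ i = 0)
    (hg : ∀ᶠ z in 𝓝 z₀, DifferentiableAt ℂ g z) (h0 : ∀ᶠ z in 𝓝 z₀, z i = 0 → g z = 0) :
    ∃ u : (Fin n → ℂ) → ℂ, (∀ᶠ z in 𝓝 z₀, DifferentiableAt ℂ u z) ∧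
      ∀ᶠ z in 𝓝 z₀, g z = z i * u z := by
  obtain ⟨R, hR, h⟩ := Metric.eventually_nhds_iff_ball.1 (hg.and h0)
  set r := R / 2 with hr
  have hr0 : 0 < r := by positivity
  have hsub : Metric.ball z₀ r ⊆ Metric.ball z₀ R := Metric.ball_subset_ball (by linarith)
  have hup : ∀ z ∈ Metric.ball z₀ r, ∀ ζ ∈ Metric.ball (0 : ℂ) R,
      Function.update z i ζ ∈ Metric.ball z₀ R := fun z hz ζ hζ =>
    mem_ball_update (hsub hz) (by rwa [hi])
  have hzi : ∀ z ∈ Metric.ball z₀ r, z i ∈ Metric.ball (0 : ℂ) r := fun z hz => by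
    rw [Metric.mem_ball, dist_pi_lt_iff hr0] at hz
    have := hz i
    rwa [hi] at this
  let φ : (Fin n → ℂ) → ℂ → ℂ := fun z ζ => g (Function.update z i ζ)
  have hφ0 : ∀ z ∈ Metric.ball z₀ r, φ z 0 = 0 := fun z hz =>
    (h _ (hup z hz 0 (Metric.mem_ball_self hR))).2 (by simp)
  have hφd : ∀ z ∈ Metric.ball z₀ r, DifferentiableOn ℂ (φ z) (Metric.ball 0 R) := by
    intro z hz ζ hζ
    have h1 := (h _ (hup z hz ζ hζ)).1
    have h2 : DifferentiableAt ℂ (fun ζ : ℂ => Function.update z i ζ) ζ :=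
      DifferentiableAt.comp (f := fun ζ : ℂ => (z, ζ))
        (g := fun p : (Fin n → ℂ) × ℂ => Function.update p.1 i p.2) ζ
        (differentiable_update i _) (by fun_prop)
    exact (h1.comp ζ h2).differentiableWithinAt
  -- On each line parallel to the axis `i` the quotient is a divided difference, holomorphic across
  -- `0`. Holomorphy in all variables together is read off from Cauchy's integral formula, whose
  -- integrand is `K`.
  let u : (Fin n → ℂ) → ℂ := fun z => dslope (φ z) 0 (z i)
  let K : (Fin n → ℂ) → ℝ → ℂ := fun z θ => deriv (circleMap 0 r) θ *
    ((circleMap 0 r θ - z i)⁻¹ * ((circleMap 0 r θ)⁻¹ *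
      g (Function.update z i (circleMap 0 r θ))))
  have hcirc : ∀ θ, circleMap 0 r θ ∈ Metric.ball (0 : ℂ) R := fun θ => by
    rw [mem_ball_zero_iff, norm_circleMap_zero, abs_of_pos hr0]; linarith
  have hcirc0 : ∀ θ, circleMap 0 r θ ≠ 0 := fun θ => circleMap_ne_center hr0.ne'
  have hcirci : ∀ θ, ∀ z ∈ Metric.ball z₀ r, circleMap 0 r θ - z i ≠ 0 := fun θ z hz heq => by
    have h1 := hzi z hz
    rw [← sub_eq_zero.1 heq, mem_ball_zero_iff, norm_circleMap_zero, abs_of_pos hr0] at h1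
    exact lt_irrefl _ h1
  have hucirc : ∀ z ∈ Metric.ball z₀ r,
      (∫ θ in (0 : ℝ)..2 * Real.pi, K z θ) = (2 * Real.pi * Complex.I : ℂ) * u z := by
    intro z hz
    have hsubr : Metric.closedBall (0 : ℂ) r ⊆ Metric.ball 0 R :=
      Metric.closedBall_subset_ball (by linarith)
    have h1 : DifferentiableOn ℂ (dslope (φ z) 0) (Metric.closedBall 0 r) :=
      ((Complex.differentiableOn_dslope (Metric.ball_mem_nhds _ hR)).2 (hφd z hz)).mono hsubr
    have h2 := h1.circleIntegral_sub_inv_smul (hzi z hz)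
    rw [smul_eq_mul] at h2
    rw [← h2, circleIntegral]
    refine intervalIntegral.integral_congr fun θ _ => ?_
    simp only [K, smul_eq_mul]
    rw [dslope_of_ne _ (hcirc0 θ), slope_def_field, hφ0 z hz, sub_zero, sub_zero,
      div_eq_inv_mul]
  have hKc : ContinuousOn (Function.uncurry K) (Metric.ball z₀ r ×ˢ univ) := by
    have hcm : Continuous fun p : (Fin n → ℂ) × ℝ => circleMap 0 r p.2 :=
      (continuous_circleMap 0 r).comp continuous_snd
    have hcd : Continuous fun p : (Fin n → ℂ) × ℝ => deriv (circleMap 0 r) p.2 := by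
      simp only [deriv_circleMap]
      fun_prop
    have hgc : ContinuousOn g (Metric.ball z₀ R) := fun z hz =>
      (h z hz).1.continuousAt.continuousWithinAt
    refine hcd.continuousOn.mul (ContinuousOn.mul ?_ (ContinuousOn.mul ?_ ?_))
    · refine ContinuousOn.inv₀ (hcm.sub (by fun_prop)).continuousOn ?_
      rintro ⟨z, θ⟩ ⟨hz, -⟩
      exact hcirci θ z hz
    · exact (hcm.inv₀ fun p => hcirc0 p.2).continuousOn
    · refine hgc.comp (f := fun p : (Fin n → ℂ) × ℝ =>
        Function.update p.1 i (circleMap 0 r p.2)) ?_ ?_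
      · exact ((differentiable_update i).continuous.comp
          (continuous_fst.prodMk hcm)).continuousOn
      · rintro ⟨z, θ⟩ ⟨hz, -⟩
        exact hup z hz _ (hcirc θ)
  have hKd : ∀ θ, DifferentiableOn ℂ (fun z => K z θ) (Metric.ball z₀ r) := by
    intro θ z hz
    refine DifferentiableAt.differentiableWithinAt ?_
    refine (differentiableAt_const _).mul (DifferentiableAt.mul ?_
      ((differentiableAt_const _).mul ?_))
    · exact DifferentiableAt.inv (by fun_prop) (hcirci θ z hz)
    · have h2 : DifferentiableAt ℂ (fun z : Fin n → ℂ => Function.update z i (circleMap 0 r θ)) z :=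
        DifferentiableAt.comp (f := fun z : Fin n → ℂ => (z, circleMap 0 r θ))
          (g := fun p : (Fin n → ℂ) × ℂ => Function.update p.1 i p.2) z
          (differentiable_update i _) (by fun_prop)
      exact (h _ (hup z hz _ (hcirc θ))).1.comp z h2
  refine ⟨u, ?_, ?_⟩
  · filter_upwards [Metric.isOpen_ball.mem_nhds (Metric.mem_ball_self hr0 (x := z₀))] with z hz
    obtain ⟨ε, hε, hεs⟩ := Metric.isOpen_iff.1 Metric.isOpen_ball z hz
    have h1 := differentiableAt_intervalIntegral hε
      (hKc.mono (prod_mono hεs Subset.rfl)) (fun θ => (hKd θ).mono hεs) 0 (2 * Real.pi)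
    have h2 : DifferentiableAt ℂ (fun z => (2 * Real.pi * Complex.I : ℂ)⁻¹ *
        ∫ θ in (0 : ℝ)..2 * Real.pi, K z θ) z := (differentiableAt_const _).mul h1
    refine h2.congr_of_eventuallyEq ?_
    filter_upwards [Metric.isOpen_ball.mem_nhds hz] with w hw
    rw [hucirc w hw, inv_mul_cancel_left₀ Complex.two_pi_I_ne_zero]
  · filter_upwards [Metric.ball_mem_nhds z₀ hr0] with z hz
    have h1 := sub_smul_dslope (φ z) 0 (z i)
    rw [hφ0 z hz, sub_zero, sub_zero, smul_eq_mul] at h1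
    rw [h1]
    simp [φ]

end Coordinates

end SemiStable

/-! ### Factorization of germs without zeros off coordinate hyperplanes -/

namespace SemiStable

section Factorization

variable {n : ℕ}

/-- If a holomorphic function has no zeros off some coordinate hyperplanes and does not vanish
identically on one of them, it has no zeros on that hyperplane off the others. -/
theorem ne_zero_on_hyperplane {g : (Fin n → ℂ) → ℂ} {z₀ : Fin n → ℂ} {i : Fin n}
    {s : Finset (Fin n)} (his : i ∉ s) (hg : ∀ᶠ z in 𝓝 z₀, DifferentiableAt ℂ g z)
    (hne : ∀ᶠ z in 𝓝 z₀, (∀ j ∈ s, z j ≠ 0) → z i ≠ 0 → g z ≠ 0)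
    (hfr : ∃ᶠ z in 𝓝 z₀, z i = 0 ∧ g z ≠ 0) :
    ∀ᶠ z in 𝓝 z₀, (∀ j ∈ s, z j ≠ 0) → g z ≠ 0 := by
  obtain ⟨R, hR, h⟩ := Metric.eventually_nhds_iff_ball.1 (hg.and hne)
  filter_upwards [Metric.ball_mem_nhds z₀ hR] with z hz hzs hgz
  -- A Hurwitz argument. On a line in the hyperplane from the zero `z` to a point where `g ≠ 0`,
  -- zeros are isolated, so `|g|` is bounded below on a small circle around `z`. Shifted off the
  -- hyperplane, `g` has no zeros on the disc, and the maximum principle for `1 / g` carries the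
  -- bound to the centre. Letting the shift tend to `0` contradicts `g z = 0`.
  by_cases hzi : z i = 0
  swap
  · exact (h z hz).2 hzs hzi hgz
  obtain ⟨z', ⟨hz'i, hgz'⟩, hz'⟩ := (hfr.and_eventually (Metric.ball_mem_nhds z₀ hR)).exists
  set w := z' - z with hw
  have hwi : w i = 0 := by simp [hw, hz'i, hzi]
  -- restriction to a line in the hyperplane
  let Ω : Set ℂ := {ζ | z + ζ • w ∈ Metric.ball z₀ R}
  have hΩo : IsOpen Ω := Metric.isOpen_ball.preimage (by fun_prop)
  have hΩc : IsPreconnected Ω := by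
    refine Convex.isPreconnected (s := Ω) ?_
    intro ζ hζ ξ hξ a b ha hb hab
    have h1 := convex_ball z₀ R hζ hξ ha hb hab
    change z + (a • ζ + b • ξ) • w ∈ Metric.ball z₀ R
    convert h1 using 1
    ext j
    have hab' : (a : ℂ) + b = 1 := by exact_mod_cast hab
    simp only [Pi.add_apply, Pi.smul_apply, smul_eq_mul, Complex.real_smul]
    linear_combination (-(z j)) * hab'
  have h0Ω : (0 : ℂ) ∈ Ω := by simpa [Ω] using hz
  have h1Ω : (1 : ℂ) ∈ Ω := by simpa [Ω, hw] using hz'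
  have han : AnalyticOnNhd ℂ (fun ζ : ℂ => g (z + ζ • w)) Ω := by
    refine DifferentiableOn.analyticOnNhd (fun ζ hζ => ?_) hΩo
    exact (DifferentiableAt.comp ζ (h _ hζ).1 (by fun_prop)).differentiableWithinAt
  have hisol : ∀ᶠ ζ in 𝓝[≠] (0 : ℂ), g (z + ζ • w) ≠ 0 := by
    by_contra hcon
    have := han.eqOn_zero_of_preconnected_of_frequently_eq_zero hΩc h0Ω
      hcon h1Ω
    simp only [one_smul, Pi.zero_apply, hw, add_sub_cancel] at this
    exact hgz' this
  have hsne : ∀ᶠ ζ in 𝓝 (0 : ℂ), ∀ j ∈ s, (z + ζ • w) j ≠ 0 := by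
    rw [Finset.eventually_all]
    intro j hj
    have : ContinuousAt (fun ζ : ℂ => (z + ζ • w) j) 0 := by
      simp only [Pi.add_apply, Pi.smul_apply]
      fun_prop
    exact this.eventually_ne (by simpa using hzs j hj)
  rw [eventually_nhdsWithin_iff] at hisol
  obtain ⟨ρ, hρ, hρ'⟩ := Metric.nhds_basis_closedBall.eventually_iff.1
    ((hisol.and hsne).and (hΩo.mem_nhds h0Ω))
  -- the perturbed restrictions
  let Φ : ℂ → ℂ → ℂ := fun η ζ => g (z + ζ • w + Pi.single i η)
  have hΦ0 : ∀ ζ, Φ 0 ζ = g (z + ζ • w) := fun ζ => by simp [Φ]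
  have hpt : Continuous fun p : ℂ × ℂ => z + p.2 • w + Pi.single i p.1 :=
    (continuous_const.add (continuous_snd.smul continuous_const)).add
      ((continuous_single i).comp continuous_fst)
  have hinball : ∀ᶠ η in 𝓝 (0 : ℂ), ∀ ζ ∈ Metric.closedBall (0 : ℂ) ρ,
      z + ζ • w + Pi.single i η ∈ Metric.ball z₀ R := by
    refine (isCompact_closedBall (0 : ℂ) ρ).eventually_forall_of_forall_eventually
      fun ζ hζ => ?_
    refine (hpt.tendsto (0, ζ)).eventually (Metric.isOpen_ball.mem_nhds ?_)
    simpa using (hρ' hζ).2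
  have hΦc : ∀ ζ ∈ Metric.closedBall (0 : ℂ) ρ, ContinuousAt (fun p : ℂ × ℂ => Φ p.1 p.2) (0, ζ) := by
    intro ζ hζ
    have h1 : ContinuousAt g (z + ζ • w + Pi.single i 0) := by
      refine (h _ ?_).1.continuousAt
      simpa using (hρ' hζ).2
    exact ContinuousAt.comp (f := fun p : ℂ × ℂ => z + p.2 • w + Pi.single i p.1)
      (x := ((0 : ℂ), ζ)) h1 hpt.continuousAt
  have hsph : IsCompact (Metric.sphere (0 : ℂ) ρ) := isCompact_sphere _ _
  obtain ⟨δ, hδ, hδ'⟩ : ∃ δ > 0, ∀ ζ ∈ Metric.sphere (0 : ℂ) ρ, δ < ‖g (z + ζ • w)‖ := by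
    have hcs : ContinuousOn (fun ζ : ℂ => ‖g (z + ζ • w)‖) (Metric.sphere 0 ρ) := fun ζ hζ =>
      ((han ζ (hρ' (Metric.sphere_subset_closedBall hζ)).2).continuousAt.norm).continuousWithinAt
    obtain ⟨ζ₁, hζ₁, hmin⟩ := hsph.exists_isMinOn ⟨(ρ : ℂ), by simp [hρ.le]⟩ hcs
    have hζne : ζ₁ ≠ 0 := fun h0 => by
      rw [h0, mem_sphere_zero_iff_norm, norm_zero] at hζ₁
      exact hρ.ne hζ₁
    have hpos : 0 < ‖g (z + ζ₁ • w)‖ :=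
      norm_pos_iff.2 ((hρ' (Metric.sphere_subset_closedBall hζ₁)).1.1 hζne)
    exact ⟨‖g (z + ζ₁ • w)‖ / 2, by positivity, fun ζ hζ =>
      (half_lt_self hpos).trans_le (hmin hζ)⟩
  have hlow : ∀ᶠ η in 𝓝 (0 : ℂ), ∀ ζ ∈ Metric.sphere (0 : ℂ) ρ, δ < ‖Φ η ζ‖ := by
    refine hsph.eventually_forall_of_forall_eventually fun ζ hζ => ?_
    refine (hΦc ζ (Metric.sphere_subset_closedBall hζ)).norm.eventually_const_lt ?_
    simpa only [hΦ0] using hδ' ζ hζ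
  have hbound : ∀ᶠ η in 𝓝[≠] (0 : ℂ), δ ≤ ‖Φ η 0‖ := by
    filter_upwards [nhdsWithin_le_nhds hinball, nhdsWithin_le_nhds hlow, self_mem_nhdsWithin]
      with η h1 h2 hη
    have hne' : ∀ ζ ∈ Metric.closedBall (0 : ℂ) ρ, Φ η ζ ≠ 0 := by
      intro ζ hζ
      refine (h _ (h1 ζ hζ)).2 (fun j hj => ?_) ?_
      · have hji : j ≠ i := fun hji => his (hji ▸ hj)
        have := (hρ' hζ).1.2 j hj
        simpa [hji] using this
      · have hη' : η ≠ 0 := hη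
        simpa [hzi, hwi] using hη'
    have hdiff : DifferentiableOn ℂ (fun ζ => (Φ η ζ)⁻¹) (Metric.closedBall 0 ρ) := by
      intro ζ hζ
      have : DifferentiableAt ℂ (fun ζ : ℂ => Φ η ζ) ζ :=
        DifferentiableAt.comp ζ (h _ (h1 ζ hζ)).1 (by fun_prop)
      exact (this.inv (hne' ζ hζ)).differentiableWithinAt
    have hdc : DiffContOnCl ℂ (fun ζ => (Φ η ζ)⁻¹) (Metric.ball 0 ρ) :=
      (hdiff.mono Metric.closure_ball_subset_closedBall).diffContOnCl
    have := Complex.norm_le_of_forall_mem_frontier_norm_le Metric.isBounded_ball hdc (C := δ⁻¹)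
      (fun ζ hζ => by
        rw [frontier_ball _ hρ.ne'] at hζ
        rw [norm_inv]
        exact inv_anti₀ hδ (h2 ζ hζ).le) (subset_closure (Metric.mem_ball_self hρ))
    rw [norm_inv] at this
    exact (inv_le_inv₀ (norm_pos_iff.2 (hne' 0 (Metric.mem_closedBall_self hρ.le))) hδ).1 this
  have hlim : Tendsto (fun η => ‖Φ η 0‖) (𝓝[≠] 0) (𝓝 ‖Φ 0 0‖) := by
    have h1 : Tendsto (fun η : ℂ => (η, (0 : ℂ))) (𝓝 0) (𝓝 (0, 0)) :=
      (continuous_id.prodMk continuous_const).tendsto 0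
    exact (((hΦc 0 (Metric.mem_closedBall_self hρ.le)).tendsto.comp h1).norm).mono_left
      nhdsWithin_le_nhds
  have hfin := ge_of_tendsto hlim hbound
  rw [hΦ0, zero_smul, add_zero, hgz, norm_zero] at hfin
  linarith

/-- Splitting off the maximal power of a coordinate. -/
theorem exists_eq_coord_pow_mul {f : (Fin n → ℂ) → ℂ} {z₀ : Fin n → ℂ} {i : Fin n}
    (hi : z₀ i = 0) (hf : ∀ᶠ z in 𝓝 z₀, DifferentiableAt ℂ f z) {v : Fin n → ℂ}
    (hne : ∃ᶠ ζ in 𝓝 (0 : ℂ), f (z₀ + ζ • v) ≠ 0) :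
    ∃ (m : ℕ) (g : (Fin n → ℂ) → ℂ), (∀ᶠ z in 𝓝 z₀, DifferentiableAt ℂ g z) ∧
      (∀ᶠ z in 𝓝 z₀, f z = z i ^ m * g z) ∧ ∃ᶠ z in 𝓝 z₀, z i = 0 ∧ g z ≠ 0 := by
  classical
  have hline : Tendsto (fun ζ : ℂ => z₀ + ζ • v) (𝓝 0) (𝓝 z₀) := by
    have : Continuous fun ζ : ℂ => z₀ + ζ • v := by fun_prop
    simpa using this.tendsto 0
  have hlan : ∀ g : (Fin n → ℂ) → ℂ, (∀ᶠ z in 𝓝 z₀, DifferentiableAt ℂ g z) →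
      AnalyticAt ℂ (fun ζ : ℂ => g (z₀ + ζ • v)) 0 := by
    intro g hg
    rw [Complex.analyticAt_iff_eventually_differentiableAt]
    filter_upwards [hline.eventually hg] with ζ hζ
    exact DifferentiableAt.comp ζ hζ (by fun_prop)
  let P : ℕ → Prop := fun m => ¬ ∃ g : (Fin n → ℂ) → ℂ,
    (∀ᶠ z in 𝓝 z₀, DifferentiableAt ℂ g z) ∧ ∀ᶠ z in 𝓝 z₀, f z = z i ^ m * g z
  -- Divisibility by `z i ^ m` forces vanishing of order at least `m` along the given line, where
  -- `f` has a finite order `N`; so `N + 1` is too large.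
  have hex : ∃ m, P m := by
    obtain ⟨N, φ, hφ, hφ0, heq⟩ := (hlan f hf).exists_eventuallyEq_pow_smul_nonzero_iff.2
      (fun h => hne (h.mono fun _ h h' => h' h))
    refine ⟨N + 1, ?_⟩
    rintro ⟨g, hg, hfg⟩
    have h1 : ∀ᶠ ζ in 𝓝[≠] (0 : ℂ), φ ζ = ζ * (v i ^ (N + 1) * g (z₀ + ζ • v)) := by
      filter_upwards [nhdsWithin_le_nhds heq, nhdsWithin_le_nhds (hline.eventually hfg),
        self_mem_nhdsWithin] with ζ h2 h3 hζ
      have hζ : ζ ≠ 0 := hζ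
      rw [h3] at h2
      simp only [Pi.add_apply, Pi.smul_apply, hi, zero_add, smul_eq_mul, sub_zero] at h2
      have : ζ ^ N ≠ 0 := pow_ne_zero _ hζ
      apply mul_left_cancel₀ this
      rw [← h2]; ring
    have h2 : Tendsto φ (𝓝[≠] 0) (𝓝 (φ 0)) := hφ.continuousAt.tendsto.mono_left nhdsWithin_le_nhds
    have h3 : Tendsto (fun ζ : ℂ => ζ * (v i ^ (N + 1) * g (z₀ + ζ • v))) (𝓝[≠] 0) (𝓝 0) := by
      have : ContinuousAt (fun ζ : ℂ => ζ * (v i ^ (N + 1) * g (z₀ + ζ • v))) 0 :=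
        continuousAt_id.mul (continuousAt_const.mul (hlan g hg).continuousAt)
      have h4 := this.tendsto
      rw [zero_mul] at h4
      exact h4.mono_left nhdsWithin_le_nhds
    exact hφ0 (tendsto_nhds_unique h2 (h3.congr' (h1.mono fun _ h => h.symm)))
  have hfind := Nat.find_spec hex
  have hpos : Nat.find hex ≠ 0 := fun h0 => by
    rw [h0] at hfind
    exact hfind ⟨f, hf, by simp⟩
  obtain ⟨k, hk⟩ := Nat.exists_eq_succ_of_ne_zero hpos
  have hkP : ¬ P k := Nat.find_min hex (by rw [hk]; exact k.lt_succ_self)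
  obtain ⟨g, hg, hfg⟩ := not_not.1 hkP
  refine ⟨k, g, hg, hfg, fun hcon => ?_⟩
  -- If `g` vanished on the hyperplane near `z₀`, one more factor could be split off, against the
  -- maximality of `k`.
  obtain ⟨u, hu, hgu⟩ := exists_eq_coord_mul hi hg (by
    filter_upwards [hcon] with z hz hzi
    by_contra h
    exact hz ⟨hzi, h⟩)
  rw [hk] at hfind
  refine hfind ⟨u, hu, ?_⟩
  filter_upwards [hfg, hgu] with z h1 h2
  rw [h1, h2, pow_succ]; ring

/-- A holomorphic function without zeros off the coordinate hyperplanes with index in `s` is a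
unit times a monomial. -/
theorem exists_unit_mul_monomial (s : Finset (Fin n)) {f : (Fin n → ℂ) → ℂ} {z₀ : Fin n → ℂ}
    (hf : ∀ᶠ z in 𝓝 z₀, DifferentiableAt ℂ f z)
    (hne : ∀ᶠ z in 𝓝 z₀, (∀ j ∈ s, z j ≠ 0) → f z ≠ 0) :
    ∃ (a : Fin n → ℕ) (u : (Fin n → ℂ) → ℂ), (∀ᶠ z in 𝓝 z₀, DifferentiableAt ℂ u z) ∧
      u z₀ ≠ 0 ∧ ∀ᶠ z in 𝓝 z₀, f z = u z * ∏ j ∈ s, z j ^ a j := by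
  classical
  induction s using Finset.induction_on generalizing f with
  | empty => exact ⟨0, f, hf, hne.self_of_nhds (by simp), by simp⟩
  | insert i s his ih =>
    have hprod : ∀ (a : Fin n → ℕ) (m : ℕ) (z : Fin n → ℂ),
        ∏ j ∈ insert i s, z j ^ Function.update a i m j = z i ^ m * ∏ j ∈ s, z j ^ a j := by
      intro a m z
      rw [Finset.prod_insert his, Function.update_self]
      congr 1
      refine Finset.prod_congr rfl fun j hj => ?_
      rw [Function.update_of_ne (ne_of_mem_of_not_mem hj his)]
    by_cases hi : z₀ i = 0
    -- The diagonal direction leaves all coordinate hyperplanes through `z₀` at once, so `f` is not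
    -- identically zero along it.
    · obtain ⟨m, g, hg, hfg, hfr⟩ := exists_eq_coord_pow_mul hi hf (v := fun _ => 1) (by
        have h1 : Tendsto (fun ζ : ℂ => z₀ + ζ • (fun _ => 1 : Fin n → ℂ)) (𝓝 0) (𝓝 z₀) := by
          have : Continuous fun ζ : ℂ => z₀ + ζ • (fun _ => 1 : Fin n → ℂ) := by fun_prop
          simpa using this.tendsto 0
        have h2 : ∀ᶠ ζ in 𝓝[≠] (0 : ℂ), ∀ j ∈ insert i s,
            (z₀ + ζ • (fun _ => 1 : Fin n → ℂ)) j ≠ 0 := by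
          rw [Finset.eventually_all]
          intro j _
          by_cases hj : z₀ j = 0
          · filter_upwards [self_mem_nhdsWithin] with ζ hζ
            have hζ : ζ ≠ 0 := hζ
            simpa [hj] using hζ
          · have : ContinuousAt (fun ζ : ℂ => (z₀ + ζ • (fun _ => 1 : Fin n → ℂ)) j) 0 := by
              simp only [Pi.add_apply, Pi.smul_apply]
              fun_prop
            exact nhdsWithin_le_nhds (this.eventually_ne (by simpa using hj))
        have h3 : ∀ᶠ ζ in 𝓝[≠] (0 : ℂ), f (z₀ + ζ • (fun _ => 1 : Fin n → ℂ)) ≠ 0 := by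
          filter_upwards [h2, nhdsWithin_le_nhds (h1.eventually hne)] with ζ h4 h5
          exact h5 h4
        exact h3.frequently.filter_mono nhdsWithin_le_nhds)
      have hgne := ne_zero_on_hyperplane his hg (by
        filter_upwards [hne, hfg] with z h1 h2 h3 h4 h5
        refine h1 ?_ (by rw [h2, h5, mul_zero])
        intro j hj
        rcases Finset.mem_insert.1 hj with rfl | hj
        · exact h4
        · exact h3 j hj) hfr
      obtain ⟨a, u, hu, hu0, hgu⟩ := ih hg hgne
      refine ⟨Function.update a i m, u, hu, hu0, ?_⟩
      filter_upwards [hfg, hgu] with z h1 h2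
      rw [hprod, h1, h2]; ring
    -- A coordinate that does not vanish at `z₀` imposes no condition nearby and gets exponent `0`.
    · have hne' : ∀ᶠ z in 𝓝 z₀, (∀ j ∈ s, z j ≠ 0) → f z ≠ 0 := by
        have : ∀ᶠ z : Fin n → ℂ in 𝓝 z₀, z i ≠ 0 := (continuous_apply i).continuousAt.eventually_ne hi
        filter_upwards [hne, this] with z h1 h2 h3
        refine h1 fun j hj => ?_
        rcases Finset.mem_insert.1 hj with rfl | hj
        · exact h2
        · exact h3 j hj
      obtain ⟨a, u, hu, hu0, hfu⟩ := ih hf hne'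
      refine ⟨Function.update a i 0, u, hu, hu0, ?_⟩
      filter_upwards [hfu] with z h1
      rw [hprod, h1, pow_zero, one_mul]

end Factorization

end SemiStable

namespace SemiStable

/-! ### Linear algebra of functionals -/

section Linear

variable {K V : Type*} [Field K] [AddCommGroup V] [Module K V]

/-- A linearly independent family can be extended to a basis by elements of a spanning set. -/
theorem exists_basis_extending [FiniteDimensional K V] {I J : Type*} [Fintype J]
    (hJ : Fintype.card J = Module.finrank K V) {a : I → V} (ha : LinearIndependent K a)
    {T : Set V} (hT : Submodule.span K T = ⊤) :
    ∃ (b : J → V) (ε : I → J), Function.Injective ε ∧ LinearIndependent K b ∧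
      (∀ i, b (ε i) = a i) ∧ ∀ j, j ∉ range ε → b j ∈ T := by
  classical
  obtain ⟨B, hBsub, hsB, htB, hB⟩ := exists_linearIndepOn_id_extension
    (K := K) (s := range a) (t := range a ∪ T) ha.linearIndepOn_id subset_union_left
  have hspan : ⊤ ≤ Submodule.span K (range ((↑) : B → V)) := by
    rw [Subtype.range_coe, ← hT, Submodule.span_le]
    exact subset_union_right.trans htB
  have hBli : LinearIndependent K ((↑) : B → V) := hB
  let bas : Module.Basis B K V := Module.Basis.mk hBli hspan
  have : Fintype B := FiniteDimensional.fintypeBasisIndex bas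
  have hcard : Fintype.card J = Fintype.card B := by
    rw [hJ, Module.finrank_eq_card_basis bas]
  let e : J ≃ B := Fintype.equivOfCardEq hcard
  refine ⟨fun j => (e j : V), fun i => e.symm ⟨a i, hsB (mem_range_self i)⟩, ?_, ?_, ?_, ?_⟩
  · intro i i' h
    have h := congrArg Subtype.val (e.symm.injective h)
    exact ha.injective h
  · exact hBli.comp e e.injective
  · intro i
    simp
  · intro j hj
    rcases hBsub (e j).2 with ⟨i, hi⟩ | h
    · refine absurd ⟨i, ?_⟩ hj
      rw [Equiv.symm_apply_eq]
      exact Subtype.ext hi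
    · exact h

/-- If the codimension of an intersection is the sum of the codimensions, equations of the
subspaces are independent. -/
theorem linearIndependent_of_finrank_quotient [FiniteDimensional K V] {A : Type*} [Fintype A]
    {J : A → Type*} [∀ a, Fintype (J a)] (l : ∀ a, J a → V →ₗ[K] K) (S : A → Submodule K V)
    (hS : ∀ a, S a = ⨅ j, LinearMap.ker (l a j))
    (hcard : ∀ a, Fintype.card (J a) = Module.finrank K (V ⧸ S a))
    (hcodim : Module.finrank K (V ⧸ ⨅ a, S a) = ∑ a, Module.finrank K (V ⧸ S a)) :
    LinearIndependent K fun p : Σ a, J a => l p.1 p.2 := by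
  classical
  let Φ : V →ₗ[K] ((Σ a, J a) → K) := LinearMap.pi fun p => l p.1 p.2
  have hker : LinearMap.ker Φ = ⨅ a, S a := by
    ext v
    simp only [LinearMap.mem_ker, Submodule.mem_iInf, hS]
    constructor
    · intro h a j
      exact congrFun h ⟨a, j⟩
    · intro h
      funext p
      exact h p.1 p.2
  -- `Φ` collects all equations. Additivity of codimensions says that its rank is their number, so
  -- it is onto and dual vectors exist.
  have hrank : Module.finrank K (LinearMap.range Φ) = Module.finrank K ((Σ a, J a) → K) := by
    rw [← Φ.quotKerEquivRange.finrank_eq, hker, hcodim, Module.finrank_fintype_fun_eq_card,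
      Fintype.card_sigma]
    exact Finset.sum_congr rfl fun a _ => (hcard a).symm
  have hsurj : LinearMap.range Φ = ⊤ := Submodule.eq_top_of_finrank_eq hrank
  rw [Fintype.linearIndependent_iff]
  intro c hc p
  obtain ⟨v, hv⟩ : Pi.single p 1 ∈ LinearMap.range Φ := by rw [hsurj]; trivial
  have h1 := LinearMap.congr_fun hc v
  simp only [LinearMap.sum_apply, LinearMap.smul_apply, smul_eq_mul, LinearMap.zero_apply] at h1
  have h2 : ∀ q, l q.1 q.2 v = (Pi.single p 1 : (Σ a, J a) → K) q := fun q => congrFun hv q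
  simp only [h2, Pi.single_apply, mul_ite, mul_one, mul_zero, Finset.sum_ite_eq',
    Finset.mem_univ, if_true] at h1
  exact h1

end Linear

/-- The equations of independent functionals separate points. -/
theorem pi_injective_of_linearIndependent {n : ℕ} {l : Fin n → (Fin n → ℂ) →L[ℂ] ℂ}
    (hl : LinearIndependent ℂ l) : Function.Injective (ContinuousLinearMap.pi l) := by
  rw [injective_iff_map_eq_zero]
  intro v hv
  have hfin : Module.finrank ℂ ((Fin n → ℂ) →L[ℂ] ℂ) = n := by
    rw [← (LinearMap.toContinuousLinearMap (𝕜 := ℂ) (E := Fin n → ℂ) (F' := ℂ)).finrank_eq]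
    rw [Module.finrank_linearMap]
    simp
  have : FiniteDimensional ℂ ((Fin n → ℂ) →L[ℂ] ℂ) :=
    (LinearMap.toContinuousLinearMap (𝕜 := ℂ) (E := Fin n → ℂ) (F' := ℂ)).finiteDimensional
  have hspan := hl.span_eq_top_of_card_eq_finrank' (by rw [hfin, Fintype.card_fin])
  have hall : ∀ φ : (Fin n → ℂ) →L[ℂ] ℂ, φ v = 0 := by
    intro φ
    have hφ : φ ∈ Submodule.span ℂ (range l) := by rw [hspan]; trivial
    induction hφ using Submodule.span_induction with
    | mem x hx =>
      obtain ⟨j, rfl⟩ := hx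
      exact congrFun hv j
    | zero => rfl
    | add x y _ _ hx hy => simp [hx, hy]
    | smul c x _ hx => simp [hx]
  ext j
  exact hall (ContinuousLinearMap.proj j)

/-! ### Holomorphic germs and charts -/

section Charts

variable {n : ℕ} {X : Type*} [TopologicalSpace X] [ChartedSpace (Model n) X]

/-- A function that is holomorphic near `p`. -/
def HolNear (n : ℕ) {X : Type*} [TopologicalSpace X] [ChartedSpace (Model n) X] (f : X → ℂ)
    (p : X) : Prop :=
  ∀ᶠ q in 𝓝 p, HolAt (n := n) f q

/-- A chart which is holomorphic with holomorphic inverse. -/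
abbrev IsHolChart (Φ : OpenPartialHomeomorph X (Model n)) : Prop :=
  Φ.MDifferentiable 𝓘(ℂ, Model n) 𝓘(ℂ, Model n)

/-- The differential of a function at `p`, in the coordinates of the chart at `p`. -/
noncomputable def dif (p : X) (f : X → ℂ) : Model n →L[ℂ] ℂ :=
  fderiv ℂ (f ∘ (chartAt (Model n) p).symm) (chartAt (Model n) p p)

/-- The differential of a chart at `p`, in the coordinates of the chart at `p`. -/
noncomputable def chartDeriv (Φ : OpenPartialHomeomorph X (Model n)) (p : X) :
    Model n →L[ℂ] Model n :=
  fderiv ℂ (Φ ∘ (chartAt (Model n) p).symm) (chartAt (Model n) p p)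

theorem isHolChart_of_mem_maximalAtlas [IsManifold 𝓘(ℂ, Model n) ω X]
    {φ : OpenPartialHomeomorph X (Model n)}
    (hφ : φ ∈ IsManifold.maximalAtlas 𝓘(ℂ, Model n) ω X) : IsHolChart φ := by
  have h1 : φ ∈ IsManifold.maximalAtlas 𝓘(ℂ, Model n) 1 X :=
    IsManifold.maximalAtlas_subset_of_le le_top hφ
  exact ⟨fun q hq => (mdifferentiableAt_of_mem_maximalAtlas h1 hq).mdifferentiableWithinAt,
    fun q hq => (mdifferentiableAt_symm_of_mem_maximalAtlas h1 hq).mdifferentiableWithinAt⟩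

theorem isHolChart_chartAt [IsManifold 𝓘(ℂ, Model n) ω X] (p : X) :
    IsHolChart (chartAt (Model n) p) :=
  isHolChart_of_mem_maximalAtlas (IsManifold.chart_mem_maximalAtlas p)

theorem IsHolChart.holAt_iff {Φ : OpenPartialHomeomorph X (Model n)} (hΦ : IsHolChart Φ)
    {f : X → ℂ} {q : X} (hq : q ∈ Φ.source) :
    HolAt (n := n) f q ↔ DifferentiableAt ℂ (f ∘ Φ.symm) (Φ q) := by
  constructor
  · intro h
    have h1 := hΦ.mdifferentiableAt_symm (Φ.map_source hq)
    have h2 : HolAt (n := n) f (Φ.symm (Φ q)) := by rwa [Φ.left_inv hq]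
    exact mdifferentiableAt_iff_differentiableAt.1 (MDifferentiableAt.comp (Φ q) h2 h1)
  · intro h
    have h1 := hΦ.mdifferentiableAt hq
    have h2 := MDifferentiableAt.comp q (mdifferentiableAt_iff_differentiableAt.2 h) h1
    refine h2.congr_of_eventuallyEq ?_
    filter_upwards [Φ.open_source.mem_nhds hq] with x hx
    simp [Φ.left_inv hx]

theorem IsHolChart.eventually_differentiableAt {Φ : OpenPartialHomeomorph X (Model n)}
    (hΦ : IsHolChart Φ) {f : X → ℂ} {p : X} (hp : p ∈ Φ.source) (hf : HolNear n f p) :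
    ∀ᶠ z in 𝓝 (Φ p), DifferentiableAt ℂ (f ∘ Φ.symm) z := by
  have h1 : Tendsto Φ.symm (𝓝 (Φ p)) (𝓝 p) := Φ.tendsto_symm hp
  filter_upwards [h1.eventually hf, Φ.open_target.mem_nhds (Φ.map_source hp)] with z hz hzt
  have := (hΦ.holAt_iff (Φ.map_target hzt)).1 hz
  rwa [Φ.right_inv hzt] at this

theorem IsHolChart.holNear_comp {Φ : OpenPartialHomeomorph X (Model n)}
    (hΦ : IsHolChart Φ) {g : Model n → ℂ} {p : X} (hp : p ∈ Φ.source)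
    (hg : ∀ᶠ z in 𝓝 (Φ p), DifferentiableAt ℂ g z) : HolNear n (fun q => g (Φ q)) p := by
  have h1 := (Φ.continuousAt hp).eventually hg
  filter_upwards [h1, Φ.open_source.mem_nhds hp] with q hq hqs
  exact MDifferentiableAt.comp q (mdifferentiableAt_iff_differentiableAt.2 hq)
    (hΦ.mdifferentiableAt hqs)

theorem IsHolChart.holNear_coord {Φ : OpenPartialHomeomorph X (Model n)}
    (hΦ : IsHolChart Φ) {p : X} (hp : p ∈ Φ.source) (j : Fin n) :
    HolNear n (fun q => Φ q j) p :=
  hΦ.holNear_comp (g := fun z => z j) hp (Eventually.of_forall fun _ => by fun_prop)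

theorem IsHolChart.holAt_coord {Φ : OpenPartialHomeomorph X (Model n)}
    (hΦ : IsHolChart Φ) {p : X} (hp : p ∈ Φ.source) (j : Fin n) :
    HolAt (n := n) (fun q => Φ q j) p := (hΦ.holNear_coord hp j).self_of_nhds

/-- Coordinate changes are holomorphic. -/
theorem IsHolChart.differentiableAt_transition {Φ Ψ : OpenPartialHomeomorph X (Model n)}
    (hΦ : IsHolChart Φ) (hΨ : IsHolChart Ψ) {p : X} (hp : p ∈ Φ.source) (hp' : p ∈ Ψ.source) :
    DifferentiableAt ℂ (Ψ ∘ Φ.symm) (Φ p) := by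
  rw [differentiableAt_pi]
  intro j
  exact (hΦ.holAt_iff hp).1 (hΨ.holAt_coord hp' j)

/-- Coordinate changes are continuously differentiable. -/
theorem IsHolChart.contDiffAt_transition {Φ Ψ : OpenPartialHomeomorph X (Model n)}
    (hΦ : IsHolChart Φ) (hΨ : IsHolChart Ψ) {p : X} (hp : p ∈ Φ.source) (hp' : p ∈ Ψ.source) :
    ContDiffAt ℂ 1 (Ψ ∘ Φ.symm) (Φ p) := by
  rw [contDiffAt_pi]
  intro j
  exact contDiffAt_one_of_eventually_differentiableAt
    (hΦ.eventually_differentiableAt hp (hΨ.holNear_coord hp' j))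

/-! #### Algebra of germs -/

theorem HolNear.congr {f g : X → ℂ} {p : X} (hf : HolNear n f p) (h : f =ᶠ[𝓝 p] g) :
    HolNear n g p := by
  filter_upwards [hf, h.eventuallyEq_nhds] with q hq hqe
  exact hq.congr_of_eventuallyEq hqe.symm

theorem holNear_const (c : ℂ) (p : X) : HolNear n (fun _ => c) p :=
  Eventually.of_forall fun _ => mdifferentiableAt_const

theorem HolNear.add {f g : X → ℂ} {p : X} (hf : HolNear n f p) (hg : HolNear n g p) :
    HolNear n (fun q => f q + g q) p := by
  filter_upwards [hf, hg] with q h1 h2 using h1.add h2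

theorem HolNear.mul {f g : X → ℂ} {p : X} (hf : HolNear n f p) (hg : HolNear n g p) :
    HolNear n (fun q => f q * g q) p := by
  filter_upwards [hf, hg] with q h1 h2 using h1.mul h2

theorem HolNear.continuousAt {f : X → ℂ} {p : X} (hf : HolNear n f p) : ContinuousAt f p :=
  hf.self_of_nhds.continuousAt

theorem HolNear.eventually {f : X → ℂ} {p : X} (hf : HolNear n f p) :
    ∀ᶠ q in 𝓝 p, HolNear n f q := eventually_eventually_nhds.2 hf

theorem HolNear.prod {J : Type*} (s : Finset J) {f : J → X → ℂ} {p : X}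
    (hf : ∀ j ∈ s, HolNear n (f j) p) : HolNear n (fun q => ∏ j ∈ s, f j q) p := by
  classical
  induction s using Finset.induction_on with
  | empty => simpa using holNear_const 1 p
  | insert j s hj ih =>
    simp only [Finset.prod_insert hj]
    exact (hf j (Finset.mem_insert_self _ _)).mul
      (ih fun i hi => hf i (Finset.mem_insert_of_mem hi))

variable [IsManifold 𝓘(ℂ, Model n) ω X]

theorem HolNear.inv {f : X → ℂ} {p : X} (hf : HolNear n f p) (h0 : f p ≠ 0) :
    HolNear n (fun q => (f q)⁻¹) p := by
  filter_upwards [hf, hf.continuousAt.eventually_ne h0, (chartAt (Model n) p).open_source.mem_nhds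
    (mem_chart_source _ p)] with q h1 h2 hq
  rw [(isHolChart_chartAt p).holAt_iff hq] at h1 ⊢
  refine DifferentiableAt.inv h1 ?_
  simpa [(chartAt (Model n) p).left_inv hq] using h2

theorem HolNear.differentiableAt {f : X → ℂ} {p : X} (hf : HolNear n f p) :
    DifferentiableAt ℂ (f ∘ (chartAt (Model n) p).symm) (chartAt (Model n) p p) :=
  ((isHolChart_chartAt p).eventually_differentiableAt (mem_chart_source _ p) hf).self_of_nhds

omit [IsManifold 𝓘(ℂ, Model n) ω X] in
theorem dif_congr {f g : X → ℂ} {p : X} (h : f =ᶠ[𝓝 p] g) : dif (n := n) p f = dif p g := by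
  refine Filter.EventuallyEq.fderiv_eq ?_
  exact ((chartAt (Model n) p).tendsto_symm (mem_chart_source _ p)).eventually h

omit [IsManifold 𝓘(ℂ, Model n) ω X] in
theorem dif_const (c : ℂ) (p : X) : dif (n := n) p (fun _ => c) = 0 := by
  unfold dif
  exact fderiv_const_apply (c : ℂ)

theorem dif_add {f g : X → ℂ} {p : X} (hf : HolNear n f p) (hg : HolNear n g p) :
    dif (n := n) p (fun q => f q + g q) = dif p f + dif p g :=
  fderiv_add hf.differentiableAt hg.differentiableAt

theorem dif_mul {f g : X → ℂ} {p : X} (hf : HolNear n f p) (hg : HolNear n g p) :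
    dif (n := n) p (fun q => f q * g q) = f p • dif p g + g p • dif p f := by
  have h := fderiv_mul hf.differentiableAt hg.differentiableAt
  have hp : (chartAt (Model n) p).symm (chartAt (Model n) p p) = p :=
    (chartAt (Model n) p).left_inv (mem_chart_source _ p)
  simp only [Function.comp_apply, hp] at h
  exact h

/-- The differential of a function in an arbitrary chart. -/
theorem IsHolChart.dif_eq {Φ : OpenPartialHomeomorph X (Model n)} (hΦ : IsHolChart Φ) {p : X}
    (hp : p ∈ Φ.source) {f : X → ℂ} (hf : HolNear n f p) :
    dif p f = (fderiv ℂ (f ∘ Φ.symm) (Φ p)).comp (chartDeriv Φ p) := by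
  set κ := chartAt (Model n) p
  have hκ : κ.symm (κ p) = p := κ.left_inv (mem_chart_source _ p)
  have h1 : DifferentiableAt ℂ (f ∘ Φ.symm) (Φ p) := (hΦ.holAt_iff hp).1 hf.self_of_nhds
  have h2 : DifferentiableAt ℂ (Φ ∘ κ.symm) (κ p) :=
    (isHolChart_chartAt p).differentiableAt_transition hΦ (mem_chart_source _ p) hp
  have h3 : f ∘ κ.symm =ᶠ[𝓝 (κ p)] (f ∘ Φ.symm) ∘ (Φ ∘ κ.symm) := by
    filter_upwards [(κ.tendsto_symm (mem_chart_source _ p)).eventually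
      (Φ.open_source.mem_nhds hp)] with z hz
    simp only [Function.comp_apply]
    rw [Φ.left_inv hz]
  have h4 : (Φ ∘ κ.symm) (κ p) = Φ p := by simp [hκ]
  rw [dif, h3.fderiv_eq, fderiv_comp _ (by rwa [h4]) h2, h4]
  rfl

theorem IsHolChart.dif_coord {Φ : OpenPartialHomeomorph X (Model n)} (hΦ : IsHolChart Φ) {p : X}
    (hp : p ∈ Φ.source) (j : Fin n) (v : Model n) :
    dif p (fun q => Φ q j) v = chartDeriv Φ p v j := by
  have h2 : DifferentiableAt ℂ (Φ ∘ (chartAt (Model n) p).symm) (chartAt (Model n) p p) :=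
    (isHolChart_chartAt p).differentiableAt_transition hΦ (mem_chart_source _ p) hp
  have h3 := (hasFDerivAt_pi'.1 h2.hasFDerivAt j).fderiv
  change fderiv ℂ (fun z => (Φ ∘ (chartAt (Model n) p).symm) z j) _ v = _
  rw [h3]
  rfl

/-- The inverse of the differential of a chart. -/
theorem IsHolChart.exists_chartDeriv_equiv {Φ : OpenPartialHomeomorph X (Model n)}
    (hΦ : IsHolChart Φ) {p : X} (hp : p ∈ Φ.source) :
    ∃ A : Model n ≃L[ℂ] Model n, (A : Model n →L[ℂ] Model n) = chartDeriv Φ p ∧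
      HasFDerivAt (Φ ∘ (chartAt (Model n) p).symm) (A : Model n →L[ℂ] Model n)
        (chartAt (Model n) p p) ∧
      HasFDerivAt (chartAt (Model n) p ∘ Φ.symm) (A.symm : Model n →L[ℂ] Model n) (Φ p) := by
  set κ := chartAt (Model n) p
  have hκs := mem_chart_source (Model n) p
  have hκ : κ.symm (κ p) = p := κ.left_inv hκs
  have hΦs : Φ.symm (Φ p) = p := Φ.left_inv hp
  have h1 : HasFDerivAt (Φ ∘ κ.symm) (chartDeriv Φ p) (κ p) :=
    ((isHolChart_chartAt p).differentiableAt_transition hΦ hκs hp).hasFDerivAt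
  obtain ⟨B, h2⟩ := hΦ.differentiableAt_transition (isHolChart_chartAt p) hp hκs
  have e1 : (Φ ∘ κ.symm) (κ p) = Φ p := by simp [hκ]
  have e2 : (κ ∘ Φ.symm) (Φ p) = κ p := by simp [hΦs]
  have h3 : HasFDerivAt ((κ ∘ Φ.symm) ∘ (Φ ∘ κ.symm)) (B.comp (chartDeriv Φ p)) (κ p) :=
    HasFDerivAt.comp (κ p) (by rwa [e1]) h1
  have h4 : HasFDerivAt ((Φ ∘ κ.symm) ∘ (κ ∘ Φ.symm)) ((chartDeriv Φ p).comp B) (Φ p) :=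
    HasFDerivAt.comp (Φ p) (by rwa [e2]) h2
  have h5 : B.comp (chartDeriv Φ p) = ContinuousLinearMap.id ℂ _ := by
    refine h3.unique ((hasFDerivAt_id (κ p)).congr_of_eventuallyEq ?_)
    filter_upwards [(κ.tendsto_symm hκs).eventually (Φ.open_source.mem_nhds hp),
      κ.open_target.mem_nhds (κ.map_source hκs)] with z hz hzt
    simp [Φ.left_inv hz, κ.right_inv hzt]
  have h6 : (chartDeriv Φ p).comp B = ContinuousLinearMap.id ℂ _ := by
    refine h4.unique ((hasFDerivAt_id (Φ p)).congr_of_eventuallyEq ?_)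
    filter_upwards [(Φ.tendsto_symm hp).eventually (κ.open_source.mem_nhds hκs),
      Φ.open_target.mem_nhds (Φ.map_source hp)] with z hz hzt
    simp [κ.left_inv hz, Φ.right_inv hzt]
  refine ⟨ContinuousLinearEquiv.equivOfInverse (chartDeriv Φ p) B
    (fun v => by simpa using DFunLike.congr_fun h5 v)
    (fun v => by simpa using DFunLike.congr_fun h6 v), rfl, h1, h2⟩

theorem IsHolChart.linearIndependent_dif {Φ : OpenPartialHomeomorph X (Model n)}
    (hΦ : IsHolChart Φ) {p : X} (hp : p ∈ Φ.source) :
    LinearIndependent ℂ fun j : Fin n => dif (n := n) p fun q => Φ q j := by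
  obtain ⟨A, hA, -, -⟩ := hΦ.exists_chartDeriv_equiv hp
  rw [Fintype.linearIndependent_iff]
  intro c hc i
  have h := DFunLike.congr_fun hc (A.symm (Pi.single i 1))
  simp only [sum_apply, smul_apply, hΦ.dif_coord hp,
    ← hA, ContinuousLinearEquiv.coe_coe, ContinuousLinearEquiv.apply_symm_apply,
    Pi.single_apply, smul_eq_mul, mul_ite, mul_one, mul_zero, Finset.sum_ite_eq',
    Finset.mem_univ, if_true, zero_apply] at h
  exact h

/-- The inverse function theorem: functions with independent differentials form a chart. -/
theorem exists_holChart {p : X} {g : Fin n → X → ℂ} (hg : ∀ j, HolNear n (g j) p)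
    (hli : LinearIndependent ℂ fun j => dif (n := n) p (g j)) {N : Set X} (hN : N ∈ 𝓝 p) :
    ∃ Φ : OpenPartialHomeomorph X (Model n), IsHolChart Φ ∧ p ∈ Φ.source ∧ Φ.source ⊆ N ∧
      ∀ q ∈ Φ.source, ∀ j, Φ q j = g j q := by
  set κ := chartAt (Model n) p
  have hκs := mem_chart_source (Model n) p
  let G : Model n → Model n := fun z j => g j (κ.symm z)
  have hGev : ∀ᶠ z in 𝓝 (κ p), ∀ j, ∀ᶠ w in 𝓝 z, DifferentiableAt ℂ (g j ∘ κ.symm) w := by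
    rw [eventually_all]
    intro j
    exact eventually_eventually_nhds.2
      ((isHolChart_chartAt p).eventually_differentiableAt hκs (hg j))
  have hGc : ∀ z, (∀ j, ∀ᶠ w in 𝓝 z, DifferentiableAt ℂ (g j ∘ κ.symm) w) →
      ContDiffAt ℂ 1 G z := fun z hz => by
    rw [contDiffAt_pi]
    exact fun j => contDiffAt_one_of_eventually_differentiableAt (hz j)
  have hG1 := hGc _ hGev.self_of_nhds
  have hGd : HasFDerivAt G (ContinuousLinearMap.pi fun j => dif p (g j)) (κ p) := by
    rw [hasFDerivAt_pi]
    exact fun j => (hg j).differentiableAt.hasFDerivAt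
  let A : Model n ≃L[ℂ] Model n := (LinearEquiv.ofInjectiveEndo
    ((ContinuousLinearMap.pi fun j => dif (n := n) p (g j) :
      Model n →L[ℂ] Model n) : Model n →ₗ[ℂ] Model n)
    (pi_injective_of_linearIndependent hli)).toContinuousLinearEquiv
  have hA : (A : Model n →L[ℂ] Model n) = ContinuousLinearMap.pi fun j => dif p (g j) := by
    ext v : 1
    rfl
  rw [← hA] at hGd
  let e := hG1.toOpenPartialHomeomorph G hGd one_ne_zero
  have heG : ∀ z, e z = G z := fun z => rfl
  have hes : κ p ∈ e.source := hG1.mem_toOpenPartialHomeomorph_source hGd one_ne_zero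
  -- Invertibility of the derivative is an open condition; shrinking to such points makes the
  -- inverse differentiable on the whole target, not only at the image of `p`.
  have hinv : ∀ᶠ z in 𝓝 (κ p), fderiv ℂ G z ∈ range
      (ContinuousLinearEquiv.toContinuousLinearMap : (Model n ≃L[ℂ] Model n) → _) := by
    refine (hG1.continuousAt_fderiv one_ne_zero).eventually ?_
    rw [hGd.fderiv]
    exact ContinuousLinearEquiv.nhds A
  obtain ⟨W, hWs, hWo, hpW⟩ := _root_.mem_nhds_iff.1 (hGev.and hinv)
  let e' := e.restrOpen W hWo
  have he'd : e'.MDifferentiable 𝓘(ℂ, Model n) 𝓘(ℂ, Model n) := by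
    constructor
    · rw [mdifferentiableOn_iff_differentiableOn]
      intro z hz
      exact ((hGc z (hWs hz.2).1).differentiableAt one_ne_zero).differentiableWithinAt
    · rw [mdifferentiableOn_iff_differentiableOn]
      intro z hz
      have hz' := e'.map_target hz
      obtain ⟨B, hB⟩ := (hWs hz'.2).2
      have h1 : HasFDerivAt e' (B : Model n →L[ℂ] Model n) (e'.symm z) := by
        rw [hB]
        exact ((hGc _ (hWs hz'.2).1).differentiableAt one_ne_zero).hasFDerivAt
      exact (e'.hasFDerivAt_symm hz h1).differentiableAt.differentiableWithinAt
  let Φ₀ := κ.trans e'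
  have hΦ₀ : IsHolChart Φ₀ := (isHolChart_chartAt p).trans he'd
  have hp0 : p ∈ Φ₀.source := by
    rw [OpenPartialHomeomorph.trans_source]
    exact ⟨hκs, hes, hpW⟩
  let Φ := Φ₀.restrOpen (interior N) isOpen_interior
  refine ⟨Φ, ⟨hΦ₀.1.mono fun q hq => hq.1, hΦ₀.2.mono fun q hq => hq.1⟩,
    ⟨hp0, mem_interior_iff_mem_nhds.2 hN⟩, fun q hq => interior_subset hq.2, ?_⟩
  intro q hq j
  have hqκ : q ∈ κ.source := by
    have := hq.1
    rw [OpenPartialHomeomorph.trans_source] at this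
    exact this.1
  change g j (κ.symm (κ q)) = g j q
  rw [κ.left_inv hqκ]

end Charts

end SemiStable

namespace SemiStable

/-! ### Tangent cones -/

section Cones

/-- The tangent cone of a translate of a closed complex cone. -/
theorem tangentConeAt_translate {E : Type*} [NormedAddCommGroup E] [NormedSpace ℂ E] {N : Set E}
    (hN : IsClosed N) (hsmul : ∀ (c : ℂ), ∀ v ∈ N, c • v ∈ N) (x : E) :
    tangentConeAt ℂ {y | y - x ∈ N} x = N := by
  ext v
  constructor
  · intro hv
    obtain ⟨α, l, hl, c, d, hd, hmem, hlim⟩ := exists_fun_of_mem_tangentConeAt hv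
    refine hN.mem_of_tendsto hlim ?_
    filter_upwards [hmem] with a ha
    refine hsmul _ _ ?_
    simpa using ha
  · intro hv
    refine mem_tangentConeAt_of_add_smul_mem (l := 𝓝[≠] (0 : ℂ)) (c := id) tendsto_id ?_
    refine Eventually.of_forall fun c => ?_
    simpa using hsmul c v hv

variable {n : ℕ} {X : Type*} [TopologicalSpace X]

/-- Differentials carry tangent cones into tangent cones. Used for a coordinate change and for its
inverse, this allows the cone to be computed in any chart. -/
theorem IsHolChart.mapsTo_tangentConeAt {Φ Ψ : OpenPartialHomeomorph X (Model n)} {p : X}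
    (hp : p ∈ Φ.source) (hp' : p ∈ Ψ.source) {B : Model n →L[ℂ] Model n}
    (hB : HasFDerivAt (Ψ ∘ Φ.symm) B (Φ p)) (A : Set X) :
    MapsTo B (tangentConeAt ℂ (Φ '' (A ∩ Φ.source)) (Φ p))
      (tangentConeAt ℂ (Ψ '' (A ∩ Ψ.source)) (Ψ p)) := by
  have ht : Φ.symm ⁻¹' Ψ.source ∈ 𝓝 (Φ p) :=
    (Φ.tendsto_symm hp) (Ψ.open_source.mem_nhds hp')
  rw [← tangentConeAt_inter_nhds ht]
  have h1 := hB.hasFDerivWithinAt (s := Φ '' (A ∩ Φ.source) ∩ Φ.symm ⁻¹' Ψ.source)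
  have h2 := h1.mapsTo_tangent_cone
  have e1 : (Ψ ∘ Φ.symm) (Φ p) = Ψ p := by simp [Φ.left_inv hp]
  rw [e1] at h2
  refine h2.mono_right (tangentConeAt_mono ?_)
  rintro _ ⟨_, ⟨⟨q, ⟨hqA, hqs⟩, rfl⟩, hq⟩, rfl⟩
  rw [mem_preimage, Φ.left_inv hqs] at hq
  exact ⟨q, ⟨hqA, hq⟩, by simp [Φ.left_inv hqs]⟩

variable [ChartedSpace (Model n) X] [IsManifold 𝓘(ℂ, Model n) ω X]

/-- The tangent cone of a set which is a closed complex cone in suitable coordinates. -/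
theorem IsHolChart.mem_tangentCone_iff {Φ : OpenPartialHomeomorph X (Model n)}
    (hΦ : IsHolChart Φ) {p : X} (hp : p ∈ Φ.source) {N : Set (Model n)} (hN : IsClosed N)
    (hsmul : ∀ (c : ℂ), ∀ v ∈ N, c • v ∈ N) {A : Set X}
    (hA : ∀ᶠ q in 𝓝 p, q ∈ A ↔ Φ q - Φ p ∈ N) (v : Model n) :
    v ∈ tangentCone (n := n) A p ↔ chartDeriv Φ p v ∈ N := by
  obtain ⟨B, hB, h1, h2⟩ := hΦ.exists_chartDeriv_equiv hp
  have hκs := mem_chart_source (Model n) p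
  have hcone : tangentConeAt ℂ (Φ '' (A ∩ Φ.source)) (Φ p) = N := by
    rw [← tangentConeAt_translate hN hsmul (Φ p)]
    obtain ⟨U, hU, hUo, hpU⟩ := _root_.mem_nhds_iff.1 hA
    have ht : Φ.target ∩ Φ.symm ⁻¹' U ∈ 𝓝 (Φ p) :=
      inter_mem (Φ.open_target.mem_nhds (Φ.map_source hp))
        ((Φ.tendsto_symm hp) (hUo.mem_nhds hpU))
    rw [← tangentConeAt_inter_nhds (s := Φ '' (A ∩ Φ.source)) ht,
      ← tangentConeAt_inter_nhds (s := {y | y - Φ p ∈ N}) ht]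
    congr 1
    ext x
    constructor
    · rintro ⟨⟨q, ⟨hqA, hqs⟩, rfl⟩, hxt, hxU⟩
      refine ⟨?_, hxt, hxU⟩
      rw [mem_preimage, Φ.left_inv hqs] at hxU
      exact (hU hxU).1 hqA
    · rintro ⟨hx, hxt, hxU⟩
      refine ⟨⟨Φ.symm x, ⟨(hU hxU).2 ?_, Φ.map_target hxt⟩, Φ.right_inv hxt⟩, hxt, hxU⟩
      rw [Φ.right_inv hxt]
      exact hx
  have hto := IsHolChart.mapsTo_tangentConeAt hκs hp h1 A
  have hfrom := IsHolChart.mapsTo_tangentConeAt hp hκs h2 A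
  rw [hcone] at hto hfrom
  rw [← hB]
  constructor
  · intro hv
    exact hto hv
  · intro hv
    have := hfrom hv
    rw [ContinuousLinearEquiv.coe_coe, ContinuousLinearEquiv.coe_coe,
      ContinuousLinearEquiv.symm_apply_apply] at this
    exact this

end Cones

/-! ### Hyperplanes in finite unions of hyperplanes -/

section Hyperplanes

variable {K V : Type*} [Field K] [AddCommGroup V] [Module K V] [FiniteDimensional K V]

theorem finrank_quotient_ker {l : V →ₗ[K] K} (hl : l ≠ 0) :
    Module.finrank K (V ⧸ LinearMap.ker l) = 1 := by
  have h1 := Module.Dual.finrank_ker_add_one_of_ne_zero hl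
  have h2 := (LinearMap.ker l).finrank_quotient_add_finrank
  omega

omit [FiniteDimensional K V] in
theorem finrank_quotient_iInf_ker {J : Type*} [Fintype J] {l : J → V →ₗ[K] K}
    (hl : Function.Surjective (LinearMap.pi l)) :
    Module.finrank K (V ⧸ ⨅ j, LinearMap.ker (l j)) = Fintype.card J := by
  rw [← LinearMap.ker_pi, (LinearMap.quotKerEquivOfSurjective _ hl).finrank_eq,
    Module.finrank_fintype_fun_eq_card]

/-- The hyperplanes contained in a finite union of hyperplanes. -/
theorem hyperplanes_subset_union [Infinite K] {J : Type*} (s : Finset J) (l : J → V →ₗ[K] K)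
    (hl : ∀ j ∈ s, l j ≠ 0) (L : Submodule K V) :
    (Module.finrank K (V ⧸ L) = 1 ∧ ∀ v ∈ L, ∃ j ∈ s, l j v = 0) ↔
      ∃ j ∈ s, LinearMap.ker (l j) = L := by
  constructor
  · rintro ⟨h1, h2⟩
    -- A vector space over an infinite field is not a finite union of proper subspaces, so one of
    -- the hyperplanes contains `L`, and dimensions agree.
    have hcov : ⋃ j : s, (((LinearMap.ker (l j)).comap L.subtype : Submodule K L) : Set L) =
        univ := by
      rw [eq_univ_iff_forall]
      intro v
      obtain ⟨j, hj, h⟩ := h2 v v.2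
      exact mem_iUnion.2 ⟨⟨j, hj⟩, h⟩
    obtain ⟨⟨j, hj⟩, htop⟩ := Subspace.exists_eq_top_of_iUnion_eq_univ hcov
    refine ⟨j, hj, ?_⟩
    have hle : L ≤ LinearMap.ker (l j) := fun v hv => by
      have : (⟨v, hv⟩ : L) ∈ ((LinearMap.ker (l j)).comap L.subtype : Submodule K L) := by
        rw [htop]; trivial
      exact this
    have h3 := finrank_quotient_ker (hl j hj)
    have h4 := (LinearMap.ker (l j)).finrank_quotient_add_finrank
    have h5 := L.finrank_quotient_add_finrank
    exact (Submodule.eq_of_le_of_finrank_eq hle (by omega)).symm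
  · rintro ⟨j, hj, rfl⟩
    exact ⟨finrank_quotient_ker (hl j hj), fun v hv => ⟨j, hj, hv⟩⟩

end Hyperplanes

/-! ### Products of germs -/

section Domain

variable {E : Type*} [NormedAddCommGroup E] [NormedSpace ℂ E]

/-- The ring of holomorphic germs is a domain. -/
theorem eventually_eq_zero_of_mul {f g : E → ℂ} {z₀ : E}
    (hf : ∀ᶠ z in 𝓝 z₀, DifferentiableAt ℂ f z) (hg : ∀ᶠ z in 𝓝 z₀, DifferentiableAt ℂ g z)
    (hfg : ∀ᶠ z in 𝓝 z₀, f z * g z = 0) (hne : ¬ ∀ᶠ z in 𝓝 z₀, f z = 0) :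
    ∀ᶠ z in 𝓝 z₀, g z = 0 := by
  obtain ⟨R, hR, h⟩ := Metric.eventually_nhds_iff_ball.1 (hf.and (hg.and hfg))
  have hfr : ∃ᶠ z in 𝓝 z₀, f z ≠ 0 := fun hcon => hne (hcon.mono fun _ h => not_not.1 h)
  -- Restriction to the complex line through `b` and a point `a` with `f a ≠ 0` reduces the claim to
  -- functions of one variable.
  obtain ⟨a, hfa, ha⟩ := (hfr.and_eventually (Metric.ball_mem_nhds z₀ hR)).exists
  filter_upwards [Metric.ball_mem_nhds z₀ hR] with b hb
  let Ω : Set ℂ := {ζ | a + ζ • (b - a) ∈ Metric.ball z₀ R}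
  have hΩo : IsOpen Ω := Metric.isOpen_ball.preimage (by fun_prop)
  have hΩc : IsPreconnected Ω := by
    refine Convex.isPreconnected (s := Ω) ?_
    intro ζ hζ ξ hξ s t hs ht hst
    let _ : NormedSpace ℝ E := NormedSpace.restrictScalars ℝ ℂ E
    have h1 := convex_ball z₀ R hζ hξ hs ht hst
    change a + (s • ζ + t • ξ) • (b - a) ∈ Metric.ball z₀ R
    convert h1 using 1
    have e : ∀ (r : ℝ) (v : E), r • v = (r : ℂ) • v := fun r v => rfl
    have hst' : (s : ℂ) + t = 1 := by exact_mod_cast hst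
    rw [e, e, Complex.real_smul, Complex.real_smul, smul_add, smul_add, smul_smul, smul_smul,
      add_smul]
    have : a = (s : ℂ) • a + (t : ℂ) • a := by rw [← add_smul, hst', one_smul]
    nth_rewrite 1 [this]
    abel
  have hline : ∀ φ : E → ℂ, (∀ z ∈ Metric.ball z₀ R, DifferentiableAt ℂ φ z) →
      AnalyticOnNhd ℂ (fun ζ : ℂ => φ (a + ζ • (b - a))) Ω := fun φ hφ =>
    DifferentiableOn.analyticOnNhd (fun ζ hζ =>
      (DifferentiableAt.comp ζ (hφ _ hζ) (by fun_prop)).differentiableWithinAt) hΩo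
  have h0 : (0 : ℂ) ∈ Ω := by simpa [Ω] using ha
  have h1 : (1 : ℂ) ∈ Ω := by simpa [Ω] using hb
  rcases AnalyticOnNhd.eq_zero_or_eq_zero_of_mul_eq_zero (hline f fun z hz => (h z hz).1)
    (hline g fun z hz => (h z hz).2.1) (fun ζ hζ => (h _ hζ).2.2) hΩc with h2 | h2
  · have := h2 0 h0
    simp only [zero_smul, add_zero] at this
    exact absurd this hfa
  · have := h2 1 h1
    simpa using this

theorem exists_eventually_eq_zero_of_prod {J : Type*} (s : Finset J) {f : J → E → ℂ} {z₀ : E}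
    (hf : ∀ j ∈ s, ∀ᶠ z in 𝓝 z₀, DifferentiableAt ℂ (f j) z)
    (hprod : ∀ᶠ z in 𝓝 z₀, ∏ j ∈ s, f j z = 0) : ∃ j ∈ s, ∀ᶠ z in 𝓝 z₀, f j z = 0 := by
  classical
  induction s using Finset.induction_on with
  | empty =>
    simp only [Finset.prod_empty, one_ne_zero] at hprod
    exact absurd hprod.self_of_nhds not_false
  | insert i s hi ih =>
    simp only [Finset.prod_insert hi] at hprod
    by_cases h : ∀ᶠ z in 𝓝 z₀, f i z = 0
    · exact ⟨i, Finset.mem_insert_self _ _, h⟩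
    · have hs : ∀ᶠ z in 𝓝 z₀, DifferentiableAt ℂ (fun z => ∏ j ∈ s, f j z) z := by
        have : ∀ᶠ z in 𝓝 z₀, ∀ j ∈ s, DifferentiableAt ℂ (f j) z := by
          rw [Finset.eventually_all]
          exact fun j hj => hf j (Finset.mem_insert_of_mem hj)
        filter_upwards [this] with z hz
        exact (HasFDerivAt.finsetProd fun j hj => (hz j hj).hasFDerivAt).differentiableAt.congr_of_eventuallyEq
          (Eventually.of_forall fun z => by simp)
      obtain ⟨j, hj, hj0⟩ := ih (fun j hj => hf j (Finset.mem_insert_of_mem hj))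
        (eventually_eq_zero_of_mul (hf i (Finset.mem_insert_self _ _)) hs hprod h)
      exact ⟨j, Finset.mem_insert_of_mem hj, hj0⟩

end Domain

section DomainManifold

variable {n : ℕ} {X : Type*} [TopologicalSpace X] [ChartedSpace (Model n) X]
  [IsManifold 𝓘(ℂ, Model n) ω X]

theorem HolNear.exists_eq_zero_of_prod {J : Type*} (s : Finset J) {f : J → X → ℂ} {p : X}
    (hf : ∀ j ∈ s, HolNear n (f j) p) (hprod : ∀ᶠ q in 𝓝 p, ∏ j ∈ s, f j q = 0) :
    ∃ j ∈ s, ∀ᶠ q in 𝓝 p, f j q = 0 := by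
  set κ := chartAt (Model n) p
  have hκs := mem_chart_source (Model n) p
  obtain ⟨j, hj, h⟩ := exists_eventually_eq_zero_of_prod s (z₀ := κ p)
    (f := fun j => f j ∘ κ.symm)
    (fun j hj => (isHolChart_chartAt p).eventually_differentiableAt hκs (hf j hj))
    ((κ.tendsto_symm hκs).eventually hprod)
  refine ⟨j, hj, ?_⟩
  filter_upwards [(κ.continuousAt hκs).eventually h, κ.open_source.mem_nhds hκs] with q hq hqs
  simpa [κ.left_inv hqs] using hq

theorem HolNear.eq_zero_of_mul {f g : X → ℂ} {p : X} (hf : HolNear n f p) (hg : HolNear n g p)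
    (hfg : ∀ᶠ q in 𝓝 p, f q * g q = 0) (hne : ¬ ∀ᶠ q in 𝓝 p, f q = 0) :
    ∀ᶠ q in 𝓝 p, g q = 0 := by
  obtain ⟨b, -, hb⟩ := HolNear.exists_eq_zero_of_prod (n := n) Finset.univ
    (f := fun b : Bool => cond b f g) (p := p) (fun b _ => by cases b <;> assumption)
    (by simpa using hfg)
  cases b
  · exact hb
  · exact absurd hb hne

end DomainManifold

end SemiStable

namespace SemiStable

/-! ### The real structure on germs -/

section RealGerms

variable {n : ℕ} {X : Type*} [TopologicalSpace X] [ChartedSpace (Model n) X]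
  {π : ComplexDegeneration n X}

/-- The action of the real structure on functions. -/
def RealStructure.conjFn (ι : RealStructure π) (f : X → ℂ) : X → ℂ :=
  fun x => star (f (ι.inv x))

theorem RealStructure.conjFn_fn (ι : RealStructure π) : ι.conjFn π.fn = π.fn := by
  funext x
  simp [RealStructure.conjFn, ι.conj_compat]

theorem RealStructure.continuous_inv (ι : RealStructure π) : Continuous ι.inv :=
  ι.antiholomorphic.1

theorem RealStructure.tendsto_inv (ι : RealStructure π) {p : X} (hp : ι.inv p = p) :
    Tendsto ι.inv (𝓝 p) (𝓝 p) := by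
  have := ι.continuous_inv.tendsto p
  rwa [hp] at this

theorem HolNear.conjFn {ι : RealStructure π} {p : X} (hp : ι.inv p = p) {f : X → ℂ}
    (hf : HolNear n f p) : HolNear n (ι.conjFn f) p := by
  filter_upwards [(ι.tendsto_inv hp).eventually hf] with q hq
  exact holAt_star_comp ι.antiholomorphic hq

theorem RealStructure.conjFn_congr (ι : RealStructure π) {p : X} (hp : ι.inv p = p) {f g : X → ℂ}
    (h : f =ᶠ[𝓝 p] g) : ι.conjFn f =ᶠ[𝓝 p] ι.conjFn g := by
  filter_upwards [(ι.tendsto_inv hp).eventually h] with q hq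
  exact congrArg star hq

/-- A combination of a function and its conjugate which is fixed by the real structure. -/
def RealStructure.realPart (ι : RealStructure π) (c : ℂ) (f : X → ℂ) : X → ℂ :=
  fun x => c * f x + star c * ι.conjFn f x

theorem RealStructure.conjFn_realPart (ι : RealStructure π) (c : ℂ) (f : X → ℂ) :
    ι.conjFn (ι.realPart c f) = ι.realPart c f := by
  funext x
  simp only [RealStructure.conjFn, RealStructure.realPart, star_add, star_mul', star_star,
    ι.involutive x]
  ring

theorem HolNear.realPart {ι : RealStructure π} {p : X} (hp : ι.inv p = p) {f : X → ℂ}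
    (hf : HolNear n f p) (c : ℂ) : HolNear n (ι.realPart c f) p :=
  ((holNear_const c p).mul hf).add ((holNear_const _ p).mul (hf.conjFn hp))

variable [IsManifold 𝓘(ℂ, Model n) ω X]

theorem dif_const_mul (c : ℂ) {f : X → ℂ} {p : X} (hf : HolNear n f p) :
    dif (n := n) p (fun q => c * f q) = c • dif p f := by
  rw [dif_mul (holNear_const c p) hf, dif_const]
  ext v
  simp

theorem dif_realPart {ι : RealStructure π} {p : X} (hp : ι.inv p = p) {f : X → ℂ}
    (hf : HolNear n f p) (c : ℂ) :
    dif (n := n) p (ι.realPart c f) = c • dif p f + star c • dif p (ι.conjFn f) := by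
  rw [← dif_const_mul c hf, ← dif_const_mul (star c) (hf.conjFn hp)]
  exact dif_add ((holNear_const c p).mul hf) ((holNear_const _ p).mul (hf.conjFn hp))

/-- A differential is a combination of the differentials of real functions. -/
theorem dif_eq_realPart {ι : RealStructure π} {p : X} (hp : ι.inv p = p) {f : X → ℂ}
    (hf : HolNear n f p) :
    dif (n := n) p f = (2 : ℂ)⁻¹ • dif p (ι.realPart 1 f) +
      (-(2 : ℂ)⁻¹ * Complex.I) • dif p (ι.realPart Complex.I f) := by
  rw [dif_realPart hp hf, dif_realPart hp hf]
  ext v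
  simp only [add_apply, smul_apply, smul_eq_mul, star_one,
    one_mul, RCLike.star_def, Complex.conj_I]
  linear_combination (-(2 : ℂ)⁻¹ * dif p f v + (2 : ℂ)⁻¹ * dif p (ι.conjFn f) v) * (-Complex.I_sq)

/-- The differential of the conjugate function. -/
theorem dif_conjFn {ι : RealStructure π} {p : X} (hp : ι.inv p = p) {f : X → ℂ}
    (hf : HolNear n f p) (v : Model n) :
    dif (n := n) p (ι.conjFn f) v =
      star (dif p f (differentialAtFixedPoint (n := n) ι.inv p v)) := by
  set κ := chartAt (Model n) p with hκ
  have hκs := mem_chart_source (Model n) p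
  have hκp : κ.symm (κ p) = p := κ.left_inv hκs
  let g : Model n → Model n := fun z => κ (ι.inv (κ.symm z))
  have hg : DifferentiableAt ℝ g (κ p) := by
    have h1 := ι.antiholomorphic.2 p
    rw [hp] at h1
    have h2 := (h1.restrictScalars ℝ).star
    simpa only [star_star] using h2
  have hgp : g (κ p) = κ p := by simp [g, hκp, hp]
  have hF : DifferentiableAt ℂ (f ∘ κ.symm) (κ p) := hf.differentiableAt
  have hS : DifferentiableAt ℂ (ι.conjFn f ∘ κ.symm) (κ p) := (hf.conjFn hp).differentiableAt
  -- The real chain rule gives the derivative of `f` composed with the involution; its conjugate is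
  -- the real derivative of `conjFn f`, which determines the complex one.
  have h3 : HasFDerivAt (f ∘ κ.symm ∘ g)
      (((fderiv ℂ (f ∘ κ.symm) (κ p)).restrictScalars ℝ).comp (fderiv ℝ g (κ p))) (κ p) := by
    refine HasFDerivAt.comp (g := f ∘ κ.symm) (κ p) ?_ hg.hasFDerivAt
    rw [hgp]
    exact hF.hasFDerivAt.restrictScalars ℝ
  have h4 := h3.star
  have h5 : ι.conjFn f ∘ κ.symm =ᶠ[𝓝 (κ p)] fun z => star ((f ∘ κ.symm ∘ g) z) := by
    have ht : Tendsto (fun z => ι.inv (κ.symm z)) (𝓝 (κ p)) (𝓝 p) :=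
      (ι.tendsto_inv hp).comp (κ.tendsto_symm hκs)
    filter_upwards [ht.eventually (κ.open_source.mem_nhds hκs)] with z hz
    simp [g, RealStructure.conjFn, κ.left_inv hz]
  have h6 := (h4.congr_of_eventuallyEq h5).unique (hS.hasFDerivAt.restrictScalars ℝ)
  exact (DFunLike.congr_fun h6 v).symm

end RealGerms

/-! ### Extending germs to charts -/

section Extend

variable {n : ℕ} {X : Type*} [TopologicalSpace X] [ChartedSpace (Model n) X]

theorem finrank_dual_model : Module.finrank ℂ (Model n →L[ℂ] ℂ) = n := by
  rw [← (LinearMap.toContinuousLinearMap (𝕜 := ℂ) (E := Model n) (F' := ℂ)).finrank_eq,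
    Module.finrank_linearMap]
  simp

instance finiteDimensional_dual_model : FiniteDimensional ℂ (Model n →L[ℂ] ℂ) :=
  (LinearMap.toContinuousLinearMap (𝕜 := ℂ) (E := Model n) (F' := ℂ)).finiteDimensional

/-- Germs with independent differentials can be extended to a coordinate system by germs from a
set whose differentials span the cotangent space. -/
theorem exists_germs_extending {p : X} {I : Type*} {f : I → X → ℂ}
    (hf : LinearIndependent ℂ fun i => dif (n := n) p (f i)) {T : Set (X → ℂ)}
    (hT : Submodule.span ℂ (dif (n := n) p '' T) = ⊤) :
    ∃ (g : Fin n → X → ℂ) (ε : I → Fin n), Function.Injective ε ∧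
      (LinearIndependent ℂ fun j => dif (n := n) p (g j)) ∧ (∀ i, g (ε i) = f i) ∧
      ∀ j, j ∉ range ε → g j ∈ T := by
  classical
  obtain ⟨b, ε, hε, hb, hbε, hbT⟩ := exists_basis_extending (J := Fin n)
    (by rw [finrank_dual_model, Fintype.card_fin]) hf hT
  choose! t htT htb using hbT
  have hg : ∀ i, Function.extend ε f t (ε i) = f i := fun i => hε.extend_apply _ _ _
  have hg' : ∀ j, j ∉ range ε → Function.extend ε f t j = t j := fun j hj =>
    Function.extend_apply' _ _ _ hj
  refine ⟨Function.extend ε f t, ε, hε, ?_, hg, fun j hj => by rw [hg' j hj]; exact htT j hj⟩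
  suffices h : (fun j => dif (n := n) p (Function.extend ε f t j)) = b by rwa [h]
  funext j
  by_cases hj : j ∈ range ε
  · obtain ⟨i, rfl⟩ := hj
    rw [hg, hbε]
  · rw [hg' j hj, htb j hj]

variable [IsManifold 𝓘(ℂ, Model n) ω X]

theorem IsHolChart.span_dif {Φ : OpenPartialHomeomorph X (Model n)} (hΦ : IsHolChart Φ) {p : X}
    (hp : p ∈ Φ.source) :
    Submodule.span ℂ (range fun j => dif (n := n) p fun q => Φ q j) = ⊤ :=
  (hΦ.linearIndependent_dif hp).span_eq_top_of_card_eq_finrank'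
    (by rw [finrank_dual_model, Fintype.card_fin])

end Extend

/-! ### Distinguished charts -/

section Distinguished

variable {n : ℕ} {X : Type*} [TopologicalSpace X] [ChartedSpace (Model n) X]
  [IsManifold 𝓘(ℂ, Model n) ω X]

omit [IsManifold 𝓘(ℂ, Model n) ω X] in
theorem ComplexDegeneration.holNear_fn (π : ComplexDegeneration n X) (p : X) :
    HolNear n π.fn p := Eventually.of_forall π.holomorphic

omit [IsManifold 𝓘(ℂ, Model n) ω X] in
theorem ComplexDegeneration.dif_fn_ne_zero (π : ComplexDegeneration n X) {p : X}
    (hp : π.fn p ≠ 0) : dif (n := n) p π.fn ≠ 0 := by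
  intro h
  have h1 : mfderiv 𝓘(ℂ, Model n) 𝓘(ℂ, ℂ) (fun x => (π.toDisc x : ℂ)) p = dif (n := n) p π.fn := by
    rw [(π.holomorphic p).mfderiv]
    simp only [mfld_simps, fderivWithin_univ]
    rfl
  have h2 := π.regular p hp
  rw [h1, h] at h2
  have h3 : Function.Surjective (0 : Model n →L[ℂ] ℂ) := h2
  obtain ⟨v, hv⟩ := h3 1
  exact zero_ne_one hv

/-- A chart in which the fibration is a product of coordinates indexed by `K`, and the fibre
through `p` is a union of coordinate hyperplanes indexed by `K`. -/
structure ComplexDegeneration.IsDistinguished (π : ComplexDegeneration n X)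
    (Φ : OpenPartialHomeomorph X (Model n)) (K : Finset (Fin n)) (p : X) : Prop where
  isHolChart : IsHolChart Φ
  mem_source : p ∈ Φ.source
  nonempty : K.Nonempty
  fn_eq : ∀ q ∈ Φ.source, π.fn q = ∏ j ∈ K, Φ q j
  fibre : ∀ᶠ q in 𝓝 p, π.fn q = π.fn p ↔ ∃ j ∈ K, Φ q j = Φ p j
  cases : (∃ j, K = {j}) ∨ (π.fn p = 0 ∧ ∀ j ∈ K, Φ p j = 0)

/-- On the special fibre the normal crossing chart serves. Elsewhere `π` has nonzero differential
and is itself taken as a coordinate, so `K` is a single index. -/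
theorem ComplexDegeneration.exists_isDistinguished (π : ComplexDegeneration n X) (p : X) :
    ∃ Φ K, π.IsDistinguished Φ K p := by
  by_cases hp : π.fn p = 0
  · obtain ⟨φ, hφ, hps, hp0, k, hk1, hkn, hk⟩ := π.normalCrossing p hp
    have hfn : ∀ q ∈ φ.source, π.fn q =
        ∏ j ∈ Finset.univ.filter fun j : Fin n => (j : ℕ) < k, φ q j := fun q hq => by
      rw [Finset.prod_filter]
      exact hk q hq
    refine ⟨φ, Finset.univ.filter fun j : Fin n => (j : ℕ) < k,
      isHolChart_of_mem_maximalAtlas hφ, hps, ⟨⟨0, by omega⟩, by simp; omega⟩, hfn, ?_,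
      Or.inr ⟨hp, fun j _ => by rw [hp0]; rfl⟩⟩
    filter_upwards [φ.open_source.mem_nhds hps] with q hq
    rw [hp, hfn q hq, Finset.prod_eq_zero_iff, hp0]
    rfl
  · have hli : LinearIndependent ℂ fun _ : Unit => dif (n := n) p π.fn :=
      LinearIndependent.of_subsingleton () (π.dif_fn_ne_zero hp)
    set κ := chartAt (Model n) p
    have hκs := mem_chart_source (Model n) p
    obtain ⟨g, ε, -, hg, hgε, hgT⟩ := exists_germs_extending (n := n) (p := p) (f := fun _ => π.fn)
      hli (T := range fun j q => κ q j) (by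
        rw [← range_comp]; exact (isHolChart_chartAt p).span_dif hκs)
    have hgh : ∀ j, HolNear n (g j) p := fun j => by
      by_cases hj : j ∈ range ε
      · obtain ⟨i, rfl⟩ := hj
        rw [hgε]
        exact π.holNear_fn p
      · obtain ⟨i, hi⟩ := hgT j hj
        rw [← hi]
        exact (isHolChart_chartAt p).holNear_coord hκs i
    obtain ⟨Φ, hΦ, hps, -, hΦg⟩ := exists_holChart hgh hg univ_mem
    have hfn : ∀ q ∈ Φ.source, Φ q (ε ()) = π.fn q := fun q hq => by rw [hΦg q hq, hgε]
    refine ⟨Φ, {ε ()}, hΦ, hps, Finset.singleton_nonempty _, fun q hq => ?_, ?_, Or.inl ⟨_, rfl⟩⟩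
    · rw [Finset.prod_singleton, hfn q hq]
    · filter_upwards [Φ.open_source.mem_nhds hps] with q hq
      simp [hfn q hq, hfn p hps]

variable {π : ComplexDegeneration n X} {Φ : OpenPartialHomeomorph X (Model n)}
  {K : Finset (Fin n)} {p : X}

/-- The hyperplane in the tangent space at `p` defined by a function. -/
noncomputable def kerDif (p : X) (f : X → ℂ) : Submodule ℂ (Model n) :=
  LinearMap.ker (dif (n := n) p f : Model n →ₗ[ℂ] ℂ)

omit [IsManifold 𝓘(ℂ, Model n) ω X] in
theorem mem_kerDif {f : X → ℂ} {v : Model n} : v ∈ kerDif p f ↔ dif (n := n) p f v = 0 := Iff.rfl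

theorem IsHolChart.exists_dif_eq (hΦ : IsHolChart Φ) (hp : p ∈ Φ.source) (w : Model n) :
    ∃ v : Model n, ∀ j, dif (n := n) p (fun q => Φ q j) v = w j := by
  obtain ⟨A, hA, -, -⟩ := hΦ.exists_chartDeriv_equiv hp
  refine ⟨A.symm w, fun j => ?_⟩
  rw [hΦ.dif_coord hp, ← hA, ContinuousLinearEquiv.coe_coe,
    ContinuousLinearEquiv.apply_symm_apply]

theorem IsHolChart.exists_dif_eq_single (hΦ : IsHolChart Φ) (hp : p ∈ Φ.source) (i : Fin n) :
    ∃ v : Model n, ∀ j, dif (n := n) p (fun q => Φ q j) v = (Pi.single i 1 : Model n) j :=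
  hΦ.exists_dif_eq hp _

theorem IsHolChart.kerDif_injective (hΦ : IsHolChart Φ) (hp : p ∈ Φ.source) :
    Function.Injective fun j => kerDif (n := n) p fun q => Φ q j := by
  intro i j hij
  by_contra hne
  obtain ⟨v, hv⟩ := hΦ.exists_dif_eq_single hp i
  have h1 : v ∈ kerDif (n := n) p fun q => Φ q j := by
    rw [mem_kerDif, hv j, Pi.single_eq_of_ne (Ne.symm hne)]
  rw [← show (kerDif (n := n) p fun q => Φ q i) = kerDif p fun q => Φ q j from hij, mem_kerDif, hv i, Pi.single_eq_same] at h1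
  exact one_ne_zero h1

/-- The hyperplanes of the tangent cone of the fibre. -/
theorem ComplexDegeneration.IsDistinguished.tangentHyperplanes_eq
    (h : π.IsDistinguished Φ K p) :
    (tangentHyperplanes (n := n) (π.fibre (π.fn p)) p : Set (Submodule ℂ (Model n))) =
      (fun j => kerDif (n := n) p fun q => Φ q j) '' K := by
  have hN : IsClosed {v : Model n | ∃ j ∈ K, v j = 0} := by
    have : {v : Model n | ∃ j ∈ K, v j = 0} = ⋃ j ∈ K, {v | v j = 0} := by ext; simp
    rw [this]
    exact isClosed_biUnion_finset fun j _ => isClosed_eq (continuous_apply j) continuous_const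
  have hcone := h.isHolChart.mem_tangentCone_iff h.mem_source hN
    (fun c v ⟨j, hj, hv⟩ => ⟨j, hj, by simp [hv]⟩) (A := π.fibre (π.fn p)) (by
      filter_upwards [h.fibre] with q hq
      simpa [sub_eq_zero] using (show q ∈ π.fibre (π.fn p) ↔ _ from hq))
  have hne : ∀ j ∈ K, (dif (n := n) p (fun q => Φ q j) : Model n →ₗ[ℂ] ℂ) ≠ 0 := fun j _ h0 => by
    obtain ⟨v, hv⟩ := h.isHolChart.exists_dif_eq_single h.mem_source j
    have := LinearMap.congr_fun h0 v
    rw [ContinuousLinearMap.coe_coe, hv j, Pi.single_eq_same] at this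
    exact one_ne_zero this
  ext L
  have hU := hyperplanes_subset_union K
    (fun j => (dif (n := n) p (fun q => Φ q j) : Model n →ₗ[ℂ] ℂ)) hne L
  refine Iff.trans ?_ hU
  refine and_congr Iff.rfl (forall_congr' fun v => imp_congr Iff.rfl ?_)
  refine (hcone v).trans ?_
  exact exists_congr fun j => and_congr Iff.rfl
    (by rw [← h.isHolChart.dif_coord h.mem_source j v]; rfl)

end Distinguished

end SemiStable

namespace SemiStable

/-! ### Real factors of the fibration -/

section Factors

variable {n : ℕ} {X : Type*} [TopologicalSpace X] [ChartedSpace (Model n) X]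
  [IsManifold 𝓘(ℂ, Model n) ω X] {π : ComplexDegeneration n X}
  {Φ : OpenPartialHomeomorph X (Model n)} {K : Finset (Fin n)} {p : X}

omit [IsManifold 𝓘(ℂ, Model n) ω X] in
theorem RealStructure.conjFn_prod (ι : RealStructure π) {J : Type*} (s : Finset J) (f : J → X → ℂ)
    (q : X) : ι.conjFn (fun q => ∏ j ∈ s, f j q) q = ∏ j ∈ s, ι.conjFn (f j) q := by
  simp [RealStructure.conjFn]

theorem dif_mul_of_eq_zero {f g : X → ℂ} (hf : HolNear n f p) (hg : HolNear n g p)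
    (h0 : f p = 0) : dif (n := n) p (fun q => f q * g q) = g p • dif p f := by
  rw [dif_mul hf hg, h0]
  ext v
  simp

/-- Total reality: the conjugate of a coordinate vanishing on the special fibre is not constant
to first order along the other components. -/
theorem exists_dif_conjFn_ne_zero {ι : RealStructure π} (hι : ι.IsTotallyReal)
    (hp : ι.inv p = p) (h : π.IsDistinguished Φ K p) (hp0 : π.fn p = 0) {i j : Fin n}
    (hj : j ∈ K) (hij : i ≠ j) :
    ∃ v : Model n, dif (n := n) p (fun q => Φ q j) v = 0 ∧
      dif (n := n) p (ι.conjFn fun q => Φ q i) v ≠ 0 := by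
  have hL : (kerDif (n := n) p fun q => Φ q j) ∈
      (tangentHyperplanes (n := n) (π.fibre (π.fn p)) p : Set (Submodule ℂ (Model n))) := by
    rw [h.tangentHyperplanes_eq]
    exact ⟨j, hj, rfl⟩
  rw [hp0] at hL
  have h1 := hι p hp hp0 _ hL
  obtain ⟨w, hw⟩ := h.isHolChart.exists_dif_eq_single h.mem_source i
  have hwL : w ∈ kerDif (n := n) p fun q => Φ q j := by
    rw [mem_kerDif, hw, Pi.single_eq_of_ne hij.symm]
  -- `w` points along the axis `i`, hence lies in the hyperplane `j`. Total reality says that the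
  -- differential of the involution maps this hyperplane onto itself, so `w` has a preimage there.
  obtain ⟨v, hv, hvw⟩ := h1.symm.subset hwL
  have hvw' : differentialAtFixedPoint (n := n) ι.inv p v = w := hvw
  refine ⟨v, hv, ?_⟩
  rw [dif_conjFn hp (h.isHolChart.holNear_coord h.mem_source i) (v : Model n), hvw', hw, Pi.single_eq_same]
  simp

/-- Total reality: the conjugate of a coordinate vanishing on the special fibre is a multiple of
that coordinate. -/
theorem exists_conjFn_eq_mul {ι : RealStructure π} (hι : ι.IsTotallyReal)
    (hp : ι.inv p = p) (h : π.IsDistinguished Φ K p) (hp0 : π.fn p = 0)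
    (hΦ0 : ∀ j ∈ K, Φ p j = 0) {j : Fin n} (hj : j ∈ K) :
    ∃ u : X → ℂ, HolNear n u p ∧ (ι.conjFn fun q => Φ q j) =ᶠ[𝓝 p] fun q => Φ q j * u q := by
  have hps := h.mem_source
  set G : Fin n → Model n → ℂ := fun i x => ι.conjFn (fun q => Φ q i) (Φ.symm x) with hG
  have hGd : ∀ i, ∀ᶠ x in 𝓝 (Φ p), DifferentiableAt ℂ (G i) x := fun i =>
    h.isHolChart.eventually_differentiableAt hps
      ((h.isHolChart.holNear_coord hps i).conjFn hp)
  -- `P` projects to the branch `j`. There the product of the conjugated coordinates equals `π`,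
  -- hence vanishes; since germs form a domain, some conjugated coordinate `i` vanishes on the
  -- branch. Total reality forces `i = j`, and the coordinate can be divided out.
  let P : Model n →L[ℂ] Model n := ContinuousLinearMap.pi fun i =>
    if i = j then 0 else ContinuousLinearMap.proj i
  have hP : ∀ x, P x = Function.update x j 0 := fun x => by
    funext i
    by_cases hi : i = j
    · subst hi; simp [P]
    · simp [P, hi]
  have hP1 : ∀ x : Model n, x j = 0 → P x = x := fun x hx => by
    rw [hP, ← hx, Function.update_eq_self]
  have hPp : P (Φ p) = Φ p := hP1 _ (hΦ0 j hj)
  have hPt : Tendsto P (𝓝 (Φ p)) (𝓝 (Φ p)) := by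
    have := P.continuous.tendsto (Φ p)
    rwa [hPp] at this
  have hprod : ∀ᶠ x in 𝓝 (Φ p), ∏ i ∈ K, G i (P x) = 0 := by
    have h1 : ∀ᶠ q in 𝓝 p, ι.inv q ∈ Φ.source :=
      (ι.tendsto_inv hp).eventually (Φ.open_source.mem_nhds hps)
    filter_upwards [hPt.eventually ((Φ.tendsto_symm hps).eventually h1),
      hPt.eventually (Φ.open_target.mem_nhds (Φ.map_source hps))] with x hx hxt
    have h2 : ∏ i ∈ K, G i (P x) = star (π.fn (ι.inv (Φ.symm (P x)))) := by
      rw [h.fn_eq _ hx]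
      simp [hG, RealStructure.conjFn]
    rw [h2, ι.conj_compat, star_star, h.fn_eq _ (Φ.map_target hxt), Φ.right_inv hxt]
    exact Finset.prod_eq_zero hj (by rw [hP, Function.update_self])
  obtain ⟨i, hi, hi0⟩ := exists_eventually_eq_zero_of_prod K (f := fun i x => G i (P x))
    (fun i _ => by
      filter_upwards [hPt.eventually (hGd i)] with x hx
      exact DifferentiableAt.comp (g := G i) x hx P.differentiableAt) hprod
  have hij : i = j := by
    by_contra hij
    obtain ⟨v, hv, hvi⟩ := exists_dif_conjFn_ne_zero hι hp h hp0 hj hij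
    refine hvi ?_
    rw [h.isHolChart.dif_eq hps ((h.isHolChart.holNear_coord hps i).conjFn hp)]
    rw [h.isHolChart.dif_coord hps] at hv
    have h1 : HasFDerivAt (fun x => G i (P x)) ((fderiv ℂ (G i) (Φ p)).comp P) (Φ p) := by
      refine HasFDerivAt.comp (g := G i) (Φ p) ?_ P.hasFDerivAt
      rw [hPp]
      exact (hGd i).self_of_nhds.hasFDerivAt
    have h2 := (h1.congr_of_eventuallyEq (f₁ := fun _ => (0 : ℂ))
      (hi0.mono fun x hx => hx.symm)).unique (hasFDerivAt_const _ _)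
    have h3 := DFunLike.congr_fun h2 (chartDeriv Φ p v)
    rw [ContinuousLinearMap.comp_apply, hP1 _ hv] at h3
    exact h3
  subst hij
  obtain ⟨u, hu, hGu⟩ := exists_eq_coord_mul (hΦ0 i hi) (hGd i) (by
    filter_upwards [hi0] with x hx hxi
    rwa [hP1 x hxi] at hx)
  refine ⟨fun q => u (Φ q), h.isHolChart.holNear_comp hps hu, ?_⟩
  filter_upwards [(Φ.continuousAt hps).eventually hGu, Φ.open_source.mem_nhds hps] with q hq hqs
  simpa [hG, Φ.left_inv hqs] using hq

/-- The fibration is, near a real point, a product of real functions which define the components of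
the fibre. -/
theorem exists_real_factors {ι : RealStructure π} (hι : ι.IsTotallyReal)
    (hp : ι.inv p = p) (h : π.IsDistinguished Φ K p) :
    ∃ w : Fin n → X → ℂ, (∀ j ∈ K, HolNear n (w j) p ∧ ι.conjFn (w j) =ᶠ[𝓝 p] w j ∧
      ∃ c : ℂ, c ≠ 0 ∧ dif (n := n) p (w j) = c • dif (n := n) p fun q => Φ q j) ∧
      π.fn =ᶠ[𝓝 p] fun q => ∏ j ∈ K, w j q := by
  classical
  have hps := h.mem_source
  have hΦh := h.isHolChart.holNear_coord hps
  rcases h.cases with ⟨j, rfl⟩ | ⟨hp0, hΦ0⟩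
  · have hfn : π.fn =ᶠ[𝓝 p] fun q => Φ q j := by
      filter_upwards [Φ.open_source.mem_nhds hps] with q hq
      rw [h.fn_eq q hq, Finset.prod_singleton]
    refine ⟨fun _ => π.fn, fun i hi => ⟨π.holNear_fn p, by rw [ι.conjFn_fn], 1, one_ne_zero, ?_⟩,
      by simp⟩
    rw [Finset.mem_singleton.1 hi, one_smul, dif_congr hfn]
  · have hex : ∀ j ∈ K, ∃ v : X → ℂ, HolNear n v p ∧ v p ≠ 0 ∧
        ∃ w : X → ℂ, HolNear n w p ∧ ι.conjFn w = w ∧ w =ᶠ[𝓝 p] fun q => Φ q j * v q := by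
      intro j hj
      obtain ⟨u, hu, hΦu⟩ := exists_conjFn_eq_mul hι hp h hp0 hΦ0 hj
      -- The real function `ι.realPart c` of coordinate `j` is this coordinate times `c + star c *
      -- u`. One of `c = 1` and `c = I` makes the second factor a unit: otherwise `u p` would be
      -- both `-1` and `1`.
      have hc : ∃ c : ℂ, c + star c * u p ≠ 0 := by
        by_contra! hcon
        have h1 := hcon 1
        have h2 := hcon Complex.I
        simp only [star_one, one_mul, RCLike.star_def, Complex.conj_I] at h1 h2
        have h3 : u p = -1 := by linear_combination h1
        rw [h3] at h2
        have h4 : (2 : ℂ) * Complex.I = 0 := by linear_combination h2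
        simp at h4
      obtain ⟨c, hc⟩ := hc
      refine ⟨fun q => c + star c * u q, (holNear_const c p).add ((holNear_const _ p).mul hu), hc,
        ι.realPart c fun q => Φ q j, (hΦh j).realPart hp c, ι.conjFn_realPart c _, ?_⟩
      filter_upwards [hΦu] with q hq
      rw [RealStructure.realPart, hq]
      ring
    choose! v hvh hv0 w hwh hwr hwv using hex
    have hdif : ∀ j ∈ K, dif (n := n) p (w j) = v j p • dif p fun q => Φ q j := fun j hj => by
      rw [dif_congr (hwv j hj), dif_mul_of_eq_zero (hΦh j) (hvh j hj) (hΦ0 j hj)]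
    have hdif0 : ∀ j, dif (n := n) p (fun q => Φ q j) ≠ 0 := fun j =>
      (h.isHolChart.linearIndependent_dif hps).ne_zero j
    obtain ⟨i, hi⟩ := h.nonempty
    -- The product of the `w j` is `π` only up to a unit, so one factor is redefined to absorb it.
    -- The new factor is real by cancellation: `π` and the product `P` of the others are real, and
    -- `P` is not the zero germ.
    let w' : X → ℂ := fun q => Φ q i * ∏ j ∈ K.erase i, (v j q)⁻¹
    have hvih : HolNear n (fun q => ∏ j ∈ K.erase i, (v j q)⁻¹) p :=
      HolNear.prod _ fun j hj => (hvh j (Finset.mem_of_mem_erase hj)).inv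
        (hv0 j (Finset.mem_of_mem_erase hj))
    have hw'h : HolNear n w' p := (hΦh i).mul hvih
    let P : X → ℂ := fun q => ∏ j ∈ K.erase i, w j q
    have hPh : HolNear n P p := HolNear.prod _ fun j hj => hwh j (Finset.mem_of_mem_erase hj)
    have hfn : π.fn =ᶠ[𝓝 p] fun q => w' q * P q := by
      have h1 : ∀ᶠ q in 𝓝 p, ∀ j ∈ K.erase i, v j q ≠ 0 ∧ w j q = Φ q j * v j q := by
        rw [Finset.eventually_all]
        exact fun j hj => ((hvh j (Finset.mem_of_mem_erase hj)).continuousAt.eventually_ne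
          (hv0 j (Finset.mem_of_mem_erase hj))).and (hwv j (Finset.mem_of_mem_erase hj))
      filter_upwards [h1, Φ.open_source.mem_nhds hps] with q hq hqs
      rw [h.fn_eq q hqs, ← Finset.mul_prod_erase K _ hi]
      simp only [w', P, mul_assoc, ← Finset.prod_mul_distrib]
      congr 1
      refine Finset.prod_congr rfl fun j hj => ?_
      rw [(hq j hj).2]
      field_simp [(hq j hj).1]
    have hreal : ι.conjFn w' =ᶠ[𝓝 p] w' := by
      have hPr : ι.conjFn P = P := by
        funext q
        refine (ι.conjFn_prod _ _ _).trans (Finset.prod_congr rfl fun j hj => ?_)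
        rw [hwr j (Finset.mem_of_mem_erase hj)]
      have h1 : ∀ᶠ q in 𝓝 p, P q * (ι.conjFn w' q + (-1) * w' q) = 0 := by
        have h2 := ι.conjFn_congr hp hfn
        rw [ι.conjFn_fn] at h2
        filter_upwards [h2, hfn] with q h3 h4
        have h5 : ι.conjFn (fun q => w' q * P q) q = ι.conjFn w' q * P q := by
          rw [← congrFun hPr q]
          simp [RealStructure.conjFn]
        rw [h5] at h3
        linear_combination h4 - h3
      have h2 : ¬ ∀ᶠ q in 𝓝 p, P q = 0 := fun hcon => by
        obtain ⟨j, hj, hj0⟩ := HolNear.exists_eq_zero_of_prod _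
          (fun j hj => hwh j (Finset.mem_of_mem_erase hj)) hcon
        have hjK := Finset.mem_of_mem_erase hj
        have h3 := dif_congr (n := n) (g := fun _ => (0 : ℂ)) hj0
        rw [dif_const, hdif j hjK] at h3
        exact (smul_ne_zero (hv0 j hjK) (hdif0 j)) h3
      filter_upwards [hPh.eq_zero_of_mul
        ((hw'h.conjFn hp).add ((holNear_const _ p).mul hw'h)) h1 h2] with q hq
      linear_combination hq
    refine ⟨Function.update w i w', fun j hj => ?_, ?_⟩
    · by_cases hji : j = i
      · subst hji
        rw [Function.update_self]
        refine ⟨hw'h, hreal, ∏ j ∈ K.erase j, (v j p)⁻¹, Finset.prod_ne_zero_iff.2 fun k hk =>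
          inv_ne_zero (hv0 k (Finset.mem_of_mem_erase hk)), ?_⟩
        rw [dif_mul_of_eq_zero (hΦh j) hvih (hΦ0 j hj)]
      · rw [Function.update_of_ne hji]
        exact ⟨hwh j hj, by rw [hwr j hj], v j p, hv0 j hj, hdif j hj⟩
    · filter_upwards [hfn] with q hq
      rw [hq, ← Finset.mul_prod_erase K _ hi, Function.update_self]
      congr 1
      refine Finset.prod_congr rfl fun j hj => ?_
      rw [Function.update_of_ne (Finset.ne_of_mem_erase hj)]

end Factors

end SemiStable

namespace SemiStable

/-! ### Real charts -/

section RealCharts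

variable {n : ℕ} {X : Type*} [TopologicalSpace X] [ChartedSpace (Model n) X]
  {π : ComplexDegeneration n X} {p : X}

/-- A holomorphic function near `p` which is real near `p`. -/
def RealNear (ι : RealStructure π) (f : X → ℂ) (p : X) : Prop :=
  HolNear n f p ∧ ι.conjFn f =ᶠ[𝓝 p] f

variable [IsManifold 𝓘(ℂ, Model n) ω X]

/-- Real equations for a real submanifold near a real point. -/
theorem exists_real_equations {ι : RealStructure π} {S : Set X} (hS : ι.IsRealSubmanifold S)
    (hp : ι.inv p = p) (hpS : p ∈ S) :
    ∃ (Θ : OpenPartialHomeomorph X (Model n)) (J : Finset (Fin n)), IsHolChart Θ ∧ p ∈ Θ.source ∧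
      (∀ j ∈ J, RealNear ι (fun q => Θ q j) p) ∧
      ∀ᶠ q in 𝓝 p, q ∈ S ↔ ∀ j ∈ J, Θ q j = 0 := by
  classical
  obtain ⟨φ, hφ, hps, hp0, d, hd⟩ := hS.1.2 p hpS
  have hφc := isHolChart_of_mem_maximalAtlas hφ
  -- Real combinations of the normal coordinates vanish on `S` because the involution preserves `S`.
  -- Their differentials and those of the tangential coordinates in `T'` span, so the tangential
  -- coordinates can be completed to a chart by elements of `T`.
  let T : Set (X → ℂ) := {f | ∃ j : Fin n, d ≤ j ∧ ∃ c : ℂ, f = ι.realPart c fun q => φ q j}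
  let T' : Set (X → ℂ) := range fun (j : {j : Fin n // (j : ℕ) < d}) q => φ q j
  have hli : LinearIndependent ℂ fun j : {j : Fin n // (j : ℕ) < d} =>
      dif (n := n) p fun q => φ q j :=
    (hφc.linearIndependent_dif hps).comp _ Subtype.val_injective
  have hT : Submodule.span ℂ (dif (n := n) p '' (T ∪ T')) = ⊤ := by
    rw [← top_le_iff, ← hφc.span_dif hps, Submodule.span_le]
    rintro _ ⟨j, rfl⟩
    by_cases hj : d ≤ j
    · change dif (n := n) p (fun q => φ q j) ∈ _
      rw [dif_eq_realPart hp (hφc.holNear_coord hps j)]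
      exact Submodule.add_mem _
        (Submodule.smul_mem _ _ (Submodule.subset_span ⟨_, Or.inl ⟨j, hj, 1, rfl⟩, rfl⟩))
        (Submodule.smul_mem _ _ (Submodule.subset_span ⟨_, Or.inl ⟨j, hj, _, rfl⟩, rfl⟩))
    · exact Submodule.subset_span ⟨_, Or.inr ⟨⟨j, not_le.1 hj⟩, rfl⟩, rfl⟩
  obtain ⟨g, ε, hε, hg, hgε, hgT⟩ := exists_germs_extending (n := n) (p := p)
    (f := fun (j : {j : Fin n // (j : ℕ) < d}) q => φ q j) hli hT
  have hgT' : ∀ j, j ∉ range ε → g j ∈ T := by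
    intro j hj
    rcases hgT j hj with h | ⟨i, hi⟩
    · exact h
    · refine absurd ⟨i, ?_⟩ hj
      refine hg.injective ?_
      rw [hgε, ← hi]
  have hreal : ∀ j, j ∉ range ε → RealNear ι (g j) p := fun j hj => by
    obtain ⟨i, -, c, h⟩ := hgT' j hj
    rw [h]
    exact ⟨(hφc.holNear_coord hps i).realPart hp c, by rw [ι.conjFn_realPart]⟩
  have hgh : ∀ j, HolNear n (g j) p := fun j => by
    by_cases hj : j ∈ range ε
    · obtain ⟨i, rfl⟩ := hj
      rw [hgε]
      exact hφc.holNear_coord hps i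
    · exact (hreal j hj).1
  have hgS : ∀ᶠ q in 𝓝 p, q ∈ S → ∀ j, j ∉ range ε → g j q = 0 := by
    filter_upwards [φ.open_source.mem_nhds hps,
      (ι.tendsto_inv hp).eventually (φ.open_source.mem_nhds hps)] with q hq hq' hqS j hj
    obtain ⟨i, hi, c, h⟩ := hgT' j hj
    rw [h, RealStructure.realPart, RealStructure.conjFn, (hd q hq).1 hqS i hi,
      (hd _ hq').1 (hS.2 hqS) i hi]
    simp
  obtain ⟨Θ, hΘ, hpΘ, -, hΘg⟩ := exists_holChart hgh hg univ_mem
  refine ⟨Θ, Finset.univ.filter fun j => j ∉ range ε, hΘ, hpΘ, fun j hj => ?_, ?_⟩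
  · obtain ⟨h1, h2⟩ := hreal j (Finset.mem_filter.1 hj).2
    have h3 : g j =ᶠ[𝓝 p] fun q => Θ q j := by
      filter_upwards [Θ.open_source.mem_nhds hpΘ] with q hq
      rw [hΘg q hq]
    exact ⟨h1.congr h3, ((ι.conjFn_congr hp h3).symm.trans h2).trans h3⟩
  -- Suppose the new equations vanish at `q`. Setting the normal coordinates of `q` to zero gives a
  -- point of `S` with the same image under `Θ`: the tangential coordinates are unchanged and the
  -- others vanish at both points. So this point is `q`.
  · let P : Model n → Model n := fun x i => if d ≤ i then 0 else x i
    have hPc : Continuous P := by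
      refine continuous_pi fun i => ?_
      by_cases hi : d ≤ (i : ℕ)
      · simpa [P, hi] using continuous_const
      · simpa [P, hi] using continuous_apply i
    have hPp : P (φ p) = φ p := by
      funext i
      simp [P, hp0]
    have ht : Tendsto (fun q => P (φ q)) (𝓝 p) (𝓝 (φ p)) := by
      have := (hPc.continuousAt (x := φ p)).tendsto.comp (φ.continuousAt hps)
      rwa [hPp] at this
    have ht' : Tendsto (fun q => φ.symm (P (φ q))) (𝓝 p) (𝓝 p) := (φ.tendsto_symm hps).comp ht
    filter_upwards [φ.open_source.mem_nhds hps, Θ.open_source.mem_nhds hpΘ, hgS,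
      ht.eventually (φ.open_target.mem_nhds (φ.map_source hps)), ht'.eventually hgS,
      ht'.eventually (Θ.open_source.mem_nhds hpΘ)] with q h1 h2 h3 h4 h5 h6
    constructor
    · intro hqS j hj
      rw [hΘg q h2, h3 hqS j (Finset.mem_filter.1 hj).2]
    · intro hq
      have hq'S : φ.symm (P (φ q)) ∈ S := by
        rw [hd _ (φ.map_target h4), φ.right_inv h4]
        intro j hj
        simp [P, hj]
      have heq : Θ (φ.symm (P (φ q))) = Θ q := by
        funext j
        by_cases hj : j ∈ range ε
        · obtain ⟨i, rfl⟩ := hj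
          rw [hΘg _ h6, hΘg _ h2, hgε]
          change φ (φ.symm (P (φ q))) i = φ q i
          rw [φ.right_inv h4]
          simp [P, not_le.2 i.2]
        · rw [hΘg _ h6, h5 hq'S j hj, hq j (by simpa using hj)]
      rw [← Θ.injOn h6 h2 heq]
      exact hq'S

/-- The tangent space of a submanifold given by coordinates. -/
theorem IsHolChart.tangentSubspace_eq {Θ : OpenPartialHomeomorph X (Model n)} (hΘ : IsHolChart Θ)
    (hp : p ∈ Θ.source) {J : Finset (Fin n)} {S : Set X} (hpS : p ∈ S)
    (hJ : ∀ᶠ q in 𝓝 p, q ∈ S ↔ ∀ j ∈ J, Θ q j = 0) :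
    (tangentSubspace (n := n) S p : Submodule ℂ (Model n)) =
      ⨅ j : J, kerDif (n := n) p fun q => Θ q j := by
  have hN : IsClosed {v : Model n | ∀ j ∈ J, v j = 0} := by
    simp only [ofPred_forall]
    exact isClosed_biInter fun j _ => isClosed_eq (continuous_apply j) continuous_const
  have hp0 := hJ.self_of_nhds.1 hpS
  have hcone := hΘ.mem_tangentCone_iff hp hN
    (fun c v hv j hj => by simp [hv j hj]) (A := S) (by
      filter_upwards [hJ] with q hq
      rw [hq]
      exact forall_congr' fun j => imp_congr_right fun hj => by
        rw [Pi.sub_apply, hp0 j hj, sub_zero])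
  have hmem : ∀ v : Model n, v ∈ (⨅ j : J, kerDif (n := n) p fun q => Θ q j) ↔
      chartDeriv Θ p v ∈ {v : Model n | ∀ j ∈ J, v j = 0} := fun v => by
    rw [Submodule.mem_iInf]
    constructor
    · intro h j hj
      rw [← hΘ.dif_coord hp]
      exact h ⟨j, hj⟩
    · intro h j
      rw [mem_kerDif, hΘ.dif_coord hp]
      exact h j j.2
  have hset : (tangentCone (n := n) S p : Set (Model n)) =
      ((⨅ j : J, kerDif (n := n) p fun q => Θ q j : Submodule ℂ (Model n)) : Set (Model n)) :=
    Set.ext fun (v : Model n) => (hcone v).trans (hmem v).symm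
  refine (congrArg (Submodule.span ℂ) hset).trans ?_
  exact Submodule.span_eq _

theorem IsHolChart.finrank_quotient_iInf_kerDif {Θ : OpenPartialHomeomorph X (Model n)}
    (hΘ : IsHolChart Θ) (hp : p ∈ Θ.source) (J : Finset (Fin n)) :
    Module.finrank ℂ (Model n ⧸ ⨅ j : J, kerDif (n := n) p fun q => Θ q j) = Fintype.card J := by
  classical
  refine finrank_quotient_iInf_ker
    (l := fun j : J => (dif (n := n) p (fun q => Θ q j) : Model n →ₗ[ℂ] ℂ)) fun y => ?_
  obtain ⟨v, hv⟩ := hΘ.exists_dif_eq hp fun j => if h : j ∈ J then y ⟨j, h⟩ else 0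
  refine ⟨v, funext fun j => ?_⟩
  exact (hv j).trans (by simp)

/-- A chart adapted to the real structure, the fibration and the submanifolds `S i`. -/
structure IsRealChart (ι : RealStructure π) {m : ℕ} (S : Fin m → Set X)
    (Ψ : OpenPartialHomeomorph X (Model n)) (K : Finset (Fin n)) : Prop where
  isHolChart : IsHolChart Ψ
  nonempty : K.Nonempty
  inv_mem : ∀ q ∈ Ψ.source, ι.inv q ∈ Ψ.source
  map_inv : ∀ q ∈ Ψ.source, Ψ (ι.inv q) = star (Ψ q)
  fn_eq : ∀ q ∈ Ψ.source, π.fn q = ∏ j ∈ K, Ψ q j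
  sat : ∀ i, ∀ q ∈ Ψ.source, ∀ q' ∈ Ψ.source, (∀ j, j ∉ K → Ψ q j = Ψ q' j) → q ∈ S i → q' ∈ S i

theorem span_dif_realNear {ι : RealStructure π} (hp : ι.inv p = p) :
    Submodule.span ℂ (dif (n := n) p '' {f | RealNear ι f p}) = ⊤ := by
  have hκ := isHolChart_chartAt (n := n) p
  have hκs := mem_chart_source (Model n) p
  rw [← top_le_iff, ← hκ.span_dif hκs, Submodule.span_le]
  rintro _ ⟨j, rfl⟩
  have hj := hκ.holNear_coord hκs j
  have hr : ∀ c, RealNear ι (ι.realPart c fun q => chartAt (Model n) p q j) p := fun c =>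
    ⟨hj.realPart hp c, by rw [ι.conjFn_realPart]⟩
  change dif (n := n) p (fun q => chartAt (Model n) p q j) ∈ _
  rw [dif_eq_realPart hp hj]
  exact Submodule.add_mem _
    (Submodule.smul_mem _ _ (Submodule.subset_span ⟨_, hr _, rfl⟩))
    (Submodule.smul_mem _ _ (Submodule.subset_span ⟨_, hr _, rfl⟩))

/-- Independence of the equations of a transversal collection. -/
theorem linearIndependent_of_isTransversal {m : ℕ} {S : Fin m → Set X}
    (hT : π.IsTransversal S) {Φ : OpenPartialHomeomorph X (Model n)} {K : Finset (Fin n)}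
    (hΦ : π.IsDistinguished Φ K p) {w : Fin n → X → ℂ}
    (hw : ∀ j ∈ K, ∃ c : ℂ, c ≠ 0 ∧ dif (n := n) p (w j) = c • dif (n := n) p fun q => Φ q j)
    {Θ : {i // p ∈ S i} → OpenPartialHomeomorph X (Model n)} {J : {i // p ∈ S i} → Finset (Fin n)}
    (hΘ : ∀ i, IsHolChart (Θ i)) (hpΘ : ∀ i, p ∈ (Θ i).source)
    (hJ : ∀ i : {i // p ∈ S i}, ∀ᶠ q in 𝓝 p, q ∈ S i ↔ ∀ j ∈ J i, Θ i q j = 0) :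
    LinearIndependent ℂ fun x : Σ a, (Sum.elim (fun j : K => {j.1}) J a : Finset (Fin n)) =>
      dif (n := n) p (Sum.elim (fun _ : K => w) (fun i j q => Θ i q j) x.1 x.2) := by
  classical
  -- The branches of the fibre, with one equation each, are put on the same footing as the
  -- submanifolds.
  let F : K ⊕ {i // p ∈ S i} → Fin n → X → ℂ := Sum.elim (fun _ => w) fun i j q => Θ i q j
  let J' : K ⊕ {i // p ∈ S i} → Finset (Fin n) := Sum.elim (fun j => {j.1}) J
  let T : {i // p ∈ S i} → Submodule ℂ (Model n) := fun i => tangentSubspace (n := n) (S i) p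
  let V : K ⊕ {i // p ∈ S i} → Submodule ℂ (Model n) :=
    Sum.elim (fun j => kerDif p fun q => Φ q j) T
  have htan : ∀ i, T i = ⨅ j : J i, kerDif (n := n) p fun q => Θ i q j := fun i =>
    (hΘ i).tangentSubspace_eq (hpΘ i) i.2 (hJ i)
  have hV : ∀ a, V a = ⨅ j : J' a,
      LinearMap.ker (dif (n := n) p (F a j) : Model n →ₗ[ℂ] ℂ) := by
    rintro (j | i)
    · obtain ⟨c, hc, hcw⟩ := hw j j.2
      change kerDif (n := n) p (fun q => Φ q j) = ⨅ x : ({j.1} : Finset (Fin n)), kerDif p (w x)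
      ext v
      simp [mem_kerDif, hcw, hc]
    · exact htan i
  have hrank : ∀ a, Module.finrank ℂ (Model n ⧸ V a) = Fintype.card (J' a) := by
    rintro (j | i)
    · refine (finrank_quotient_ker fun h0 => (hΦ.isHolChart.linearIndependent_dif
        hΦ.mem_source).ne_zero j.1 (ContinuousLinearMap.coe_injective h0)).trans ?_
      simp [J']
    · change Module.finrank ℂ (Model n ⧸ T i) = Fintype.card (J i)
      rw [htan i]
      exact (hΘ i).finrank_quotient_iInf_kerDif (hpΘ i) (J i)
  have hcodim : Module.finrank ℂ (Model n ⧸ ⨅ a, V a) =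
      ∑ a, Module.finrank ℂ (Model n ⧸ V a) := by
    let H : Set (Submodule ℂ (Model n)) := tangentHyperplanes (n := n) (π.fibre (π.fn p)) p
    have hH : H = (fun j => kerDif (n := n) p fun q => Φ q j) '' K := hΦ.tangentHyperplanes_eq
    have h1 : Module.finrank ℂ (Model n ⧸ (⨅ L ∈ H, L) ⊓ ⨅ i, T i) =
        H.ncard + ∑ᶠ i, Module.finrank ℂ (Model n ⧸ T i) := hT p
    have h2 : (⨅ L ∈ H, L) = ⨅ j : K, kerDif (n := n) p fun q => Φ q j := by
      rw [hH, iInf_image, iInf_subtype]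
      rfl
    -- Distinct coordinates define distinct hyperplanes, so the number of hyperplanes is the sum of
    -- their codimensions.
    have h3 : H.ncard = K.card := by
      rw [hH, ncard_image_of_injective _ (hΦ.isHolChart.kerDif_injective hΦ.mem_source),
        ncard_coe_finset]
    have h4 : ∑ j : K, Module.finrank ℂ (Model n ⧸ V (Sum.inl j)) = K.card := by
      rw [Finset.sum_congr rfl fun j _ => hrank (Sum.inl j)]
      simp [J']
    rw [iInf_sum, Fintype.sum_sum_type, h4, ← h3]
    rw [finsum_eq_sum_of_fintype, h2] at h1
    exact h1
  have hli := linearIndependent_of_finrank_quotient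
    (fun a (j : J' a) => (dif (n := n) p (F a j) : Model n →ₗ[ℂ] ℂ)) V hV
    (fun a => (hrank a).symm) hcodim
  exact LinearIndependent.of_comp (ContinuousLinearMap.coeLM ℂ) hli

/-- Real charts exist at real points. -/
theorem exists_isRealChart {ι : RealStructure π} (hι : ι.IsTotallyReal) {m : ℕ}
    {S : Fin m → Set X} (hS : ∀ i, ι.IsRealSubmanifold (S i)) (hT : π.IsTransversal S)
    (hp : ι.inv p = p) : ∃ Ψ K, p ∈ Ψ.source ∧ IsRealChart ι S Ψ K := by
  classical
  obtain ⟨Φ, K, hΦ⟩ := π.exists_isDistinguished p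
  obtain ⟨w, hw, hfn⟩ := exists_real_factors hι hp hΦ
  have hex := fun i : {i // p ∈ S i} => exists_real_equations (hS i) hp i.2
  choose Θ J hΘ hpΘ hΘr hJ using hex
  have hli := linearIndependent_of_isTransversal hT hΦ (fun j hj => (hw j hj).2.2) hΘ hpΘ hJ
  obtain ⟨g, ε, hε, hg, hgε, hgT⟩ := exists_germs_extending hli (span_dif_realNear hp)
  have hgr : ∀ j, RealNear ι (g j) p := fun j => by
    by_cases hj : j ∈ range ε
    · obtain ⟨⟨k | i, j⟩, rfl⟩ := hj
      · rw [hgε]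
        have hj : (j : Fin n) ∈ K := by
          rw [Finset.mem_singleton.1 j.2]
          exact k.2
        exact ⟨(hw j hj).1, (hw j hj).2.1⟩
      · rw [hgε]
        exact hΘr i j j.2
    · exact hgT j hj
  -- The chart is cut down to where all identities of germs hold. Submanifolds not through `p` are
  -- avoided, which is possible as they are closed.
  have hN : ∀ᶠ q in 𝓝 p, (∀ j, ι.conjFn (g j) q = g j q) ∧ π.fn q = ∏ j ∈ K, w j q ∧
      (∀ i : {i // p ∈ S i}, q ∈ S i ↔ ∀ j ∈ J i, Θ i q j = 0) ∧
      ∀ i : {i // p ∉ S i}, q ∉ S i :=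
    (eventually_all.2 fun j => (hgr j).2).and (hfn.and ((eventually_all.2 hJ).and
      (eventually_all.2 fun i => (hS i).1.1.isOpen_compl.mem_nhds i.2)))
  obtain ⟨Ψ, hΨ, hpΨ, hΨN, hΨg⟩ := exists_holChart (fun j => (hgr j).1) hg hN
  -- Intersecting the domain with its conjugate makes it invariant under the involution.
  let U : Set X := ι.inv ⁻¹' Ψ.source
  have hU : IsOpen U := Ψ.open_source.preimage ι.continuous_inv
  have hsrc : (Ψ.restrOpen U hU).source = Ψ.source ∩ U := Ψ.restrOpen_source U hU
  have hcoe : ∀ q, Ψ.restrOpen U hU q = Ψ q := fun q => rfl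
  let K' : Finset (Fin n) := Finset.univ.image fun j : K => ε ⟨Sum.inl j, ⟨j, Finset.mem_singleton_self _⟩⟩
  refine ⟨Ψ.restrOpen U hU, K', ?_, ⟨hΨ.1.mono ?_, ?_⟩, ?_, ?_, ?_, ?_, ?_⟩
  · rw [hsrc]
    exact ⟨hpΨ, by rw [mem_preimage, hp]; exact hpΨ⟩
  · rw [hsrc]
    exact inter_subset_left
  · refine hΨ.2.mono fun x hx => ?_
    have := (Ψ.restrOpen U hU).map_target hx
    rw [hsrc] at this
    have h2 := Ψ.map_source this.1
    have h3 := (Ψ.restrOpen U hU).right_inv hx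
    rw [hcoe] at h3
    rwa [h3] at h2
  · obtain ⟨j, hj⟩ := hΦ.nonempty
    exact ⟨_, Finset.mem_image_of_mem _ (Finset.mem_univ ⟨j, hj⟩)⟩
  · intro q hq
    rw [hsrc] at hq ⊢
    exact ⟨hq.2, by rw [mem_preimage, ι.involutive]; exact hq.1⟩
  · intro q hq
    rw [hsrc] at hq
    funext j
    rw [hcoe, hcoe, hΨg _ hq.2, Pi.star_apply, hΨg _ hq.1, ← (hΨN hq.1).1 j]
    simp [RealStructure.conjFn]
  · intro q hq
    rw [hsrc] at hq
    rw [(hΨN hq.1).2.1, Finset.prod_image fun j _ j' _ h => Sum.inl_injective (congrArg Sigma.fst (hε h)),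
      ← Finset.prod_coe_sort K]
    refine Finset.prod_congr rfl fun j _ => ?_
    rw [hcoe, hΨg _ hq.1, hgε]
    rfl
  · intro i q hq q' hq' h hqi
    rw [hsrc] at hq hq'
    by_cases hi : p ∈ S i
    -- The equations of `S i` are themselves coordinates, with indices outside `K'` because `ε` is
    -- injective.
    · refine ((hΨN hq'.1).2.2.1 ⟨i, hi⟩).2 fun j hj => ?_
      have h1 := ((hΨN hq.1).2.2.1 ⟨i, hi⟩).1 hqi j hj
      have h2 := h (ε ⟨Sum.inr ⟨i, hi⟩, ⟨j, hj⟩⟩) (by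
        rw [Finset.mem_image]
        rintro ⟨j', -, hj'⟩
        cases congrArg Sigma.fst (hε hj'))
      rw [hcoe, hcoe, hΨg _ hq.1, hΨg _ hq'.1, hgε] at h2
      exact h2.symm.trans h1
    · exact absurd hqi ((hΨN hq.1).2.2.2 ⟨i, hi⟩)

end RealCharts

end SemiStable

namespace SemiStable

/-! ### Phases -/

theorem isEmbedding_circle_coe : IsEmbedding ((↑) : Circle → ℂ) := IsEmbedding.subtypeVal

theorem circle_coe_prod {J : Type*} (s : Finset J) (θ : J → Circle) :
    ((∏ j ∈ s, θ j : Circle) : ℂ) = ∏ j ∈ s, (θ j : ℂ) := map_prod Circle.coeHom θ s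

section Phases

variable {n : ℕ} {X : Type*} [TopologicalSpace X] [ChartedSpace (Model n) X] {S D : Set X}

theorem HolNear.mem_logMonoid {p : X} {f : X → ℂ} (hf : HolNear n f p) (h0 : f p ≠ 0) :
    f ∈ logMonoid n S D p :=
  ⟨hf, (hf.continuousAt.eventually_ne h0).filter_mono nhdsWithin_le_nhds |>.mono fun _ h _ => h⟩

theorem eventually_mem_logMonoid {p : X} {f : X → ℂ} (hf : f ∈ logMonoid n univ D p) :
    ∀ᶠ q in 𝓝 p, f ∈ logMonoid n univ D q := by
  obtain ⟨h1, h2⟩ := hf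
  rw [nhdsWithin_univ] at h2
  filter_upwards [eventually_eventually_nhds.2 h1, eventually_eventually_nhds.2 h2] with q h3 h4
  exact ⟨h3, by rwa [nhdsWithin_univ]⟩

open Classical in
/-- The phase of an arbitrary function; it is `1` where the phase is not defined. -/
noncomputable def Blowup.ph (y : Blowup n S D) (f : X → ℂ) : Circle :=
  if h : f ∈ logMonoid n S D y.pt then y.phase ⟨f, h⟩ else 1

theorem Blowup.ph_eq (y : Blowup n S D) {f : X → ℂ} (h : f ∈ logMonoid n S D y.pt) :
    y.ph f = y.phase ⟨f, h⟩ := dif_pos h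

theorem Blowup.ext_ph {y y' : Blowup n S D} (hpt : y.pt = y'.pt)
    (h : ∀ f ∈ logMonoid n S D y.pt, y.ph f = y'.ph f) : y = y' := by
  rcases y with ⟨q, hq, φ, h1, h2⟩
  rcases y' with ⟨q', hq', φ', h1', h2'⟩
  obtain rfl : q = q' := hpt
  congr
  ext ⟨f, hf⟩ : 1
  have := h f hf
  rwa [Blowup.ph_eq _ hf, Blowup.ph_eq _ hf] at this

theorem Blowup.ph_congr (y : Blowup n S D) {f g : X → ℂ} (hf : f ∈ logMonoid n S D y.pt)
    (hg : g ∈ logMonoid n S D y.pt) (h : f =ᶠ[𝓝 y.pt] g) : y.ph f = y.ph g := by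
  rw [y.ph_eq hf, y.ph_eq hg]
  exact y.phase_congr _ _ (h.filter_mono nhdsWithin_le_nhds)

theorem Blowup.ph_mul (y : Blowup n S D) {f g : X → ℂ} (hf : f ∈ logMonoid n S D y.pt)
    (hg : g ∈ logMonoid n S D y.pt) : y.ph (f * g) = y.ph f * y.ph g := by
  rw [y.ph_eq hf, y.ph_eq hg, y.ph_eq (mul_mem hf hg), ← map_mul]
  rfl

theorem Blowup.ph_prod (y : Blowup n S D) {J : Type*} (s : Finset J) {f : J → X → ℂ}
    (hf : ∀ j ∈ s, f j ∈ logMonoid n S D y.pt) (a : J → ℕ) :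
    y.ph (∏ j ∈ s, f j ^ a j) = ∏ j ∈ s, y.ph (f j) ^ a j := by
  classical
  have hpow : ∀ (g : X → ℂ) (b : ℕ), g ∈ logMonoid n S D y.pt → y.ph (g ^ b) = y.ph g ^ b := by
    intro g b hg
    rw [y.ph_eq hg, y.ph_eq (pow_mem hg b), ← map_pow]
    rfl
  induction s using Finset.induction_on with
  | empty =>
    rw [Finset.prod_empty, Finset.prod_empty, y.ph_eq (one_mem _)]
    exact map_one y.phase
  | insert i s hi ih =>
    have h1 := hf i (Finset.mem_insert_self _ _)
    have h2 : ∀ j ∈ s, f j ∈ logMonoid n S D y.pt := fun j hj =>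
      hf j (Finset.mem_insert_of_mem hj)
    rw [Finset.prod_insert hi, Finset.prod_insert hi,
      y.ph_mul (pow_mem h1 _) (prod_mem fun j hj => pow_mem (h2 j hj) _), ih h2, hpow _ _ h1]

theorem Blowup.ph_unit (y : Blowup n S D) {f : X → ℂ} (hf : HolNear n f y.pt) (h0 : f y.pt ≠ 0) :
    (y.ph f : ℂ) = f y.pt / (‖f y.pt‖ : ℝ) := by
  rw [y.ph_eq (hf.mem_logMonoid h0)]
  exact y.phase_unit _ h0

theorem Blowup.eq_ph_mul_norm (y : Blowup n S D) {f : X → ℂ} (hf : HolNear n f y.pt) :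
    f y.pt = y.ph f * (‖f y.pt‖ : ℝ) := by
  by_cases h0 : f y.pt = 0
  · simp [h0]
  · rw [y.ph_unit hf h0, div_mul_cancel₀]
    exact_mod_cast norm_ne_zero_iff.2 h0

theorem Blowup.ph_incl (y : Blowup n S D) {f : X → ℂ} (hf : f ∈ logMonoid n univ D y.pt) :
    y.incl.ph f = y.ph f := by
  rw [y.ph_eq (logMonoid_univ_le S D y.pt hf)]
  exact y.incl.ph_eq hf

theorem Blowup.ph_conj {π : ComplexDegeneration n X} (ι : RealStructure π)
    (hS : MapsTo ι.inv S S) (y : Blowup n S (π.fibre 0)) {f : X → ℂ}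
    (hf : f ∈ logMonoid n S (π.fibre 0) (ι.inv y.pt)) :
    (y.conj ι hS).ph f = (y.ph (ι.conjFn f))⁻¹ := by
  rw [(y.conj ι hS).ph_eq hf]
  exact congrArg (·⁻¹) (y.ph_eq (star_comp_mem_logMonoid ι hS hf)).symm

theorem Blowup.continuous_pt : Continuous fun y : Blowup n S D => y.pt :=
  continuous_def.2 fun U hU => TopologicalSpace.isOpen_generateFrom_of_mem
    (Or.inl ⟨U, hU, rfl⟩)

theorem Blowup.continuousOn_ph {U : Set X} (hU : IsOpen U) {f : X → ℂ}
    (hf : ∀ q ∈ U, f ∈ logMonoid n S D q) :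
    ContinuousOn (fun y : Blowup n S D => y.ph f) {y | y.pt ∈ U} := by
  have hU' : IsOpen {y : Blowup n S D | y.pt ∈ U} := hU.preimage Blowup.continuous_pt
  rw [continuousOn_open_iff hU']
  intro V hV
  refine TopologicalSpace.isOpen_generateFrom_of_mem (Or.inr ⟨U, f, hf, V, hU, hV, ?_⟩)
  ext y
  constructor
  · rintro ⟨h1, h2⟩
    refine ⟨h1, ?_⟩
    rwa [mem_preimage, y.ph_eq (hf _ h1)] at h2
  · rintro ⟨h1, h2⟩
    refine ⟨h1, ?_⟩
    rwa [mem_preimage, y.ph_eq (hf _ h1)]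

theorem Blowup.continuousAt_ph {f : X → ℂ} {y : Blowup n univ D}
    (hf : f ∈ logMonoid n univ D y.pt) : ContinuousAt (fun y : Blowup n univ D => y.ph f) y := by
  obtain ⟨U, hU, hUo, hyU⟩ := _root_.mem_nhds_iff.1 (eventually_mem_logMonoid hf)
  exact (Blowup.continuousOn_ph hUo fun q hq => hU hq).continuousAt
    ((hUo.preimage Blowup.continuous_pt).mem_nhds hyU)

instance [T2Space X] : T2Space (Blowup n (univ : Set X) D) := by
  refine ⟨fun y y' hne => ?_⟩
  by_cases hpt : y.pt = y'.pt
  · have hex : ∃ f ∈ logMonoid n univ D y.pt, y.ph f ≠ y'.ph f := by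
      by_contra! hcon
      exact hne (Blowup.ext_ph hpt hcon)
    obtain ⟨f, hf, hfne⟩ := hex
    obtain ⟨A, B, hA, hB, hyA, hyB, hAB⟩ := t2_separation hfne
    obtain ⟨U, hU, hUo, hyU⟩ := _root_.mem_nhds_iff.1 (eventually_mem_logMonoid hf)
    have hc := Blowup.continuousOn_ph (S := univ) hUo fun q hq => hU hq
    have hU' : IsOpen {y : Blowup n univ D | y.pt ∈ U} := hUo.preimage Blowup.continuous_pt
    refine ⟨_, _, hc.isOpen_inter_preimage hU' hA, hc.isOpen_inter_preimage hU' hB,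
      ⟨hyU, hyA⟩, ⟨show y'.pt ∈ U from hpt ▸ hyU, hyB⟩, ?_⟩
    rw [Set.disjoint_left]
    rintro z ⟨-, h1⟩ ⟨-, h2⟩
    exact Set.disjoint_left.1 hAB h1 h2
  · obtain ⟨A, B, hA, hB, hyA, hyB, hAB⟩ := t2_separation hpt
    exact ⟨_, _, hA.preimage Blowup.continuous_pt, hB.preimage Blowup.continuous_pt, hyA, hyB,
      hAB.preimage _⟩

end Phases

/-! ### Phases in charts -/

section ChartPhases

variable {n : ℕ} {X : Type*} [TopologicalSpace X] [ChartedSpace (Model n) X]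
  {π : ComplexDegeneration n X} {Ψ : OpenPartialHomeomorph X (Model n)} {K : Finset (Fin n)}

theorem IsHolChart.coord_mem_logMonoid (hΨ : IsHolChart Ψ)
    (hfn : ∀ q ∈ Ψ.source, π.fn q = ∏ j ∈ K, Ψ q j) (S : Set X) {q : X} (hq : q ∈ Ψ.source)
    {j : Fin n} (hj : j ∈ K) : (fun x => Ψ x j) ∈ logMonoid n S (π.fibre 0) q := by
  refine ⟨hΨ.holNear_coord hq j, ?_⟩
  filter_upwards [nhdsWithin_le_nhds (Ψ.open_source.mem_nhds hq)] with x hx hxD h0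
  exact hxD ((hfn x hx).trans (Finset.prod_eq_zero hj h0))

/-- In the chart the divisor is the union of the hyperplanes with index in `K`, so
`exists_unit_mul_monomial` applies. It does not require the coordinates in `K` to vanish at `q`. -/
theorem IsHolChart.exists_factorization (hΨ : IsHolChart Ψ)
    (hfn : ∀ q ∈ Ψ.source, π.fn q = ∏ j ∈ K, Ψ q j) {q : X} (hq : q ∈ Ψ.source) {f : X → ℂ}
    (hf : f ∈ logMonoid n univ (π.fibre 0) q) :
    ∃ (a : Fin n → ℕ) (u : X → ℂ), HolNear n u q ∧ u q ≠ 0 ∧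
      f =ᶠ[𝓝 q] u * ∏ j ∈ K, (fun x => Ψ x j) ^ a j := by
  obtain ⟨h1, h2⟩ := hf
  rw [nhdsWithin_univ] at h2
  have h3 : ∀ᶠ z in 𝓝 (Ψ q), (∀ j ∈ K, z j ≠ 0) → (f ∘ Ψ.symm) z ≠ 0 := by
    filter_upwards [(Ψ.tendsto_symm hq).eventually h2,
      Ψ.open_target.mem_nhds (Ψ.map_source hq)] with z hz hzt hzK
    refine hz fun hzD => ?_
    have h4 : π.fn (Ψ.symm z) = 0 := hzD
    rw [hfn _ (Ψ.map_target hzt), Finset.prod_eq_zero_iff] at h4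
    obtain ⟨j, hj, hj0⟩ := h4
    rw [Ψ.right_inv hzt] at hj0
    exact hzK j hj hj0
  obtain ⟨a, u, hu, hu0, hfu⟩ := exists_unit_mul_monomial K
    (hΨ.eventually_differentiableAt hq h1) h3
  refine ⟨a, fun x => u (Ψ x), hΨ.holNear_comp hq hu, hu0, ?_⟩
  filter_upwards [(Ψ.continuousAt hq).eventually hfu, Ψ.open_source.mem_nhds hq] with x hx hxs
  simpa [Ψ.left_inv hxs] using hx

/-- The phase of a unit is prescribed, so all phases at a point are determined by those of finitely
many coordinates. This gives the blow-up its local product structure. -/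
theorem IsHolChart.ph_eq_of_factorization (hΨ : IsHolChart Ψ)
    (hfn : ∀ q ∈ Ψ.source, π.fn q = ∏ j ∈ K, Ψ q j) (y : Blowup n univ (π.fibre 0))
    (hy : y.pt ∈ Ψ.source) {f : X → ℂ} (hf : f ∈ logMonoid n univ (π.fibre 0) y.pt)
    {a : Fin n → ℕ} {u : X → ℂ} (hu : HolNear n u y.pt) (hu0 : u y.pt ≠ 0)
    (hfu : f =ᶠ[𝓝 y.pt] u * ∏ j ∈ K, (fun x => Ψ x j) ^ a j) :
    (y.ph f : ℂ) = u y.pt / (‖u y.pt‖ : ℝ) * ∏ j ∈ K, (y.ph fun x => Ψ x j : ℂ) ^ a j := by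
  have hK : ∀ j ∈ K, (fun x => Ψ x j) ∈ logMonoid n univ (π.fibre 0) y.pt := fun j hj =>
    hΨ.coord_mem_logMonoid hfn univ hy hj
  have hK' := prod_mem fun j hj => pow_mem (hK j hj) (a j)
  have hum : u ∈ logMonoid n univ (π.fibre 0) y.pt := hu.mem_logMonoid hu0
  rw [y.ph_congr hf (mul_mem hum hK') hfu, y.ph_mul hum hK', y.ph_prod K hK, Circle.coe_mul,
    y.ph_unit hu hu0]
  congr 1
  rw [circle_coe_prod]
  simp

/-- A point of the blow-up is determined by the phases of coordinates. -/
theorem IsHolChart.blowup_ext (hΨ : IsHolChart Ψ)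
    (hfn : ∀ q ∈ Ψ.source, π.fn q = ∏ j ∈ K, Ψ q j) {y y' : Blowup n univ (π.fibre 0)}
    (hpt : y.pt = y'.pt) (hy : y.pt ∈ Ψ.source)
    (h : ∀ j ∈ K, (y.ph fun x => Ψ x j) = y'.ph fun x => Ψ x j) : y = y' := by
  refine Blowup.ext_ph hpt fun f hf => ?_
  obtain ⟨a, u, hu, hu0, hfu⟩ := hΨ.exists_factorization hfn hy hf
  have h1 := hΨ.ph_eq_of_factorization hfn y hy hf hu hu0 hfu
  have h2 := hΨ.ph_eq_of_factorization hfn y' (hpt ▸ hy) (hpt ▸ hf) (hpt ▸ hu) (hpt ▸ hu0)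
    (hpt ▸ hfu)
  ext
  rw [h1, h2, hpt]
  congr 1
  exact Finset.prod_congr rfl fun j hj => by rw [h j hj]

/-- Convergence in the blow-up is convergence of the point and of the phases of coordinates. -/
theorem IsHolChart.tendsto_blowup (hΨ : IsHolChart Ψ)
    (hfn : ∀ q ∈ Ψ.source, π.fn q = ∏ j ∈ K, Ψ q j) {α : Type*} {l : Filter α}
    {Y : α → Blowup n univ (π.fibre 0)} {y : Blowup n univ (π.fibre 0)} (hy : y.pt ∈ Ψ.source)
    (hpt : Tendsto (fun a => (Y a).pt) l (𝓝 y.pt))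
    (hph : ∀ j ∈ K, Tendsto (fun a => (Y a).ph fun x => Ψ x j) l (𝓝 (y.ph fun x => Ψ x j))) :
    Tendsto Y l (𝓝 y) := by
  rw [TopologicalSpace.tendsto_nhds_generateFrom_iff]
  rintro s (⟨U, hU, rfl⟩ | ⟨U, f, hf, V, hU, hV, rfl⟩) hys
  · exact hpt (hU.mem_nhds hys)
  · obtain ⟨hyU, hyV⟩ := hys
    rw [← Blowup.ph_eq] at hyV
    have hfm : ∀ x (h : x ∈ U), f ∈ logMonoid n univ (π.fibre 0) x := hf
    obtain ⟨a, u, hu, hu0, hfu⟩ := hΨ.exists_factorization hfn hy (hf _ hyU)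
    -- The factorization found at `y.pt` holds near it, so the same unit and exponents compute the
    -- phase of `f` at all nearby points.
    have hev : ∀ᶠ x in 𝓝 y.pt, x ∈ U ∧ x ∈ Ψ.source ∧ HolNear n u x ∧ u x ≠ 0 ∧
        f =ᶠ[𝓝 x] u * ∏ j ∈ K, (fun x => Ψ x j) ^ a j :=
      (hU.eventually_mem hyU).and ((Ψ.open_source.eventually_mem hy).and (hu.eventually.and
        ((hu.continuousAt.eventually_ne hu0).and hfu.eventuallyEq_nhds)))
    have hlim : Tendsto (fun b => ((Y b).ph f : ℂ)) l (𝓝 (y.ph f)) := by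
      rw [hΨ.ph_eq_of_factorization hfn y hy (hf _ hyU) hu hu0 hfu]
      have h1 : Tendsto (fun b => u (Y b).pt) l (𝓝 (u y.pt)) := hu.continuousAt.tendsto.comp hpt
      have h2 : Tendsto (fun b => u (Y b).pt / (‖u (Y b).pt‖ : ℝ) *
          ∏ j ∈ K, ((Y b).ph fun x => Ψ x j : ℂ) ^ a j) l
          (𝓝 (u y.pt / (‖u y.pt‖ : ℝ) * ∏ j ∈ K, (y.ph fun x => Ψ x j : ℂ) ^ a j)) := by
        refine (h1.div ?_ (by exact_mod_cast norm_ne_zero_iff.2 hu0)).mul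
          (tendsto_finsetProd _ fun j hj => ?_)
        · exact (Complex.continuous_ofReal.tendsto _).comp h1.norm
        · exact ((isEmbedding_circle_coe.continuous.tendsto _).comp (hph j hj)).pow _
      refine h2.congr' ?_
      filter_upwards [hpt.eventually hev] with b hb
      exact (hΨ.ph_eq_of_factorization hfn (Y b) hb.2.1 (hf _ hb.1) hb.2.2.1 hb.2.2.2.1
        hb.2.2.2.2).symm
    have hlim' : Tendsto (fun b => (Y b).ph f) l (𝓝 (y.ph f)) :=
      isEmbedding_circle_coe.tendsto_nhds_iff.2 hlim
    filter_upwards [hpt (hU.mem_nhds hyU), hlim' (hV.mem_nhds hyV)] with b hb hbV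
    refine ⟨hb, ?_⟩
    rw [← Blowup.ph_eq]
    exact hbV

end ChartPhases

end SemiStable

namespace SemiStable

/-! ### Points of the blow-up defined by paths -/

section Paths

variable {n : ℕ} {X : Type*} [TopologicalSpace X] [ChartedSpace (Model n) X] {S D : Set X}

/-- The phase of `f` has the limit `θ` along the path `γ`. -/
def HasPhase (γ : ℝ → X) (f : X → ℂ) (θ : Circle) : Prop :=
  Tendsto (fun s => f (γ s) / (‖f (γ s)‖ : ℝ)) (𝓝[>] 0) (𝓝 (θ : ℂ))

omit [TopologicalSpace X] [ChartedSpace (Model n) X] in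
theorem HasPhase.unique {γ : ℝ → X} {f : X → ℂ} {θ θ' : Circle} (h : HasPhase γ f θ)
    (h' : HasPhase γ f θ') : θ = θ' :=
  Circle.ext (tendsto_nhds_unique h h')

omit [TopologicalSpace X] [ChartedSpace (Model n) X] in
theorem HasPhase.mul {γ : ℝ → X} {f g : X → ℂ} {θ θ' : Circle} (h : HasPhase γ f θ)
    (h' : HasPhase γ g θ') : HasPhase γ (f * g) (θ * θ') := by
  rw [HasPhase, Circle.coe_mul]
  refine (Tendsto.mul h h').congr fun s => ?_
  simp only [Pi.mul_apply, norm_mul, Complex.ofReal_mul]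
  rw [div_mul_div_comm]

omit [TopologicalSpace X] [ChartedSpace (Model n) X] in
theorem HasPhase.congr {γ : ℝ → X} {f g : X → ℂ} {θ : Circle} (h : HasPhase γ f θ)
    (hfg : ∀ᶠ s : ℝ in 𝓝[>] 0, f (γ s) = g (γ s)) : HasPhase γ g θ :=
  Tendsto.congr' (by filter_upwards [hfg] with s hs; rw [hs]) h

theorem HasPhase.of_continuousAt {γ : ℝ → X} {f : X → ℂ} {θ : Circle} {q : X}
    (h : HasPhase γ f θ) (hγ : Tendsto γ (𝓝[>] 0) (𝓝 q)) (hf : ContinuousAt f q)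
    (h0 : f q ≠ 0) : (θ : ℂ) = f q / (‖f q‖ : ℝ) := by
  have h1 : Tendsto (fun s => f (γ s)) (𝓝[>] 0) (𝓝 (f q)) := hf.tendsto.comp hγ
  exact tendsto_nhds_unique h (h1.div ((Complex.continuous_ofReal.tendsto _).comp h1.norm)
    (by exact_mod_cast norm_ne_zero_iff.2 h0))

theorem exists_circle_eq {z : ℂ} (hz : z ≠ 0) : ∃ θ : Circle, (θ : ℂ) = z / (‖z‖ : ℝ) :=
  ⟨⟨z / (‖z‖ : ℝ), mem_sphere_zero_iff_norm.2 (by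
    rw [norm_div, Complex.norm_real, norm_norm, div_self (norm_ne_zero_iff.2 hz)])⟩, rfl⟩

/-- The point of the blow-up given by a path. -/
noncomputable def Blowup.ofPath {q : X} (hq : q ∈ S) {γ : ℝ → X}
    (hγ : Tendsto γ (𝓝[>] 0) (𝓝[S] q))
    (hex : ∀ f ∈ logMonoid n S D q, ∃ θ, HasPhase γ f θ) : Blowup n S D where
  pt := q
  mem := hq
  phase :=
    { toFun := fun f => (hex f f.2).choose
      map_one' := by
        refine (hex _ (one_mem _)).choose_spec.unique ?_
        refine tendsto_const_nhds.congr fun s => ?_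
        simp
      map_mul' := fun f g => (hex _ (mul_mem f.2 g.2)).choose_spec.unique
        ((hex f f.2).choose_spec.mul (hex g g.2).choose_spec) }
  phase_congr f g h := ((hex f f.2).choose_spec.congr (hγ.eventually h)).unique
    (hex g g.2).choose_spec
  phase_unit f hf := (hex f f.2).choose_spec.of_continuousAt (hγ.mono_right nhdsWithin_le_nhds)
    (HolNear.continuousAt f.2.1) hf

theorem Blowup.hasPhase_ofPath {q : X} (hq : q ∈ S) {γ : ℝ → X}
    (hγ : Tendsto γ (𝓝[>] 0) (𝓝[S] q))
    (hex : ∀ f ∈ logMonoid n S D q, ∃ θ, HasPhase γ f θ) {f : X → ℂ}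
    (hf : f ∈ logMonoid n S D q) : HasPhase γ f ((Blowup.ofPath hq hγ hex).ph f) := by
  rw [Blowup.ph_eq _ (show f ∈ logMonoid n S D (Blowup.ofPath hq hγ hex).pt from hf)]
  exact (hex f hf).choose_spec

/-- Along a path of real points the phases of `conjFn f` are conjugate to those of `f`, and so are
their limits. -/
theorem Blowup.conj_ofPath {π : ComplexDegeneration n X} (ι : RealStructure π)
    (hS : MapsTo ι.inv S S) {q : X} (hq : q ∈ S) (hιq : ι.inv q = q) {γ : ℝ → X}
    (hγ : Tendsto γ (𝓝[>] 0) (𝓝[S] q))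
    (hex : ∀ f ∈ logMonoid n S (π.fibre 0) q, ∃ θ, HasPhase γ f θ)
    (hreal : ∀ᶠ s : ℝ in 𝓝[>] 0, ι.inv (γ s) = γ s) :
    (Blowup.ofPath hq hγ hex).conj ι hS = Blowup.ofPath hq hγ hex := by
  set y := Blowup.ofPath hq hγ hex with hy
  refine Blowup.ext_ph hιq fun f hf => ?_
  have hf' : f ∈ logMonoid n S (π.fibre 0) (ι.inv q) := hf
  have hfc := star_comp_mem_logMonoid ι hS hf'
  rw [hιq] at hf'
  rw [Blowup.ph_conj ι hS y hf]
  have h1 : HasPhase γ (ι.conjFn f) (y.ph (ι.conjFn f)) :=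
    Blowup.hasPhase_ofPath hq hγ hex hfc
  have h2 : HasPhase γ f (y.ph f) := Blowup.hasPhase_ofPath hq hγ hex hf'
  have h3 : HasPhase γ (ι.conjFn f) (y.ph f)⁻¹ := by
    have h4 := (continuous_star.tendsto _).comp h2
    rw [HasPhase, Circle.coe_inv_eq_conj]
    refine h4.congr' ?_
    filter_upwards [hreal] with s hs
    simp [RealStructure.conjFn, hs]
  rw [h1.unique h3, inv_inv]

/-- Phases of holomorphic functions have limits along analytic paths. -/
theorem IsHolChart.exists_hasPhase {Ψ : OpenPartialHomeomorph X (Model n)} (hΨ : IsHolChart Ψ)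
    {q : X} (hq : q ∈ Ψ.source) (v : Model n) {f : X → ℂ} (hf : HolNear n f q)
    (hne : ∀ᶠ s : ℝ in 𝓝[>] 0, f (Ψ.symm (Ψ q + (s : ℂ) • v)) ≠ 0) :
    ∃ θ, HasPhase (fun s : ℝ => Ψ.symm (Ψ q + (s : ℂ) • v)) f θ := by
  set F : ℂ → ℂ := fun ζ => f (Ψ.symm (Ψ q + ζ • v)) with hF
  have hline : Tendsto (fun ζ : ℂ => Ψ q + ζ • v) (𝓝 0) (𝓝 (Ψ q)) := by
    have : Continuous fun ζ : ℂ => Ψ q + ζ • v := by fun_prop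
    simpa using this.tendsto 0
  have hFa : AnalyticAt ℂ F 0 := by
    rw [Complex.analyticAt_iff_eventually_differentiableAt]
    filter_upwards [hline.eventually (hΨ.eventually_differentiableAt hq hf)] with ζ hζ
    exact DifferentiableAt.comp (g := f ∘ Ψ.symm) ζ hζ (by fun_prop)
  have hreal : Tendsto (fun s : ℝ => (s : ℂ)) (𝓝[>] 0) (𝓝 0) := by
    have := (Complex.continuous_ofReal.tendsto 0).mono_left (nhdsWithin_le_nhds (s := Ioi 0))
    simpa using this
  have hF0 : ¬ ∀ᶠ ζ in 𝓝 (0 : ℂ), F ζ = 0 := fun hcon => by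
    obtain ⟨s, hs, hs'⟩ := (hne.and (hreal.eventually hcon)).exists
    exact hs hs'
  -- Along the path `f` is `s ^ m * g s` with `g 0 ≠ 0`. For `s > 0` the power has phase `1`, so the
  -- limit is the phase of `g 0`.
  obtain ⟨m, g, hg, hg0, hFg⟩ := hFa.exists_eventuallyEq_pow_smul_nonzero_iff.2 hF0
  obtain ⟨θ, hθ⟩ := exists_circle_eq hg0
  refine ⟨θ, ?_⟩
  have h1 : Tendsto (fun s : ℝ => g s) (𝓝[>] 0) (𝓝 (g 0)) := hg.continuousAt.tendsto.comp hreal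
  have h2 := h1.div ((Complex.continuous_ofReal.tendsto _).comp h1.norm)
    (by exact_mod_cast norm_ne_zero_iff.2 hg0)
  rw [HasPhase, hθ]
  refine h2.congr' ?_
  filter_upwards [hreal.eventually hFg, self_mem_nhdsWithin] with s hs hs0
  have hs0' : (0 : ℝ) < s := hs0
  change g s / ((‖g s‖ : ℝ) : ℂ) = F s / (‖F s‖ : ℝ)
  rw [hs, sub_zero, smul_eq_mul, norm_mul, norm_pow, Complex.norm_real, Real.norm_of_nonneg hs0'.le,
    Complex.ofReal_mul, Complex.ofReal_pow, mul_div_mul_left]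
  exact pow_ne_zero _ (by exact_mod_cast hs0'.ne')

end Paths

/-! ### Real positive points -/

section RealPositivePoints

variable {n : ℕ} {X : Type*} [TopologicalSpace X] [ChartedSpace (Model n) X]
  {π : ComplexDegeneration n X} {ι : RealStructure π}
  {Ψ : OpenPartialHomeomorph X (Model n)} {K : Finset (Fin n)} {S : Set X}

theorem IsHolChart.ph_fn (hΨ : IsHolChart Ψ) (hfn : ∀ q ∈ Ψ.source, π.fn q = ∏ j ∈ K, Ψ q j)
    (y : Blowup n S (π.fibre 0)) (hy : y.pt ∈ Ψ.source) :
    y.ph π.fn = ∏ j ∈ K, y.ph fun x => Ψ x j := by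
  have hK : ∀ j ∈ K, (fun x => Ψ x j) ∈ logMonoid n S (π.fibre 0) y.pt := fun j hj =>
    hΨ.coord_mem_logMonoid hfn S hy hj
  have h1 := y.ph_prod K hK fun _ => 1
  simp only [pow_one] at h1
  rw [← h1]
  refine y.ph_congr (π.fn_mem_logMonoid S _) (prod_mem hK) ?_
  filter_upwards [Ψ.open_source.mem_nhds hy] with x hx
  rw [hfn x hx, Finset.prod_apply]

theorem ph_fn_of_mem_realPositive {hS : MapsTo ι.inv S S} {y : Blowup n S (π.fibre 0)}
    (hy : y ∈ realPositive ι hS) : y.ph π.fn = 1 :=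
  (y.ph_eq (π.fn_mem_logMonoid S y.pt)).trans hy.2

theorem inv_pt_of_mem_realPositive {hS : MapsTo ι.inv S S} {y : Blowup n S (π.fibre 0)}
    (hy : y ∈ realPositive ι hS) : ι.inv y.pt = y.pt :=
  congrArg Blowup.pt hy.1

variable {m : ℕ} {T : Fin m → Set X}

theorem IsRealChart.conjFn_coord (hΨ : IsRealChart ι T Ψ K) {q : X} (hq : q ∈ Ψ.source)
    (j : Fin n) : (ι.conjFn fun x => Ψ x j) =ᶠ[𝓝 q] fun x => Ψ x j := by
  filter_upwards [Ψ.open_source.mem_nhds hq] with x hx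
  simp [RealStructure.conjFn, hΨ.map_inv x hx]

theorem IsRealChart.star_eq (hΨ : IsRealChart ι T Ψ K) {q : X} (hq : q ∈ Ψ.source)
    (hιq : ι.inv q = q) : star (Ψ q) = Ψ q := by
  rw [← hΨ.map_inv q hq, hιq]

theorem IsRealChart.inv_eq (hΨ : IsRealChart ι T Ψ K) {q : X} (hq : q ∈ Ψ.source)
    (hr : star (Ψ q) = Ψ q) : ι.inv q = q :=
  Ψ.injOn (hΨ.inv_mem q hq) hq ((hΨ.map_inv q hq).trans hr)

/-- Coordinates of a real chart are real functions, so at a real point of the blow-up their phases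
are signs. -/
theorem IsRealChart.ph_coord_inv (hΨ : IsRealChart ι T Ψ K) {hS : MapsTo ι.inv S S}
    {y : Blowup n S (π.fibre 0)} (hy : y ∈ realPositive ι hS) (hys : y.pt ∈ Ψ.source)
    {j : Fin n} (hj : j ∈ K) : (y.ph fun x => Ψ x j)⁻¹ = y.ph fun x => Ψ x j := by
  have hm := hΨ.isHolChart.coord_mem_logMonoid hΨ.fn_eq S hys hj
  have hm' : (fun x => Ψ x j) ∈ logMonoid n S (π.fibre 0) (ι.inv y.pt) := by
    rwa [inv_pt_of_mem_realPositive hy]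
  have h1 := Blowup.ph_conj ι hS y hm'
  have h2 : y.ph (ι.conjFn fun x => Ψ x j) = y.ph fun x => Ψ x j :=
    y.ph_congr (star_comp_mem_logMonoid ι hS hm') hm (hΨ.conjFn_coord hys j)
  rw [hy.1, h2] at h1
  exact h1.symm

/-- Existence of real positive points with given phases of coordinates. -/
theorem IsRealChart.exists_mem_realPositive (hΨ : IsRealChart ι T Ψ K) (hS : MapsTo ι.inv S S)
    (hsat : ∀ x ∈ Ψ.source, ∀ x' ∈ Ψ.source, (∀ j, j ∉ K → Ψ x j = Ψ x' j) → x ∈ S → x' ∈ S)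
    {q : X} (hq : q ∈ Ψ.source) (hqS : q ∈ S) (hιq : ι.inv q = q) {θ : Fin n → Circle}
    (hθ : ∀ j ∈ K, (θ j)⁻¹ = θ j) (hθ1 : ∏ j ∈ K, θ j = 1)
    (hθq : ∀ j ∈ K, Ψ q j = θ j * (‖Ψ q j‖ : ℝ)) :
    ∃ y ∈ realPositive ι hS, y.pt = q ∧ ∀ j ∈ K, (y.ph fun x => Ψ x j) = θ j := by
  classical
  -- Along `γ` the coordinates in `K` are `θ j * (‖Ψ q j‖ + s)`, nonzero and of constant phase,
  -- while the others do not change. So the path leaves the divisor at once, stays in `S` and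
  -- consists of real points.
  let v : Model n := fun j => if j ∈ K then θ j else 0
  let γ : ℝ → X := fun s => Ψ.symm (Ψ q + (s : ℂ) • v)
  have hline : Tendsto (fun s : ℝ => Ψ q + (s : ℂ) • v) (𝓝[>] 0) (𝓝 (Ψ q)) := by
    have h1 : Continuous fun s : ℝ => Ψ q + (s : ℂ) • v := by fun_prop
    have h2 := (h1.tendsto 0).mono_left (nhdsWithin_le_nhds (s := Ioi 0))
    simpa using h2
  have htgt : ∀ᶠ s : ℝ in 𝓝[>] 0, 0 < s ∧ γ s ∈ Ψ.source ∧ Ψ (γ s) = Ψ q + (s : ℂ) • v := by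
    filter_upwards [hline.eventually (Ψ.open_target.mem_nhds (Ψ.map_source hq)),
      self_mem_nhdsWithin] with s hs hs0
    exact ⟨hs0, Ψ.map_target hs, Ψ.right_inv hs⟩
  have hγS : ∀ᶠ s : ℝ in 𝓝[>] 0, γ s ∈ S := by
    filter_upwards [htgt] with s ⟨hs0, hs, hsΨ⟩
    refine hsat q hq _ hs (fun j hj => ?_) hqS
    simp [hsΨ, v, hj]
  have hγ : Tendsto γ (𝓝[>] 0) (𝓝[S] q) :=
    tendsto_nhdsWithin_iff.2 ⟨(Ψ.tendsto_symm hq).comp hline, hγS⟩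
  have hcoord : ∀ j ∈ K, ∀ᶠ s : ℝ in 𝓝[>] 0, Ψ (γ s) j = θ j * ((‖Ψ q j‖ + s : ℝ) : ℂ) ∧
      0 < ‖Ψ q j‖ + s := by
    intro j hj
    filter_upwards [htgt] with s ⟨hs0, hs, hsΨ⟩
    refine ⟨?_, by positivity⟩
    rw [hsΨ, Pi.add_apply, hθq j hj]
    simp only [v, Pi.smul_apply, hj, if_true, smul_eq_mul, norm_mul, Circle.norm_coe, one_mul,
      Complex.norm_real, norm_norm]
    push_cast
    ring
  have hγD : ∀ᶠ s : ℝ in 𝓝[>] 0, γ s ∉ π.fibre 0 := by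
    have h1 : ∀ᶠ s : ℝ in 𝓝[>] 0, ∀ j ∈ K, Ψ (γ s) j ≠ 0 := by
      rw [Finset.eventually_all]
      intro j hj
      filter_upwards [hcoord j hj] with s hs
      rw [hs.1]
      exact mul_ne_zero (Circle.coe_ne_zero _) (by exact_mod_cast hs.2.ne')
    filter_upwards [h1, htgt] with s hs ⟨_, hss, _⟩ hD
    have h2 : π.fn (γ s) = 0 := hD
    rw [hΨ.fn_eq _ hss] at h2
    exact Finset.prod_ne_zero_iff.2 hs h2
  have hex : ∀ f ∈ logMonoid n S (π.fibre 0) q, ∃ θ, HasPhase γ f θ := by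
    rintro f ⟨hf, hfD⟩
    refine hΨ.isHolChart.exists_hasPhase hq v hf ?_
    filter_upwards [hγ.eventually hfD, hγD] with s h1 h2
    exact h1 h2
  have hreal : ∀ᶠ s : ℝ in 𝓝[>] 0, ι.inv (γ s) = γ s := by
    filter_upwards [htgt] with s ⟨hs0, hs, hsΨ⟩
    refine hΨ.inv_eq hs ?_
    rw [hsΨ, star_add, hΨ.star_eq hq hιq]
    congr 1
    funext j
    by_cases hj : j ∈ K
    · have h1 : star (θ j : ℂ) = θ j := by
        rw [RCLike.star_def, ← Circle.coe_inv_eq_conj, hθ j hj]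
      simp only [v, Pi.star_apply, Pi.smul_apply, hj, if_true, smul_eq_mul, star_mul', h1]
      simp
    · simp [v, hj]
  let y := Blowup.ofPath hqS hγ hex
  have hyΨ : ∀ j ∈ K, (y.ph fun x => Ψ x j) = θ j := by
    intro j hj
    refine (Blowup.hasPhase_ofPath hqS hγ hex
      (hΨ.isHolChart.coord_mem_logMonoid hΨ.fn_eq S hq hj)).unique ?_
    refine tendsto_const_nhds.congr' ?_
    filter_upwards [hcoord j hj] with s hs
    rw [hs.1, norm_mul, Circle.norm_coe, one_mul, Complex.norm_real, Real.norm_of_nonneg hs.2.le,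
      mul_div_cancel_right₀]
    exact_mod_cast hs.2.ne'
  refine ⟨y, ⟨Blowup.conj_ofPath ι hS hqS hιq hγ hex hreal, ?_⟩, rfl, hyΨ⟩
  refine (y.ph_eq (π.fn_mem_logMonoid S y.pt)).symm.trans ?_
  rw [hΨ.isHolChart.ph_fn hΨ.fn_eq y hq, Finset.prod_congr rfl hyΨ, hθ1]

/-- A real positive point over a submanifold is a real positive point of its blow-up. -/
theorem IsRealChart.mem_image_incl_iff (hΨ : IsRealChart ι T Ψ K) (hS : MapsTo ι.inv S S)
    (hsat : ∀ x ∈ Ψ.source, ∀ x' ∈ Ψ.source, (∀ j, j ∉ K → Ψ x j = Ψ x' j) → x ∈ S → x' ∈ S)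
    {y : Blowup n univ (π.fibre 0)} (hy : y ∈ realPositive ι (mapsTo_univ ι.inv univ))
    (hys : y.pt ∈ Ψ.source) : y ∈ Blowup.incl '' realPositive ι hS ↔ y.pt ∈ S := by
  constructor
  · rintro ⟨y', -, rfl⟩
    exact y'.mem
  · intro hyS
    obtain ⟨y', hy', hpt, hph⟩ := hΨ.exists_mem_realPositive hS hsat hys hyS
      (inv_pt_of_mem_realPositive hy) (θ := fun j => y.ph fun x => Ψ x j)
      (fun j hj => hΨ.ph_coord_inv hy hys hj)
      ((hΨ.isHolChart.ph_fn hΨ.fn_eq y hys).symm.trans (ph_fn_of_mem_realPositive hy))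
      (fun j hj => y.eq_ph_mul_norm (hΨ.isHolChart.holNear_coord hys j))
    have hy's : y'.pt ∈ Ψ.source := by rwa [hpt]
    refine ⟨y', hy', hΨ.isHolChart.blowup_ext hΨ.fn_eq hpt hy's fun j hj => ?_⟩
    rw [Blowup.ph_incl y' (hΨ.isHolChart.coord_mem_logMonoid hΨ.fn_eq univ hy's hj), hph j hj]

end RealPositivePoints

end SemiStable

namespace SemiStable

/-! ### Orthant charts of the real positive blow-up -/

theorem circle_ofReal_re {θ : Circle} (h : θ⁻¹ = θ) : (((θ : ℂ).re : ℝ) : ℂ) = θ := by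
  rw [← Complex.conj_eq_iff_re, ← Circle.coe_inv_eq_conj, h]

theorem circle_re_mul_self {θ : Circle} (h : θ⁻¹ = θ) : (θ : ℂ).re * (θ : ℂ).re = 1 := by
  have h1 : (θ : ℂ) * θ = 1 := by
    rw [← Circle.coe_mul]
    nth_rewrite 1 [← h]
    simp
  rw [← circle_ofReal_re h] at h1
  exact_mod_cast h1

theorem circle_eq_or_eq_neg {θ θ' : Circle} (h : θ⁻¹ = θ) (h' : θ'⁻¹ = θ') :
    θ = θ' ∨ θ = -θ' := by
  rcases mul_self_eq_mul_self_iff.1 ((circle_re_mul_self h).trans (circle_re_mul_self h').symm)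
    with h1 | h1
  · left
    ext
    rw [← circle_ofReal_re h, ← circle_ofReal_re h', h1]
  · right
    ext
    rw [Circle.coe_neg, ← circle_ofReal_re h, ← circle_ofReal_re h', h1, Complex.ofReal_neg]

section Orthant

variable {n : ℕ} {X : Type*} [TopologicalSpace X] [ChartedSpace (Model n) X]
  {π : ComplexDegeneration n X} {ι : RealStructure π}
  {Ψ : OpenPartialHomeomorph X (Model n)} {K : Finset (Fin n)} {m : ℕ} {T : Fin m → Set X}

/-- The part of the real positive blow-up where the coordinates have given phases. -/
def phaseSource (ι : RealStructure π) (Ψ : OpenPartialHomeomorph X (Model n)) (K : Finset (Fin n))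
    (θ : Fin n → Circle) : Set (RealPositive ι) :=
  {y | y.1.pt ∈ Ψ.source ∧ ∀ j ∈ K, (y.1.ph fun x => Ψ x j) = θ j}

/-- The phases of the coordinates are signs, so prescribing one amounts to excluding the opposite
sign, which is an open condition. -/
theorem IsRealChart.isOpen_phaseSource (hΨ : IsRealChart ι T Ψ K) {θ : Fin n → Circle}
    (hθ : ∀ j ∈ K, (θ j)⁻¹ = θ j) : IsOpen (phaseSource ι Ψ K θ) := by
  rw [isOpen_iff_mem_nhds]
  rintro y ⟨hy, hyθ⟩
  have hptc : Continuous fun y : RealPositive ι => y.1.pt :=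
    Blowup.continuous_pt.comp continuous_subtype_val
  have hs := (hptc.continuousAt (x := y)).eventually (Ψ.open_source.mem_nhds hy)
  have h1 : ∀ᶠ z in 𝓝 y, ∀ j ∈ K, (z.1.ph fun x => Ψ x j) ≠ -θ j := by
    rw [Finset.eventually_all]
    intro j hj
    have hc : ContinuousAt (fun z : RealPositive ι => z.1.ph fun x => Ψ x j) y :=
      (Blowup.continuousAt_ph
        (hΨ.isHolChart.coord_mem_logMonoid hΨ.fn_eq univ hy hj)).comp
        continuous_subtype_val.continuousAt
    refine hc.eventually_ne ?_
    rw [hyθ j hj]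
    exact (Circle.neg_ne_self _).symm
  filter_upwards [hs, h1] with z hz hz1
  exact ⟨hz, fun j hj => (circle_eq_or_eq_neg (hΨ.ph_coord_inv z.2 hz hj) (hθ j hj)).resolve_right
    (hz1 j hj)⟩

/-- Near each of its points the real positive blow-up is an open subset of an orthant. -/
theorem IsRealChart.exists_orthantChart (hΨ : IsRealChart ι T Ψ K) {y₀ : RealPositive ι}
    (hy₀ : y₀.1.pt ∈ Ψ.source) :
    ∃ c : OrthantChart (RealPositive ι) n (fun y => ‖π.fn y.1.pt‖) (fun i => {y | y.1.pt ∈ T i}),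
      y₀ ∈ c.e.source ∧ (∀ y ∈ c.e.source, y.1.pt ∈ Ψ.source) ∧
      ∀ a ∈ c.e.source, ∀ b ∈ c.e.source, dist (c.e a) (c.e b) = dist (Ψ a.1.pt) (Ψ b.1.pt) := by
  classical
  set θ : Fin n → Circle := fun j => if j ∈ K then y₀.1.ph fun x => Ψ x j else 1 with hθdef
  have hθ : ∀ j, (θ j)⁻¹ = θ j := fun j => by
    by_cases hj : j ∈ K
    · simp only [hθdef, hj, if_true]
      exact hΨ.ph_coord_inv y₀.2 hy₀ hj
    · simp [hθdef, hj]
  have hθ0 : ∀ j ∈ K, θ j = y₀.1.ph fun x => Ψ x j := fun j hj => by simp [hθdef, hj]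
  have hθprod : ∏ j ∈ K, θ j = 1 := by
    rw [Finset.prod_congr rfl hθ0, ← hΨ.isHolChart.ph_fn hΨ.fn_eq y₀.1 hy₀]
    exact ph_fn_of_mem_realPositive y₀.2
  let ε : Fin n → ℝ := fun j => (θ j : ℂ).re
  have hεθ : ∀ j, (ε j : ℂ) = θ j := fun j => circle_ofReal_re (hθ j)
  have hεε : ∀ j, ε j * ε j = 1 := fun j => circle_re_mul_self (hθ j)
  have hεε' : ∀ j, (ε j : ℂ) * ε j = 1 := fun j => by exact_mod_cast hεε j
  have hεnorm : ∀ j, ‖(ε j : ℂ)‖ = 1 := fun j => by rw [hεθ, Circle.norm_coe]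
  -- The signs `ε` are the phases at `y₀`, and `1` outside `K`. Where the phases are the same, `co y
  -- j` is `‖Ψ y.1.pt j‖` for `j ∈ K`, which puts the image in the orthant and makes `|π|` the
  -- product of these coordinates.
  let co : RealPositive ι → Fin n → ℝ := fun y j => ε j * (Ψ y.1.pt j).re
  let A : Set (RealPositive ι) := phaseSource ι Ψ K θ
  let W : Set (Fin n → ℝ) := {x | (fun j => (ε j : ℂ) * x j : Model n) ∈ Ψ.target}
  have hιpt : ∀ y : RealPositive ι, ι.inv y.1.pt = y.1.pt := fun y =>
    inv_pt_of_mem_realPositive y.2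
  have hre : ∀ y ∈ A, ∀ j, Ψ y.1.pt j = (ε j : ℂ) * co y j := by
    intro y hy j
    have h1 : star (Ψ y.1.pt j) = Ψ y.1.pt j := congrFun (hΨ.star_eq hy.1 (hιpt y)) j
    have h2 : (((Ψ y.1.pt j).re : ℝ) : ℂ) = Ψ y.1.pt j := Complex.conj_eq_iff_re.1 h1
    simp only [co, Complex.ofReal_mul, ← mul_assoc, hεε', one_mul, h2]
  have hnorm : ∀ y ∈ A, ∀ j ∈ K, co y j = ‖Ψ y.1.pt j‖ := by
    intro y hy j hj
    have h1 := y.1.eq_ph_mul_norm (hΨ.isHolChart.holNear_coord hy.1 j)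
    rw [hy.2 j hj, ← hεθ] at h1
    have h2 := (hre y hy j).symm.trans h1
    have h3 : (ε j : ℂ) ≠ 0 := fun h => by simpa [h] using hεε' j
    exact_mod_cast mul_left_cancel₀ h3 h2
  have hΨco : ∀ y ∈ A, (fun j => (ε j : ℂ) * co y j : Model n) = Ψ y.1.pt := fun y hy =>
    funext fun j => (hre y hy j).symm
  have hbij : BijOn co A (W ∩ orthant K) := by
    refine ⟨?_, ?_, ?_⟩
    · intro y hy
      refine ⟨?_, fun j hj => ?_⟩
      · change (fun j => (ε j : ℂ) * co y j : Model n) ∈ Ψ.target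
        rw [hΨco y hy]
        exact Ψ.map_source hy.1
      · rw [hnorm y hy j hj]
        exact norm_nonneg _
    · intro y hy y' hy' h
      have hpt : y.1.pt = y'.1.pt := Ψ.injOn hy.1 hy'.1 (by rw [← hΨco y hy, ← hΨco y' hy', h])
      exact Subtype.ext (hΨ.isHolChart.blowup_ext hΨ.fn_eq hpt hy.1 fun j hj =>
        (hy.2 j hj).trans (hy'.2 j hj).symm)
    · rintro x ⟨hxW, hxK⟩
      set z : Model n := fun j => (ε j : ℂ) * x j with hz
      have hzW : z ∈ Ψ.target := hxW
      have hzr : star (Ψ (Ψ.symm z)) = Ψ (Ψ.symm z) := by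
        rw [Ψ.right_inv hzW]
        funext j
        simp [hz]
      have hzs := Ψ.map_target hzW
      obtain ⟨y, hy, hypt, hyθ⟩ := hΨ.exists_mem_realPositive (mapsTo_univ ι.inv univ)
        (fun _ _ _ _ _ _ => trivial) hzs (mem_univ _) (hΨ.inv_eq hzs hzr) (θ := θ)
        (fun j _ => hθ j) hθprod (fun j hj => by
          rw [Ψ.right_inv hzW, hz]
          simp only [norm_mul, hεnorm, one_mul, Complex.norm_real]
          rw [Real.norm_of_nonneg (hxK j hj), hεθ])
      have hyA : (⟨y, hy⟩ : RealPositive ι) ∈ A := ⟨by rw [hypt]; exact hzs, hyθ⟩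
      refine ⟨⟨y, hy⟩, hyA, funext fun j => ?_⟩
      change ε j * (Ψ y.pt j).re = x j
      rw [hypt, Ψ.right_inv hzW, hz]
      simp only [Complex.re_ofReal_mul, Complex.ofReal_re]
      rw [← mul_assoc, hεε, one_mul]
  have : Nonempty (RealPositive ι) := ⟨y₀⟩
  have hAo : IsOpen A := hΨ.isOpen_phaseSource fun j _ => hθ j
  have hptc : Continuous fun y : RealPositive ι => y.1.pt :=
    Blowup.continuous_pt.comp continuous_subtype_val
  let e := hbij.toPartialEquiv co A _
  have hsymm : ∀ x ∈ W ∩ orthant K, e.symm x ∈ A ∧ co (e.symm x) = x := fun x hx =>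
    ⟨e.map_target hx, e.right_inv hx⟩
  have hz : Continuous fun x : Fin n → ℝ => (fun j => (ε j : ℂ) * x j : Model n) := by fun_prop
  let c : OrthantChart (RealPositive ι) n (fun y => ‖π.fn y.1.pt‖)
      (fun i => {y | y.1.pt ∈ T i}) :=
    { e := e
      K := K
      W := W
      nonempty := hΨ.nonempty
      isOpen_W := Ψ.open_target.preimage hz
      target_eq := rfl
      open_source := hAo
      continuousOn := by
        refine continuousOn_pi.2 fun j => ?_
        have h1 : ContinuousOn (fun y : RealPositive ι => Ψ y.1.pt) A :=
          Ψ.continuousOn.comp hptc.continuousOn fun y hy => hy.1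
        have h2 : ContinuousOn (fun y : RealPositive ι => Ψ y.1.pt j) A :=
          (continuous_apply j).comp_continuousOn h1
        exact (Complex.continuous_re.comp_continuousOn h2).const_smul (ε j)
      continuousOn_symm := by
        intro x hx
        have hx' := hsymm x hx
        refine tendsto_subtype_rng.2 ?_
        refine hΨ.isHolChart.tendsto_blowup hΨ.fn_eq hx'.1.1 ?_ fun j hj => ?_
        · have hpt : ∀ x ∈ W ∩ orthant K,
              (e.symm x).1.pt = Ψ.symm (fun j => (ε j : ℂ) * x j : Model n) := fun x hx => by
            have h1 := hΨco _ (hsymm x hx).1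
            rw [(hsymm x hx).2] at h1
            rw [h1, Ψ.left_inv (hsymm x hx).1.1]
          rw [hpt x hx]
          have h2 : ContinuousWithinAt
              (fun x : Fin n → ℝ => Ψ.symm (fun j => (ε j : ℂ) * x j : Model n))
              (W ∩ orthant K) x :=
            ((Ψ.continuousAt_symm hx.1).comp (f := fun x : Fin n → ℝ =>
              (fun j => (ε j : ℂ) * x j : Model n)) hz.continuousAt).continuousWithinAt
          refine h2.tendsto.congr' ?_
          filter_upwards [self_mem_nhdsWithin] with x' hx'
          exact (hpt x' hx').symm
        · rw [hx'.1.2 j hj]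
          refine tendsto_const_nhds.congr' ?_
          filter_upwards [self_mem_nhdsWithin] with x' hx'
          exact ((hsymm x' hx').1.2 j hj).symm
      f_eq := fun y hy => by
        change ‖π.fn y.1.pt‖ = ∏ j ∈ K, co y j
        rw [hΨ.fn_eq _ hy.1, norm_prod]
        exact Finset.prod_congr rfl fun j hj => (hnorm y hy j hj).symm
      sat := fun i y hy y' hy' h hyi => by
        refine hΨ.sat i _ hy.1 _ hy'.1 (fun j hj => ?_) hyi
        rw [hre y hy, hre y' hy']
        exact congrArg (fun t : ℝ => (ε j : ℂ) * t) (h j hj) }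
  refine ⟨c, ⟨hy₀, fun j hj => (hθ0 j hj).symm⟩, fun y hy => hy.1, fun a ha b hb => ?_⟩
  change dist (co a) (co b) = dist (Ψ a.1.pt) (Ψ b.1.pt)
  rw [← hΨco a ha, ← hΨco b hb]
  -- Changing signs of coordinates is an isometry.
  have h1 : ∀ j (s t : ℝ), nndist s t = nndist ((ε j : ℂ) * s) ((ε j : ℂ) * t) := by
    intro j s t
    ext
    rw [coe_nndist, coe_nndist, dist_eq_norm ((ε j : ℂ) * s), ← mul_sub, norm_mul, hεnorm, one_mul,
      ← Complex.ofReal_sub, Complex.norm_real, dist_eq_norm]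
  simp only [dist_pi_def, fun j => h1 j (co a j) (co b j)]

end Orthant

end SemiStable

namespace SemiStable

/-! ### Properness -/

section Proper

variable {n : ℕ} {X : Type*} [TopologicalSpace X] [ChartedSpace (Model n) X]
  {π : ComplexDegeneration n X} {ι : RealStructure π} {m : ℕ} {T : Fin m → Set X}

theorem ComplexDegeneration.isCompact_norm_fn_le (π : ComplexDegeneration n X) {b : ℝ}
    (hb : b < 1) : IsCompact {x | ‖π.fn x‖ ≤ b} := by
  have h1 : IsCompact {z : Disc | ‖(z : ℂ)‖ ≤ b} := by
    rw [Subtype.isCompact_iff]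
    convert isCompact_closedBall (0 : ℂ) b using 1
    ext z
    rw [mem_closedBall_zero_iff]
    constructor
    · rintro ⟨z, hz, rfl⟩
      exact hz
    · intro hz
      exact ⟨⟨z, mem_ball_zero_iff.2 (hz.trans_lt hb)⟩, hz, rfl⟩
  exact π.proper.isCompact_preimage h1

/-- For an ultrafilter, the base points converge because `π` is proper, and the phases of
coordinates because the circle is compact. The limit phases are again signs with product `1`,
compatible with the limit point, so `exists_mem_realPositive` provides a point of the blow-up with
these data, and this is the limit. -/
theorem isCompact_realPositive_norm_fn_le [T2Space X]
    (hcharts : ∀ p, ι.inv p = p → ∃ Ψ K, p ∈ Ψ.source ∧ IsRealChart ι T Ψ K) {b : ℝ}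
    (hb : b < 1) : IsCompact ((fun y : RealPositive ι => ‖π.fn y.1.pt‖) ⁻¹' Iic b) := by
  rw [isCompact_iff_ultrafilter_le_nhds]
  intro F hF
  let pt : RealPositive ι → X := fun y => y.1.pt
  obtain ⟨q, hqb, hq⟩ := isCompact_iff_ultrafilter_le_nhds.1 (π.isCompact_norm_fn_le hb)
    (F.map pt) (by
      rw [le_principal_iff] at hF ⊢
      exact hF)
  have hqt : Tendsto pt F (𝓝 q) := hq
  have hιq : ι.inv q = q := by
    have h1 : Tendsto (fun y => ι.inv (pt y)) F (𝓝 (ι.inv q)) :=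
      (ι.continuous_inv.tendsto q).comp hqt
    refine tendsto_nhds_unique h1 (hqt.congr fun y => ?_)
    exact (inv_pt_of_mem_realPositive y.2).symm
  obtain ⟨Ψ, K, hqs, hΨ⟩ := hcharts q hιq
  have hev : ∀ᶠ y in (F : Filter (RealPositive ι)), y.1.pt ∈ Ψ.source :=
    hqt.eventually (Ψ.open_source.mem_nhds hqs)
  have hlim : ∀ j, ∃ θ : Circle, Tendsto (fun y : RealPositive ι => y.1.ph fun x => Ψ x j) F
      (𝓝 θ) := fun j =>
    ⟨(F.map fun y : RealPositive ι => y.1.ph fun x => Ψ x j).lim,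
      Ultrafilter.le_nhds_lim (F.map fun y : RealPositive ι => y.1.ph fun x => Ψ x j)⟩
  choose θ hθ using hlim
  have hθi : ∀ j ∈ K, (θ j)⁻¹ = θ j := fun j hj => by
    refine tendsto_nhds_unique (hθ j).inv ((hθ j).congr' ?_)
    filter_upwards [hev] with y hy
    exact (hΨ.ph_coord_inv y.2 hy hj).symm
  have hθp : ∏ j ∈ K, θ j = 1 := by
    refine tendsto_nhds_unique (tendsto_finsetProd K fun j _ => hθ j)
      (tendsto_const_nhds.congr' ?_)
    filter_upwards [hev] with y hy
    rw [← hΨ.isHolChart.ph_fn hΨ.fn_eq y.1 hy]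
    exact (ph_fn_of_mem_realPositive y.2).symm
  have hΨt : ∀ j, Tendsto (fun y : RealPositive ι => Ψ y.1.pt j) F (𝓝 (Ψ q j)) := fun j =>
    (((continuous_apply j).continuousAt (x := Ψ q)).tendsto.comp (Ψ.continuousAt hqs)).comp hqt
  have hθq : ∀ j ∈ K, Ψ q j = θ j * (‖Ψ q j‖ : ℝ) := fun j _ => by
    have h1 : Tendsto (fun y : RealPositive ι => ((y.1.ph fun x => Ψ x j : Circle) : ℂ)) F
        (𝓝 (θ j)) := (isEmbedding_circle_coe.continuous.tendsto _).comp (hθ j)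
    have h2 := h1.mul ((Complex.continuous_ofReal.tendsto _).comp (hΨt j).norm)
    refine tendsto_nhds_unique ((hΨt j).congr' ?_) h2
    filter_upwards [hev] with y hy
    exact y.1.eq_ph_mul_norm (hΨ.isHolChart.holNear_coord hy j)
  obtain ⟨y, hy, hypt, hyθ⟩ := hΨ.exists_mem_realPositive (mapsTo_univ ι.inv univ)
    (fun _ _ _ _ _ _ => trivial) hqs (mem_univ _) hιq hθi hθp hθq
  refine ⟨⟨y, hy⟩, ?_, ?_⟩
  · change ‖π.fn y.pt‖ ≤ b
    rw [hypt]
    exact hqb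
  · refine (tendsto_subtype_rng (f := id)).2 ?_
    refine hΨ.isHolChart.tendsto_blowup hΨ.fn_eq (by rwa [hypt]) ?_ fun j hj => ?_
    · rw [hypt]
      exact hqt
    · rw [hyθ j hj]
      exact hθ j

end Proper

/-! ### Trivialization -/

section Trivialization

/-- A retraction onto a fibre of a function which is bijective on fibres gives a trivialization. -/
theorem isHomeomorph_retraction_prod {M : Type*} [TopologicalSpace M] [T2Space M] {f : M → ℝ}
    (hf : Continuous f) (hf01 : ∀ y, f y ∈ Ico (0 : ℝ) 1)
    (hcomp : ∀ b < 1, IsCompact (f ⁻¹' Iic b)) {r : M → M}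
    (hbij : ∀ τ ∈ Ico (0 : ℝ) 1, BijOn r {y | f y = τ} {y | f y = 0}) {N : Type*}
    [TopologicalSpace N] [T2Space N] {g : M → N} (hg : Continuous g)
    (hgr : ∀ y y', g y = g y' ↔ r y = r y')
    (hgs : ∀ x, ∃ z, f z = 0 ∧ ∀ y, r y = z → g y = x) :
    IsHomeomorph fun y => (g y, (⟨f y, hf01 y⟩ : Ico (0 : ℝ) 1)) := by
  have hfc : Continuous fun y => (⟨f y, hf01 y⟩ : Ico (0 : ℝ) 1) := hf.subtype_mk _
  have hprop : IsProperMap fun y => (⟨f y, hf01 y⟩ : Ico (0 : ℝ) 1) := by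
    rw [isProperMap_iff_isCompact_preimage]
    refine ⟨hfc, fun s hs => ?_⟩
    rcases s.eq_empty_or_nonempty with rfl | hne
    · simp
    · obtain ⟨b, -, hb⟩ := hs.exists_isMaxOn hne continuous_subtype_val.continuousOn
      refine (hcomp b b.2.2).of_isClosed_subset (hs.isClosed.preimage hfc) fun y hy => ?_
      exact hb hy
  have hcont : Continuous fun y => (g y, (⟨f y, hf01 y⟩ : Ico (0 : ℝ) 1)) := hg.prodMk hfc
  -- Properness of the second component passes to the pair, and a proper continuous bijection is a
  -- homeomorphism.
  have hproper := isProperMap_of_comp_of_t2 hcont continuous_snd hprop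
  rw [isHomeomorph_iff_continuous_isClosedMap_bijective]
  refine ⟨hcont, hproper.isClosedMap, ?_, ?_⟩
  · intro y y' h
    have h1 : r y = r y' := (hgr y y').1 (congrArg Prod.fst h)
    have h2 : f y = f y' := congrArg (fun p => (p.2 : ℝ)) h
    exact (hbij (f y) (hf01 y)).injOn rfl h2.symm h1
  · rintro ⟨x, τ⟩
    obtain ⟨z, hz0, hz⟩ := hgs x
    obtain ⟨y, hy, hyz⟩ := (hbij τ τ.2).surjOn hz0
    exact ⟨y, Prod.ext (hz y hyz) (Subtype.ext hy)⟩

variable {n : ℕ} {X : Type*} [TopologicalSpace X] [ChartedSpace (Model n) X]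
  {π : ComplexDegeneration n X} {ι : RealStructure π} {m : ℕ} {T : Fin m → Set X}

/-- The real positive blow-up retracts onto the real positive special fibre. -/
theorem exists_retraction_realPositive [T2Space X]
    (hcharts : ∀ p, ι.inv p = p → ∃ Ψ K, p ∈ Ψ.source ∧ IsRealChart ι T Ψ K) :
    ∃ r : RealPositive ι → RealPositive ι, Continuous r ∧
      (∀ τ ∈ Ico (0 : ℝ) 1, BijOn r {y | ‖π.fn y.1.pt‖ = τ} {y | ‖π.fn y.1.pt‖ = 0}) ∧
      ∀ y i, (r y).1.pt ∈ T i ↔ y.1.pt ∈ T i := by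
  have hptc : Continuous fun y : RealPositive ι => y.1.pt :=
    Blowup.continuous_pt.comp continuous_subtype_val
  have hfn : Continuous π.fn := continuous_iff_continuousAt.2 fun p =>
    (π.holNear_fn p).continuousAt
  have hf : Continuous fun y : RealPositive ι => ‖π.fn y.1.pt‖ := (hfn.comp hptc).norm
  have hex : ∀ y : RealPositive ι, ∃ (Ψ : OpenPartialHomeomorph X (Model n))
      (c : OrthantChart (RealPositive ι) n (fun y => ‖π.fn y.1.pt‖) fun i => {y | y.1.pt ∈ T i}),
      IsHolChart Ψ ∧ y ∈ c.e.source ∧ (∀ y ∈ c.e.source, y.1.pt ∈ Ψ.source) ∧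
      ∀ a ∈ c.e.source, ∀ b ∈ c.e.source, dist (c.e a) (c.e b) = dist (Ψ a.1.pt) (Ψ b.1.pt) := by
    intro y
    obtain ⟨Ψ, K, hy, hΨ⟩ := hcharts y.1.pt (inv_pt_of_mem_realPositive y.2)
    obtain ⟨c, h1, h2, h3⟩ := hΨ.exists_orthantChart hy
    exact ⟨Ψ, c, hΨ.isHolChart, h1, h2, h3⟩
  choose Ψ c hΨ hc hcΨ hcd using hex
  refine exists_retraction_of_orthantCharts hf (fun _ => norm_nonneg _)
    (fun y => (π.norm_fn_mem y.1.pt).2) (fun b hb => isCompact_realPositive_norm_fn_le hcharts hb)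
    c hc ?_
  -- Distances in orthant charts are those in holomorphic charts, whose coordinate changes are
  -- continuously differentiable and hence locally Lipschitz.
  rintro x z y ⟨hyx, hyz⟩
  obtain ⟨L, U, hU, hL⟩ := ((hΨ z).contDiffAt_transition (hΨ x) (hcΨ z y hyz)
    (hcΨ x y hyx)).exists_lipschitzOnWith
  have hUz : ∀ᶠ a in 𝓝 y, Ψ z a.1.pt ∈ U :=
    (((Ψ z).continuousAt (hcΨ z y hyz)).tendsto.comp hptc.continuousAt.tendsto).eventually hU
  refine ⟨L, _, hUz.and (((c x).open_source.eventually_mem hyx).and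
    ((c z).open_source.eventually_mem hyz)),
    ?_⟩
  rintro a ⟨haU, hax, haz⟩ b ⟨hbU, hbx, hbz⟩
  rw [hcd x a hax b hbx, hcd z a haz b hbz]
  have := hL.dist_le_mul _ haU _ hbU
  simpa [(Ψ z).left_inv (hcΨ z a haz), (Ψ z).left_inv (hcΨ z b hbz)] using this

end Trivialization

/-! ### Points over the punctured disc -/

section Punctured

variable {n : ℕ} {X : Type*} [TopologicalSpace X] [ChartedSpace (Model n) X]
  {π : ComplexDegeneration n X} {ι : RealStructure π} {m : ℕ} {T : Fin m → Set X}

/-- Outside the divisor the blow-down map is injective. -/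
theorem Blowup.eq_of_pt_eq {D : Set X} {y y' : Blowup n univ D} (h : y.pt = y'.pt)
    (hD : y.pt ∉ D) : y = y' := by
  refine Blowup.ext_ph h fun f hf => ?_
  have h0 : f y.pt ≠ 0 := by
    have := hf.2
    rw [nhdsWithin_univ] at this
    exact this.self_of_nhds hD
  ext
  rw [y.ph_unit hf.1 h0, y'.ph_unit (h ▸ hf.1) (h ▸ h0), h]

/-- Off the divisor the phases have to be those of the coordinates at `q`. They are signs because
`q` is real, and their product is the phase of `t`, which is `1` as `t > 0`. -/
theorem IsRealChart.exists_pt_eq {Ψ : OpenPartialHomeomorph X (Model n)} {K : Finset (Fin n)}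
    (hΨ : IsRealChart ι T Ψ K) {q : X} (hq : q ∈ Ψ.source) (hιq : ι.inv q = q) {t : ℝ}
    (ht : 0 < t) (hqt : π.fn q = t) : ∃ y : RealPositive ι, y.1.pt = q := by
  have hprod : ∏ j ∈ K, Ψ q j = t := by rw [← hΨ.fn_eq q hq, hqt]
  have hne : ∀ j ∈ K, Ψ q j ≠ 0 := by
    rw [← Finset.prod_ne_zero_iff, hprod]
    exact_mod_cast ht.ne'
  have hex : ∀ j ∈ K, ∃ θ : Circle, (θ : ℂ) = Ψ q j / (‖Ψ q j‖ : ℝ) := fun j hj =>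
    exists_circle_eq (hne j hj)
  choose! θ hθ using hex
  obtain ⟨y, hy, hyq, -⟩ := hΨ.exists_mem_realPositive (mapsTo_univ ι.inv univ)
    (fun _ _ _ _ _ _ => trivial) hq (mem_univ _) hιq (θ := θ) (fun j hj => by
      ext
      have h1 : star (Ψ q j) = Ψ q j := congrFun (hΨ.star_eq hq hιq) j
      rw [Circle.coe_inv_eq_conj, hθ j hj, map_div₀, Complex.conj_ofReal]
      congr 1) (by
      ext
      rw [circle_coe_prod, Finset.prod_congr rfl hθ, Finset.prod_div_distrib, hprod,
        ← Complex.ofReal_prod, ← norm_prod, hprod, Complex.norm_real, Real.norm_of_nonneg ht.le,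
        div_self (by exact_mod_cast ht.ne')]
      rfl) (fun j hj => by
      rw [hθ j hj, div_mul_cancel₀]
      exact_mod_cast norm_ne_zero_iff.2 (hne j hj))
  exact ⟨⟨y, hy⟩, hyq⟩

end Punctured

end SemiStable

/-! ### Submanifolds and fibres of the real positive blow-up -/

namespace SemiStable

section Subsets

variable {n : ℕ} {X : Type*} [TopologicalSpace X] [ChartedSpace (Model n) X]
  {π : ComplexDegeneration n X} {ι : RealStructure π} {m : ℕ} {T : Fin m → Set X}

theorem mem_realPositiveSub_iff
    (hcharts : ∀ p, ι.inv p = p → ∃ Ψ K, p ∈ Ψ.source ∧ IsRealChart ι T Ψ K) {i : Fin m}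
    (hS : MapsTo ι.inv (T i) (T i)) (y : RealPositive ι) :
    y ∈ realPositiveSub ι hS ↔ y.1.pt ∈ T i := by
  obtain ⟨Ψ, K, hy, hΨ⟩ := hcharts y.1.pt (inv_pt_of_mem_realPositive y.2)
  exact hΨ.mem_image_incl_iff hS (hΨ.sat i) y.2 hy

theorem mem_realPositiveSpecialSub_iff
    (hcharts : ∀ p, ι.inv p = p → ∃ Ψ K, p ∈ Ψ.source ∧ IsRealChart ι T Ψ K) {i : Fin m}
    (hS : MapsTo ι.inv (T i) (T i)) (y : RealPositiveSpecial ι) :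
    y ∈ realPositiveSpecialSub ι hS ↔ y.1.pt ∈ T i := by
  have hy := y.2
  have hy' : y.1 ∈ realPositive ι (mapsTo_univ ι.inv univ) := ⟨hy.1, hy.2.1⟩
  have h := mem_realPositiveSub_iff hcharts hS ⟨y.1, hy'⟩
  rw [← h]
  constructor
  · rintro ⟨z, hz, hzy⟩
    exact ⟨z, ⟨hz.1, hz.2.1⟩, hzy⟩
  · rintro ⟨z, hz, hzy⟩
    refine ⟨z, ⟨hz.1, hz.2, ?_⟩, hzy⟩
    have h1 : ‖π.fn y.1.pt‖ = 0 := hy.2.2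
    change ‖π.fn z.pt‖ = 0
    rw [← h1]
    exact congrArg (fun w : Blowup n univ (π.fibre 0) => ‖π.fn w.pt‖) hzy

/-- Needed to turn a continuous bijection from the special fibre to a real fibre into a
homeomorphism. -/
theorem compactSpace_realPositiveSpecial [T2Space X]
    (hcharts : ∀ p, ι.inv p = p → ∃ Ψ K, p ∈ Ψ.source ∧ IsRealChart ι T Ψ K) :
    CompactSpace (RealPositiveSpecial ι) := by
  rw [← isCompact_iff_compactSpace]
  convert (isCompact_realPositive_norm_fn_le hcharts zero_lt_one).image continuous_subtype_val
  ext y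
  constructor
  · intro hy
    exact ⟨⟨y, hy.1, hy.2.1⟩, le_of_eq hy.2.2, rfl⟩
  · rintro ⟨z, hz, rfl⟩
    exact ⟨z.2.1, z.2.2, le_antisymm hz (norm_nonneg _)⟩

/-- The phase of `π` is `1` on the real positive part. -/
theorem fn_pt_eq_norm (y : RealPositive ι) : π.fn y.1.pt = (‖π.fn y.1.pt‖ : ℝ) := by
  have h := y.1.eq_ph_mul_norm (π.holNear_fn y.1.pt)
  rwa [ph_fn_of_mem_realPositive y.2, Circle.coe_one, one_mul] at h

end Subsets

end SemiStable

/-! ### The trivialization theorem -/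

open SemiStable in
theorem mainTheorem4 {n m : ℕ} {X : Type*} [TopologicalSpace X] [T2Space X]
    [ChartedSpace (Fin n → ℂ) X] [IsManifold 𝓘(ℂ, Fin n → ℂ) ω X]
    (π : ComplexDegeneration n X) (ι : RealStructure π) (hι : ι.IsTotallyReal)
    (S : Fin m → Set X) (hS : ∀ i, ι.IsRealSubmanifold (S i)) (hT : π.IsTransversal S) :
    (∃ H : RealPositiveSpecial ι × Ico (0 : ℝ) 1 ≃ₜ RealPositive ι,
      (∀ x t, π.blowupMap (H (x, t)).1 = (1, t)) ∧
      ∀ i, H '' (realPositiveSpecialSub ι (hS i).2 ×ˢ univ) = realPositiveSub ι (hS i).2) ∧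
    ∀ t ∈ Ioo (0 : ℝ) 1, ∃ G : RealPositiveSpecial ι ≃ₜ RealFibre ι t,
      ∀ i, G '' realPositiveSpecialSub ι (hS i).2 = {x : RealFibre ι t | x.1 ∈ S i} := by
  have hcharts : ∀ p, ι.inv p = p → ∃ Ψ K, p ∈ Ψ.source ∧ IsRealChart ι S Ψ K := fun p hp =>
    exists_isRealChart hι hS hT hp
  obtain ⟨r, hr, hbij, hrS⟩ := exists_retraction_realPositive hcharts
  have hptc : Continuous fun y : RealPositive ι => y.1.pt :=
    Blowup.continuous_pt.comp continuous_subtype_val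
  have hfn : Continuous π.fn := continuous_iff_continuousAt.2 fun p =>
    (π.holNear_fn p).continuousAt
  have hr0 : ∀ y, ‖π.fn (r y).1.pt‖ = 0 := fun y =>
    (hbij _ (π.norm_fn_mem y.1.pt)).mapsTo rfl
  let g : RealPositive ι → RealPositiveSpecial ι := fun y =>
    ⟨(r y).1, (r y).2.1, (r y).2.2, hr0 y⟩
  have hg : Continuous g := (continuous_subtype_val.comp hr).subtype_mk _
  have hhomeo := isHomeomorph_retraction_prod (hfn.comp hptc).norm
    (fun y : RealPositive ι => π.norm_fn_mem y.1.pt)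
    (fun b hb => isCompact_realPositive_norm_fn_le hcharts hb) hbij hg
    (fun y y' => ⟨fun h => Subtype.ext (congrArg (fun x => x.1) h),
      fun h => Subtype.ext (congrArg (fun x => x.1) h)⟩)
    (fun x => ⟨⟨x.1, x.2.1, x.2.2.1⟩, x.2.2.2, fun y hy =>
      Subtype.ext (congrArg (fun z => z.1) hy)⟩)
  -- `Φ` combines retraction and level. Its inverse is the required trivialization, which respects
  -- the `S i` because the retraction does.
  let Φ := hhomeo.homeomorph
  have hΦ1 : ∀ x t, g (Φ.symm (x, t)) = x := fun x t =>
    congrArg Prod.fst (Φ.apply_symm_apply (x, t))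
  have hΦ2 : ∀ x (t : Ico (0 : ℝ) 1), ‖π.fn (Φ.symm (x, t)).1.pt‖ = t := fun x t =>
    congrArg (fun z => (z.2 : ℝ)) (Φ.apply_symm_apply (x, t))
  have hΦS : ∀ x t i, (Φ.symm (x, t)).1.pt ∈ S i ↔ x.1.pt ∈ S i := fun x t i => by
    rw [← hrS]
    have h1 : (r (Φ.symm (x, t))).1 = x.1 := congrArg Subtype.val (hΦ1 x t)
    rw [h1]
  refine ⟨⟨Φ.symm, fun x t => Prod.ext (Φ.symm (x, t)).2.2 (Subtype.ext (hΦ2 x t)), fun i => ?_⟩,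
    fun t ht => ?_⟩
  · ext y
    obtain ⟨⟨x, t⟩, rfl⟩ := Φ.symm.surjective y
    rw [Φ.symm.injective.mem_set_image, mem_realPositiveSub_iff hcharts, hΦS, mem_prod,
      mem_realPositiveSpecialSub_iff hcharts]
    simp
  · have ht' : t ∈ Ico (0 : ℝ) 1 := ⟨ht.1.le, ht.2⟩
    -- The slice of the trivialization at level `t`, followed by the blow-down map. The latter is
    -- injective off the divisor, and every real point of the fibre lifts because `t > 0`.
    let G : RealPositiveSpecial ι → RealFibre ι t := fun x =>
      ⟨(Φ.symm (x, ⟨t, ht'⟩)).1.pt, inv_pt_of_mem_realPositive (Φ.symm (x, ⟨t, ht'⟩)).2, by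
        rw [fn_pt_eq_norm, hΦ2]⟩
    have hG : Continuous G :=
      (hptc.comp (Φ.symm.continuous.comp (continuous_id.prodMk continuous_const))).subtype_mk _
    have hGinj : Function.Injective G := by
      intro x x' h
      have h1 : (Φ.symm (x, ⟨t, ht'⟩)).1.pt = (Φ.symm (x', ⟨t, ht'⟩)).1.pt :=
        congrArg Subtype.val h
      have h2 : Φ.symm (x, ⟨t, ht'⟩) = Φ.symm (x', ⟨t, ht'⟩) := by
        refine Subtype.ext (Blowup.eq_of_pt_eq h1 fun h0 => ?_)
        have h3 : π.fn (Φ.symm (x, ⟨t, ht'⟩)).1.pt = 0 := h0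
        have h4 := hΦ2 x ⟨t, ht'⟩
        rw [h3, norm_zero] at h4
        exact ht.1.ne h4
      exact congrArg Prod.fst (Φ.symm.injective h2)
    have hGsurj : Function.Surjective G := by
      rintro ⟨q, hιq, hqt⟩
      obtain ⟨Ψ, K, hq, hΨ⟩ := hcharts q hιq
      obtain ⟨y, hy⟩ := hΨ.exists_pt_eq hq hιq ht.1 hqt
      obtain ⟨⟨x, τ⟩, rfl⟩ := Φ.symm.surjective y
      have h1 := hΦ2 x τ
      rw [hy, hqt, Complex.norm_real, Real.norm_of_nonneg ht.1.le] at h1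
      have h2 : τ = ⟨t, ht'⟩ := Subtype.ext h1.symm
      subst h2
      exact ⟨x, Subtype.ext hy⟩
    have := compactSpace_realPositiveSpecial hcharts
    let e : RealPositiveSpecial ι ≃ RealFibre ι t := Equiv.ofBijective G ⟨hGinj, hGsurj⟩
    refine ⟨Continuous.homeoOfEquivCompactToT2 (f := e) hG, fun i => ?_⟩
    ext q
    obtain ⟨x, rfl⟩ := hGsurj q
    change G x ∈ G '' _ ↔ (Φ.symm (x, ⟨t, ht'⟩)).1.pt ∈ S i
    rw [hGinj.mem_set_image, mem_realPositiveSpecialSub_iff hcharts, hΦS]
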